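/- **Setting.** Let $n=\ell+r$, $m\ge 0$ be integers. Let $\Lambda_0=\mathrm{diag}(\lambda_1,\dots,\lambda_n)\in C^1([0,1];\mathbb R^{n\times n})$ with $\lambda_i>0$ on $[0,1]$ for $i\le \ell$ and $\lambda_i<0$ on $[0,1]$ for $i>\ell$, let $\Lambda_1\in C^1([0,1];\mathbb R^{n\times n})$, $K\in\mathbb R^{n\times n}$, $B\in\mathbb R^{n\times m}$, $L_1,L_2\in\mathbb R^{m\times n}$, $k_i>0$, $K_i\in\mathbb R^{m\times m}$ invertible, $w_b\in\mathbb R^n$ and $w_y,y_{ref}\in\mathbb R^m$. Write $\phi=(\phi_+,\phi_-)\in\mathbb R^\ell\times\mathbb R^{r}$. Consider the closed loop with state $v=(\phi,z)$, for $t\ge 0$, $s\in(0,1)$: $$\phi_t+\Lambda_0(s)\phi_s+\Lambda_1(s)\phi=0,\qquad \begin{bmatrix}\phi_+(t,0)\\ \phi_-(t,1)\end{bmatrix}=K\begin{bmatrix}\phi_+(t,1)\\ \phi_-(t,0)\end{bmatrix}+Bu(t)+w_b,$$ $$u=k_iK_iz,\qquad \dot z=y-y_{ref},\qquad y(t)=L_1\begin{bmatrix}\phi_+(t,0)\\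 \phi_-(t,1)\end{bmatrix}+L_2\begin{bmatrix}\phi_+(t,1)\\ \phi_-(t,0)\end{bmatrix}+w_y .$$ Let $\mathcal X_e=L^2((0,1),\mathbb R^n)\times\mathbb R^m$ with norm $\|(\phi,z)\|_{\mathcal X_e}=\|\phi\|_{L^2}+|z|$, and $\mathcal X_{e1}=H^1((0,1),\mathbb R^n)\times\mathbb R^m$. An initial state $v_0=(\phi_0,z_0)\in\mathcal X_{e1}$ is called *compatible* if $\phi_0$ satisfies the boundary condition with $u=k_iK_iz_0$. A *weak solution* issued from $v_0\in\mathcal X_e$ is a $v\in C^0([0,\infty);\mathcal X_e)$ with $v(0)=v_0$ that satisfies, for every $T>0$, the identity obtained by testing the system against $C^1$ functions $(\psi(t,s),\eta(t))$ on $[0,T]$ that satisfy the adjoint boundary condition and integrating by parts in $t$ and $s$; a *strong solution* is a $v\in C^0([0,\infty);\mathcal X_{e1})\cap C^1([0,\infty);\mathcal X_e)$ with $v(0)=v_0$ that satisfies the system for all $t\ge0$ (the first equation for almost every $s$). An *equilibrium* is a $v_\infty=(\phi_\infty,z_\infty)\in\mathcal X_{e1}$ such that the constant $v(t)=v_\infty$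 satisfies the system. **Rank condition.** Let $\Phi$ solve $\Phi_s=-\Lambda_0^{-1}\Lambda_1\Phi$ on $[0,1]$, $\Phi(0)=\mathrm{Id}_n$, with blocks $\Phi_{11},\Phi_{12},\Phi_{21},\Phi_{22}$ along $n=\ell+r$, and put $$\Phi_+(1)=\begin{bmatrix}\Phi_{11}(1)&\Phi_{12}(1)\\0&\mathrm{Id}_{r}\end{bmatrix},\qquad \Phi_-(1)=\begin{bmatrix}\mathrm{Id}_\ell&0\\ \Phi_{21}(1)&\Phi_{22}(1)\end{bmatrix}.$$ Assume that $\Phi_-(1)-K\Phi_+(1)$ and $T_1=\left(L_1\Phi_-(1)+L_2\Phi_+(1)\right)\left(\Phi_-(1)-K\Phi_+(1)\right)^{-1}B$ are both invertible. **Lyapunov condition.** Assume moreover that, for the equilibrium $v_\infty$ (which the rank condition provides), there are a functional $V_e:\mathcal X_e\to\mathbb R_+$ and constants $L_e,\mu_e>0$ such that $$\frac1{L_e}\|v_\infty-v\|_{\mathcal X_e}^2\le V_e(v)\le L_e\|v_\infty-v\|_{\mathcal X_e}^2\qquad\text{for all }v\in\mathcal X_e,$$ and such that, for every $v_0\in\mathcal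 X_e$, every weak solution $v$ issued from $v_0$ and every $t_0\ge0$ at which $v$ is $C^1$ as a function with values in $\mathcal X_e$, the function $t\mapsto V_e(v(t))$ is differentiable at $t_0$ (from the right if $t_0=0$) and $\frac{d}{dt}V_e(v(t))\big|_{t=t_0}\le-\mu_eV_e(v(t_0))$. **Conclusion.** 1. For every $v_0\in\mathcal X_e$ there is a unique weak solution issued from $v_0$. For every compatible $v_0\in\mathcal X_{e1}$ there is a unique strong solution, and it is also the weak solution. 2. There is a unique equilibrium $v_\infty$, and it is globally exponentially stable in $\mathcal X_e$: there are $k,\nu>0$ such that, for every $v_0\in\mathcal X_e$, the weak solution satisfies $\|v(t)-v_\infty\|_{\mathcal X_e}\le k e^{-\nu t}\|v_0-v_\infty\|_{\mathcal X_e}$ for all $t\ge0$. 3. For every compatible $v_0\in\mathcal X_{e1}$, the output of the strong solution satisfies $\lim_{t\to+\infty}|y(t)-y_{ref}|=0$. -/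

import Mathlib

open MeasureTheory Set Filter Topology
open scoped Matrix ContDiff

noncomputable section

namespace HypReg

/-- Lebesgue measure on the space interval `(0,1)`. -/
abbrev μ01 : Measure ℝ := volume.restrict (Ioo (0 : ℝ) 1)

/-- Components of `φ = (φ₊, φ₋)`: `ℓ` with positive speed, `r = n - ℓ` with negative speed. -/
abbrev Idx (ℓ r : ℕ) : Type := Fin ℓ ⊕ Fin r

/-- `L²((0,1), ℝⁿ)`, with `ℝⁿ` carrying its Euclidean norm. -/
abbrev L2 (ℓ r : ℕ) : Type := Lp (EuclideanSpace ℝ (Idx ℓ r)) 2 μ01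

/-- The state space `L²((0,1), ℝⁿ) × ℝᵐ`. Its norm is `stateNorm`; the instance norm of the
product is equivalent to it and is only used for continuity and differentiability. -/
abbrev State (ℓ r m : ℕ) : Type := L2 ℓ r × EuclideanSpace ℝ (Fin m)

/-- `‖(φ, z)‖ = ‖φ‖_{L²} + |z|`. -/
def stateNorm {ℓ r m : ℕ} (v : State ℓ r m) : ℝ := ‖v.1‖ + ‖v.2‖

/-- `δ ∈ L²` is the weak derivative of `φ ∈ L²` on `(0,1)`. -/
def HasWeakDeriv {ℓ r : ℕ} (φ δ : L2 ℓ r) : Prop :=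
  ∀ χ : ℝ → ℝ, ContDiff ℝ ∞ χ → HasCompactSupport χ → tsupport χ ⊆ Ioo (0 : ℝ) 1 →
    ∫ s, deriv χ s • φ s ∂μ01 = - ∫ s, χ s • δ s ∂μ01

/-- `f` is, on `[0,1]`, the continuous representative of the class `φ`. For `φ ∈ H¹(0,1)` it
exists; the boundary values of `φ` are those of `f` at `0` and `1`. -/
def IsContRep {ℓ r : ℕ} (f : ℝ → EuclideanSpace ℝ (Idx ℓ r)) (φ : L2 ℓ r) : Prop :=
  ContinuousOn f (Icc (0 : ℝ) 1) ∧ (φ : ℝ → EuclideanSpace ℝ (Idx ℓ r)) =ᵐ[μ01] f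

/-- `(f₊(0), f₋(1))`. -/
def inflow {ℓ r : ℕ} (f : ℝ → EuclideanSpace ℝ (Idx ℓ r)) : Idx ℓ r → ℝ :=
  Sum.elim (fun i => f 0 (Sum.inl i)) (fun j => f 1 (Sum.inr j))

/-- `(f₊(1), f₋(0))`. -/
def outflow {ℓ r : ℕ} (f : ℝ → EuclideanSpace ℝ (Idx ℓ r)) : Idx ℓ r → ℝ :=
  Sum.elim (fun i => f 1 (Sum.inl i)) (fun j => f 0 (Sum.inr j))

/-- Data of the closed loop
`φ_t + Λ₀(s) φ_s + Λ₁(s) φ = 0` on `(0,1)`, `Λ₀ = diag(lam)`,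
`(φ₊(t,0), φ₋(t,1)) = K (φ₊(t,1), φ₋(t,0)) + B u + wb`,
`y = L₁ (φ₊(t,0), φ₋(t,1)) + L₂ (φ₊(t,1), φ₋(t,0)) + wy`,
`u = ki Ki z`, `z_t = y - yref`. -/
structure ClosedLoop (ℓ r m : ℕ) where
  lam : Idx ℓ r → ℝ → ℝ
  Λ₁ : ℝ → Matrix (Idx ℓ r) (Idx ℓ r) ℝ
  K : Matrix (Idx ℓ r) (Idx ℓ r) ℝ
  B : Matrix (Idx ℓ r) (Fin m) ℝ
  L₁ : Matrix (Fin m) (Idx ℓ r) ℝ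
  L₂ : Matrix (Fin m) (Idx ℓ r) ℝ
  ki : ℝ
  Ki : Matrix (Fin m) (Fin m) ℝ
  wb : Idx ℓ r → ℝ
  wy : Fin m → ℝ
  yref : Fin m → ℝ
  lam_C1 : ∀ i, ContDiffOn ℝ 1 (lam i) (Icc 0 1)
  lam_pos : ∀ i : Fin ℓ, ∀ s ∈ Icc (0 : ℝ) 1, 0 < lam (Sum.inl i) s
  lam_neg : ∀ j : Fin r, ∀ s ∈ Icc (0 : ℝ) 1, lam (Sum.inr j) s < 0
  Λ₁_C1 : ∀ i j, ContDiffOn ℝ 1 (fun s => Λ₁ s i j) (Icc 0 1)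
  ki_pos : 0 < ki
  Ki_full_rank : IsUnit Ki.det

namespace ClosedLoop

variable {ℓ r m : ℕ} (D : ClosedLoop ℓ r m)

/-- `Λ₀(s)`. -/
def Λ₀ (s : ℝ) : Matrix (Idx ℓ r) (Idx ℓ r) ℝ := Matrix.diagonal (fun i => D.lam i s)

/-- `Φ` solves `Φ_s = -Λ₀⁻¹ Λ₁ Φ` on `[0,1]`, `Φ(0) = Id`. -/
def IsFundamental (Φ : ℝ → Matrix (Idx ℓ r) (Idx ℓ r) ℝ) : Prop :=
  Φ 0 = 1 ∧ ∀ s ∈ Icc (0 : ℝ) 1, ∀ i j,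
    HasDerivWithinAt (fun σ => Φ σ i j) ((-((D.Λ₀ s)⁻¹ * D.Λ₁ s * Φ s)) i j) (Icc 0 1) s

/-- `[Φ₁₁ Φ₁₂; 0 Id]`. -/
def plusPart (M : Matrix (Idx ℓ r) (Idx ℓ r) ℝ) : Matrix (Idx ℓ r) (Idx ℓ r) ℝ :=
  Matrix.fromBlocks M.toBlocks₁₁ M.toBlocks₁₂ 0 1

/-- `[Id 0; Φ₂₁ Φ₂₂]`. -/
def minusPart (M : Matrix (Idx ℓ r) (Idx ℓ r) ℝ) : Matrix (Idx ℓ r) (Idx ℓ r) ℝ :=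
  Matrix.fromBlocks 1 0 M.toBlocks₂₁ M.toBlocks₂₂

/-- The rank condition, on the value at `1` of the fundamental matrix: `Φ₋(1) - K Φ₊(1)` and
`T₁ = (L₁ Φ₋(1) + L₂ Φ₊(1)) (Φ₋(1) - K Φ₊(1))⁻¹ B` are both of full rank. -/
def RankCondition : Prop :=
  ∃ Φ : ℝ → Matrix (Idx ℓ r) (Idx ℓ r) ℝ, D.IsFundamental Φ ∧
    IsUnit (minusPart (Φ 1) - D.K * plusPart (Φ 1)).det ∧
    IsUnit ((D.L₁ * minusPart (Φ 1) + D.L₂ * plusPart (Φ 1)) *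
      (minusPart (Φ 1) - D.K * plusPart (Φ 1))⁻¹ * D.B).det

/-- `B u + wb` with the feedback `u = ki Ki z`. -/
def actuation (z : EuclideanSpace ℝ (Fin m)) : Idx ℓ r → ℝ :=
  D.B *ᵥ (D.ki • (D.Ki *ᵥ z.ofLp)) + D.wb

/-- The boundary condition, for a profile with continuous representative `f`. -/
def BC (f : ℝ → EuclideanSpace ℝ (Idx ℓ r)) (z : EuclideanSpace ℝ (Fin m)) : Prop :=
  inflow f = D.K *ᵥ outflow f + D.actuation z

/-- The output `y` of a profile with continuous representative `f`. -/
def output (f : ℝ → EuclideanSpace ℝ (Idx ℓ r)) : EuclideanSpace ℝ (Fin m) :=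
  WithLp.toLp 2 (D.L₁ *ᵥ inflow f + D.L₂ *ᵥ outflow f + D.wy)

/-- `v = (φ, z)` lies in `H¹ × ℝᵐ` with `φ_s = δ`, satisfies the boundary condition, and
`dv = (-Λ₀ δ - Λ₁ φ, y - yref)`, i.e. `dv` is the right-hand side of the closed loop at `v`. -/
def IsRHS (v : State ℓ r m) (δ : L2 ℓ r) (dv : State ℓ r m) : Prop :=
  HasWeakDeriv v.1 δ ∧
  (∀ᵐ s ∂μ01, (dv.1 s).ofLp = -(D.Λ₀ s *ᵥ (δ s).ofLp) - D.Λ₁ s *ᵥ (v.1 s).ofLp) ∧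
  ∃ f, IsContRep f v.1 ∧ D.BC f v.2 ∧ dv.2 = D.output f - WithLp.toLp 2 D.yref

/-- Equilibrium: a state at which the right-hand side is defined and vanishes. -/
def IsEquilibrium (v : State ℓ r m) : Prop := ∃ δ, D.IsRHS v δ 0

/-- Initial data in `H¹ × ℝᵐ` satisfying the boundary condition. -/
def Compatible (v₀ : State ℓ r m) : Prop :=
  (∃ δ, HasWeakDeriv v₀.1 δ) ∧ ∃ f, IsContRep f v₀.1 ∧ D.BC f v₀.2

/-- `y₀` is the output at the state `v`; its `φ`-component lies in `H¹`. -/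
def IsOutput (v : State ℓ r m) (y₀ : EuclideanSpace ℝ (Fin m)) : Prop :=
  (∃ δ, HasWeakDeriv v.1 δ) ∧ ∃ f, IsContRep f v.1 ∧ y₀ = D.output f

/-- Strong solution on `[0,∞)`, of class `C⁰([0,∞); H¹ × ℝᵐ) ∩ C¹([0,∞); L² × ℝᵐ)`. -/
def IsStrongSol (v₀ : State ℓ r m) (v : ℝ → State ℓ r m) : Prop :=
  v 0 = v₀ ∧ ContDiffOn ℝ 1 v (Ici 0) ∧
  ∃ δ : ℝ → L2 ℓ r, ContinuousOn δ (Ici 0) ∧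
    ∀ t, 0 ≤ t → D.IsRHS (v t) (δ t) (derivWithin v (Ici 0) t)

/-- `(λ₊(1) ψ₊(1), -λ₋(0) ψ₋(0))`: what multiplies `(φ₊(1), φ₋(0))` in the boundary term
`ψ(1)ᵀ Λ₀(1) φ(1) - ψ(0)ᵀ Λ₀(0) φ(0)`. -/
def testOut (g : ℝ → Idx ℓ r → ℝ) : Idx ℓ r → ℝ :=
  Sum.elim (fun i => D.lam (Sum.inl i) 1 * g 1 (Sum.inl i))
    (fun j => -(D.lam (Sum.inr j) 0 * g 0 (Sum.inr j)))

/-- `(-λ₊(0) ψ₊(0), λ₋(1) ψ₋(1))`: what multiplies `(φ₊(0), φ₋(1))` in the same term. -/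
def testIn (g : ℝ → Idx ℓ r → ℝ) : Idx ℓ r → ℝ :=
  Sum.elim (fun i => -(D.lam (Sum.inl i) 0 * g 0 (Sum.inl i)))
    (fun j => D.lam (Sum.inr j) 1 * g 1 (Sum.inr j))

/-- `C¹` test functions `ψ(t,s)`, `η(t)` on `[0,T]` satisfying the adjoint boundary condition,
which makes the unknown trace `(φ₊(t,1), φ₋(t,0))` disappear from the weak formulation. -/
def IsTest (T : ℝ) (ψ : ℝ → ℝ → Idx ℓ r → ℝ) (η : ℝ → Fin m → ℝ) : Prop :=
  ContDiff ℝ 1 (fun p : ℝ × ℝ => ψ p.1 p.2) ∧ ContDiff ℝ 1 η ∧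
  ∀ t ∈ Icc (0 : ℝ) T,
    D.testOut (ψ t) + D.Kᵀ *ᵥ D.testIn (ψ t) = (D.L₁ * D.K + D.L₂)ᵀ *ᵥ η t

/-- `⟨(φ, z), (ψ, η)⟩ = ∫₀¹ φᵀ ψ ds + zᵀ η`. -/
def pairing (v : State ℓ r m) (g : ℝ → Idx ℓ r → ℝ) (e : Fin m → ℝ) : ℝ :=
  (∫ s, (v.1 s).ofLp ⬝ᵥ g s ∂μ01) + v.2.ofLp ⬝ᵥ e

/-- `ψ_t + (Λ₀ ψ)_s - Λ₁ᵀ ψ` at `(t,s)`. -/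
def adjointExpr (ψ : ℝ → ℝ → Idx ℓ r → ℝ) (t s : ℝ) : Idx ℓ r → ℝ :=
  fun i => deriv (fun τ => ψ τ s i) t + deriv (fun σ => D.lam i σ * ψ t σ i) s
    - ((D.Λ₁ s)ᵀ *ᵥ ψ t s) i

/-- Weak solution on `[0,∞)` in `C⁰([0,∞); L² × ℝᵐ)`: the identity obtained by testing the closed
loop against `(ψ, η)` on `[0,T]` and integrating by parts in `t` and `s`. -/
def IsWeakSol (v₀ : State ℓ r m) (v : ℝ → State ℓ r m) : Prop :=
  v 0 = v₀ ∧ ContinuousOn v (Ici 0) ∧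
  ∀ T : ℝ, 0 < T → ∀ ψ η, D.IsTest T ψ η →
    pairing (v T) (ψ T) (η T) - pairing v₀ (ψ 0) (η 0) =
      ∫ t in (0 : ℝ)..T,
        (pairing (v t) (D.adjointExpr ψ t) (deriv η t)
          - (D.testIn (ψ t) - D.L₁ᵀ *ᵥ η t) ⬝ᵥ D.actuation (v t).2
          + η t ⬝ᵥ (D.wy - D.yref))

/-- Existence and uniqueness of the weak solution for every initial state, and of the strong
solution, which is also the weak one, for compatible initial states in `H¹ × ℝᵐ`. -/
def WellPosed : Prop :=
  (∀ v₀, ∃ v, D.IsWeakSol v₀ v ∧ ∀ w, D.IsWeakSol v₀ w → EqOn w v (Ici 0)) ∧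
  (∀ v₀, D.Compatible v₀ → ∃ v, D.IsStrongSol v₀ v ∧ D.IsWeakSol v₀ v ∧
    ∀ w, D.IsStrongSol v₀ w → EqOn w v (Ici 0))

/-- `V` is equivalent to the squared distance to `vinf`, with constant `L`, and satisfies
`dV/dt ≤ -μ V` at every time at which a solution is of class `C¹`. -/
def IsLyapunov (vinf : State ℓ r m) (V : State ℓ r m → ℝ) (L μ : ℝ) : Prop :=
  (∀ v, 0 ≤ V v) ∧
  (∀ v, stateNorm (vinf - v) ^ 2 / L ≤ V v ∧ V v ≤ L * stateNorm (vinf - v) ^ 2) ∧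
  ∀ v₀ v, D.IsWeakSol v₀ v → ∀ t₀, 0 ≤ t₀ → ContDiffWithinAt ℝ 1 v (Ici 0) t₀ →
    ∃ d, HasDerivWithinAt (fun t => V (v t)) d (Ici 0) t₀ ∧ d ≤ -μ * V (v t₀)

/-- Global exponential stability of `vinf`. -/
def ExpStable (vinf : State ℓ r m) : Prop :=
  ∃ k ν : ℝ, 0 < k ∧ 0 < ν ∧ ∀ v₀ v, D.IsWeakSol v₀ v → ∀ t, 0 ≤ t →
    stateNorm (v t - vinf) ≤ k * Real.exp (-ν * t) * stateNorm (v₀ - vinf)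

/-- Output regulation along strong solutions. -/
def Regulated : Prop :=
  ∀ v₀, D.Compatible v₀ → ∀ v, D.IsStrongSol v₀ v →
    ∃ y : ℝ → EuclideanSpace ℝ (Fin m), (∀ t, 0 ≤ t → D.IsOutput (v t) (y t)) ∧
      Tendsto (fun t => ‖y t - WithLp.toLp 2 D.yref‖) atTop (𝓝 0)

end ClosedLoop

end HypReg

end

/-! The rank condition yields an equilibrium by linear algebra on the profile `Φ c`: inverting
`Φ₋(1) - K Φ₊(1)` meets the boundary condition, and inverting `T₁` tunes the input so that the
output equals `yref`. Subtracting the equilibrium turns the affine closed loop into a homogeneous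
linear one, encoded by duality in `LinRHS`: `x` is in the domain with image `y` when the pair
balances the formal adjoint on all time-independent tests. Thus the generator is by definition an
adjoint relation, hence closed, and `IsRHS.weakRHS` together with `WeakRHS.exists_isRHS` identifies
the weak right-hand side with the strong one (H¹ profile, boundary condition, output).

Generation follows a dual form of the Lumer–Phillips theorem, `exists_resolvent` and
`exists_semigroup`: the adjoint of a dissipative relation `T` generates a contraction semigroup once
it is densely defined and has no positive eigenvalue. Dissipativity, up to a shift by `β`, is an
energy estimate with an affine weight in `s` (`exists_dissipative_weight`), small at the ends where
the adjoint boundary condition prescribes the traces. Density is tested on explicit smooth states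
(`eq_zero_of_forall_linRHS`). The absence of positive eigenvalues needs no resolvent equation: an
eigenvector `x` would give the growing `C¹` solution `vinf + exp (c t) x`, which contradicts
Lyapunov decay.

The Lyapunov functional is differentiable only along solutions at times where they are `C¹`, so
`IsLyapunov.decay` covers `C¹` solutions only. Two devices remove this restriction. For uniqueness,
the time integral of the difference of two weak solutions is a `C¹` solution of the homogeneous
system starting at `0`, hence vanishes (`weakSol_unique`). For stability, data in the domain give
`C¹` solutions, and the estimate passes to all data by density and continuity of the semigroup. Weak
solutions for arbitrary data are likewise limits of `C¹` ones (`isWeakSol_of_tendsto`).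

Regulation uses that the time derivative of a strong solution is itself an orbit `S t y` of the
homogeneous semigroup, and that its second component is exactly the output minus `yref`; exponential
decay of the orbit in the state norm therefore gives convergence of the output. -/

noncomputable section

namespace HypReg

/-! ### Semigroups generated by adjoints of dissipative relations. -/

section Generation

variable {H : Type*} [NormedAddCommGroup H] [InnerProductSpace ℝ H]

/-- The adjoint of the linear relation `T`. -/
def AdjGraph (T : Submodule ℝ (H × H)) (x y : H) : Prop :=
  ∀ τ ∈ T, inner ℝ x τ.2 = inner ℝ y τ.1

namespace AdjGraph

variable {T : Submodule ℝ (H × H)} {x y x' y' : H}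

theorem add (h : AdjGraph T x y) (h' : AdjGraph T x' y') : AdjGraph T (x + x') (y + y') := by
  intro τ hτ
  rw [inner_add_left, inner_add_left, h τ hτ, h' τ hτ]

theorem smul (c : ℝ) (h : AdjGraph T x y) : AdjGraph T (c • x) (c • y) := by
  intro τ hτ
  rw [real_inner_smul_left, real_inner_smul_left, h τ hτ]

theorem of_tendsto {u w : ℕ → H} (h : ∀ n, AdjGraph T (u n) (w n))
    (hu : Tendsto u atTop (𝓝 x)) (hw : Tendsto w atTop (𝓝 y)) : AdjGraph T x y := by
  intro τ hτ
  refine tendsto_nhds_unique (hu.inner tendsto_const_nhds) ?_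
  simp_rw [fun n => h n τ hτ]
  exact hw.inner tendsto_const_nhds

end AdjGraph

/-- The uniformly continuous semigroup generated by `B`. -/
abbrev expOp (B : H →L[ℝ] H) (t : ℝ) : H →L[ℝ] H := NormedSpace.exp (t • B)

theorem commute_expOp {B C : H →L[ℝ] H} (h : Commute B C) (t : ℝ) : Commute B (expOp C t) :=
  (h.smul_right t).exp_right

variable [CompleteSpace H]

/-- Dissipativity bounds `c - T` from below on the closure of `T`, so its range is closed; a vector
orthogonal to the range is an eigenvector of the adjoint for `c`, so the range is everything. The
resolvent of the adjoint relation is then the Hilbert adjoint of `(c - T)⁻¹`, with the same norm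
bound `c⁻¹`. -/
theorem exists_resolvent (T : Submodule ℝ (H × H))
    (hT : ∀ τ ∈ T, inner ℝ τ.2 τ.1 ≤ 0)
    (hinj : ∀ c : ℝ, 0 < c → ∀ x, AdjGraph T x (c • x) → x = 0) {c : ℝ} (hc : 0 < c) :
    ∃ R : H →L[ℝ] H, (∀ h, ‖R h‖ ≤ c⁻¹ * ‖h‖) ∧ (∀ h, AdjGraph T (R h) (c • R h - h)) ∧
      ∀ x y, AdjGraph T x y → R (c • x - y) = x := by
  have hT' : ∀ τ ∈ T.topologicalClosure, inner ℝ τ.2 τ.1 ≤ 0 := by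
    intro τ hτ
    have hcl : IsClosed {τ : H × H | inner ℝ τ.2 τ.1 ≤ 0} :=
      isClosed_le (continuous_snd.inner continuous_fst) continuous_const
    exact closure_minimal (s := (T : Set (H × H))) (fun τ h => hT τ h) hcl hτ
  let P : T.topologicalClosure →L[ℝ] H :=
    (c • ContinuousLinearMap.fst ℝ H H - ContinuousLinearMap.snd ℝ H H).comp
      T.topologicalClosure.subtypeL
  have hP : ∀ τ, P τ = c • (τ : H × H).1 - (τ : H × H).2 := fun τ => rfl
  have hP1 : ∀ τ : T.topologicalClosure, c * ‖(τ : H × H).1‖ ≤ ‖P τ‖ := by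
    intro τ
    have h1 : c * ‖(τ : H × H).1‖ ^ 2 ≤ inner ℝ (P τ) (τ : H × H).1 := by
      rw [hP, inner_sub_left, real_inner_smul_left, real_inner_self_eq_norm_sq]
      linarith [hT' τ τ.2]
    have h2 := h1.trans (real_inner_le_norm _ _)
    rcases (norm_nonneg (τ : H × H).1).eq_or_lt with h0 | h0
    · rw [← h0, mul_zero]; exact norm_nonneg _
    · nlinarith
  have hP2 : ∀ τ : T.topologicalClosure, ‖τ‖ ≤ (c⁻¹ + 2) * ‖P τ‖ := by
    intro τ
    have h1 := hP1 τ
    have h0 := norm_nonneg (P τ)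
    have hci : 0 < c⁻¹ := inv_pos.2 hc
    have h3 : ‖(τ : H × H).1‖ ≤ c⁻¹ * ‖P τ‖ := by
      rw [inv_mul_eq_div, le_div_iff₀ hc]; linarith
    have h2 : ‖(τ : H × H).2‖ ≤ 2 * ‖P τ‖ := by
      have : (τ : H × H).2 = c • (τ : H × H).1 - P τ := by rw [hP]; abel
      rw [this]
      refine (norm_sub_le _ _).trans ?_
      rw [norm_smul, Real.norm_of_nonneg hc.le]; linarith
    change max ‖(τ : H × H).1‖ ‖(τ : H × H).2‖ ≤ _
    apply max_le <;> nlinarith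
  have hanti : AntilipschitzWith (Real.toNNReal (c⁻¹ + 2)) P := by
    apply AddMonoidHomClass.antilipschitz_of_bound
    intro τ
    rw [Real.coe_toNNReal _ (by positivity)]
    exact hP2 τ
  have hclosed : IsClosed (Set.range P) := hanti.isClosed_range P.uniformContinuous
  have hsurj : Function.Surjective P := by
    have htop : (LinearMap.range P.toLinearMap).topologicalClosure = ⊤ := by
      rw [Submodule.topologicalClosure_eq_top_iff, Submodule.eq_bot_iff]
      intro u hu
      apply hinj c hc
      intro τ hτ
      have := hu (P ⟨τ, T.le_topologicalClosure hτ⟩) ⟨_, rfl⟩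
      rw [hP, real_inner_comm, inner_sub_right, real_inner_smul_right] at this
      rw [real_inner_smul_left]; linarith
    intro h
    have : h ∈ (LinearMap.range P.toLinearMap).topologicalClosure := by rw [htop]; trivial
    have h' : h ∈ closure (Set.range P) := this
    rwa [hclosed.closure_eq] at h'
  let e := LinearEquiv.ofBijective P.toLinearMap ⟨hanti.injective, hsurj⟩
  have he : ∀ h, P (e.symm h) = h := fun h => e.apply_symm_apply h
  let Q : H →L[ℝ] H := LinearMap.mkContinuous
    (LinearMap.fst ℝ H H ∘ₗ T.topologicalClosure.subtype ∘ₗ e.symm.toLinearMap) c⁻¹ (by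
      intro h
      have := hP1 (e.symm h)
      rw [he] at this
      rw [inv_mul_eq_div, le_div_iff₀ hc]
      change ‖((e.symm h : T.topologicalClosure) : H × H).1‖ * c ≤ _
      linarith)
  have hQ : ∀ h, Q h = ((e.symm h : T.topologicalClosure) : H × H).1 := fun h => rfl
  have hQP : ∀ τ, Q (P τ) = (τ : H × H).1 := by
    intro τ
    rw [hQ, show P τ = e τ from rfl, e.symm_apply_apply]
  have hQn : ‖Q‖ ≤ c⁻¹ := LinearMap.mkContinuous_norm_le _ (by positivity) _
  refine ⟨ContinuousLinearMap.adjoint Q, ?_, ?_, ?_⟩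
  · intro h
    refine (ContinuousLinearMap.le_opNorm _ _).trans ?_
    gcongr
    rwa [LinearIsometryEquiv.norm_map]
  · intro h τ hτ
    have := hQP ⟨τ, T.le_topologicalClosure hτ⟩
    have h1 := ContinuousLinearMap.adjoint_inner_left Q (P ⟨τ, T.le_topologicalClosure hτ⟩) h
    rw [this, hP, inner_sub_right, real_inner_smul_right] at h1
    rw [inner_sub_left, real_inner_smul_left]
    dsimp only at h1
    linarith
  · intro x y hxy
    refine ext_inner_right ℝ fun w => ?_
    rw [ContinuousLinearMap.adjoint_inner_left, hQ]
    conv_rhs => rw [← he w, hP]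
    have hcl : ∀ τ ∈ T.topologicalClosure, inner ℝ x τ.2 = inner ℝ y τ.1 := by
      intro τ hτ
      have hcl : IsClosed {τ : H × H | inner ℝ x τ.2 = inner ℝ y τ.1} :=
        isClosed_eq (continuous_const.inner continuous_snd) (continuous_const.inner continuous_fst)
      exact closure_minimal (s := (T : Set (H × H))) (fun τ h => hxy τ h) hcl hτ
    have := hcl _ (e.symm w).2
    rw [inner_sub_left, inner_sub_right, real_inner_smul_left, real_inner_smul_right, this]

theorem hasDerivAt_expOp (B : H →L[ℝ] H) (x : H) (t : ℝ) :
    HasDerivAt (fun s => expOp B s x) (expOp B t (B x)) t :=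
  ((hasDerivAt_exp_smul_const B t).clm_apply (hasDerivAt_const t x)).congr_deriv (by simp)

/-- The derivative of `‖exp (s B) x‖ ^ 2` is `2 ⟨B z, z⟩ ≤ 0` with `z = exp (s B) x`. -/
theorem norm_expOp_le {B : H →L[ℝ] H} (hB : ∀ x, inner ℝ (B x) x ≤ 0) (x : H) {t : ℝ}
    (ht : 0 ≤ t) : ‖expOp B t x‖ ≤ ‖x‖ := by
  have hd : ∀ s, HasDerivAt (fun s => ‖expOp B s x‖ ^ 2)
      (2 * inner ℝ (expOp B s x) (expOp B s (B x))) s := fun s => (hasDerivAt_expOp B x s).norm_sq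
  have hanti : Antitone (fun s => ‖expOp B s x‖ ^ 2) := by
    refine antitone_of_hasDerivAt_nonpos hd fun s => ?_
    have hc : expOp B s (B x) = B (expOp B s x) :=
      (DFunLike.congr_fun (commute_expOp (Commute.refl B) s) x).symm
    change 2 * inner ℝ (expOp B s x) (expOp B s (B x)) ≤ 0
    rw [hc, real_inner_comm]
    linarith [hB (expOp B s x)]
  have := hanti ht
  simp only [expOp, zero_smul, NormedSpace.exp_zero, one_apply_eq_self] at this
  exact le_of_sq_le_sq this (norm_nonneg _)

/-- The path `s ↦ exp (s B) exp ((t - s) C) x` joins the two exponentials. By commutation its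
derivative is a product of contractions applied to `B x - C x`. This is the Cauchy estimate for
Yosida approximations. -/
theorem norm_expOp_sub_le {B C : H →L[ℝ] H} (hB : ∀ x, inner ℝ (B x) x ≤ 0)
    (hC : ∀ x, inner ℝ (C x) x ≤ 0) (hBC : Commute B C) (x : H) {t : ℝ} (ht : 0 ≤ t) :
    ‖expOp B t x - expOp C t x‖ ≤ t * ‖B x - C x‖ := by
  have hd : ∀ s, HasDerivAt (fun s => expOp B s (expOp C (t - s) x))
      (expOp B s (expOp C (t - s) (B x - C x))) s := by
    intro s
    have h1 : HasDerivAt (fun s => expOp C (t - s) x) (-(expOp C (t - s) (C x))) s := by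
      simpa [Function.comp_def] using
        (hasDerivAt_expOp C x (t - s)).scomp s ((hasDerivAt_id s).const_sub t)
    refine ((hasDerivAt_exp_smul_const B s).clm_apply h1).congr_deriv ?_
    have hc : B (expOp C (t - s) x) = expOp C (t - s) (B x) :=
      DFunLike.congr_fun (commute_expOp hBC (t - s)) x
    simp only [mul_apply_eq_comp, map_sub, map_neg]
    rw [hc]
    abel
  have h := norm_image_sub_le_of_norm_deriv_le_segment' (f := fun s => expOp B s (expOp C (t - s) x))
    (C := ‖B x - C x‖) (a := 0) (b := t) (fun s _ => (hd s).hasDerivWithinAt)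
    (fun s hs => (norm_expOp_le hB _ hs.1).trans (norm_expOp_le hC _ (by linarith [hs.2])))
    t ⟨ht, le_rfl⟩
  simpa [expOp, mul_comm] using h

theorem norm_expOp_sub_expOp_le {B : H →L[ℝ] H} (hB : ∀ x, inner ℝ (B x) x ≤ 0) (x : H) {s t : ℝ}
    (hs : 0 ≤ s) (ht : 0 ≤ t) : ‖expOp B t x - expOp B s x‖ ≤ ‖B x‖ * ‖t - s‖ :=
  (convex_Ici (0 : ℝ)).norm_image_sub_le_of_norm_hasDerivWithin_le
    (fun r _ => (hasDerivAt_expOp B x r).hasDerivWithinAt)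
    (fun _ hr => norm_expOp_le hB _ hr) hs ht

/-- A maximal dissipative relation with dense domain generates a contraction semigroup. -/
theorem exists_semigroup (T : Submodule ℝ (H × H))
    (hT : ∀ τ ∈ T, inner ℝ τ.2 τ.1 ≤ 0)
    (hinj : ∀ c : ℝ, 0 < c → ∀ x, AdjGraph T x (c • x) → x = 0)
    (hdense : Dense {x | ∃ y, AdjGraph T x y}) :
    ∃ S : ℝ → H →L[ℝ] H, (∀ t x, ‖S t x‖ ≤ ‖x‖) ∧ (∀ x, S 0 x = x) ∧
      (∀ x, Continuous fun t => S t x) ∧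
      ∀ x y, AdjGraph T x y → ∀ t, 0 ≤ t →
        HasDerivWithinAt (fun s => S s x) (S t y) (Ici 0) t ∧ AdjGraph T (S t x) (S t y) := by
  have hc : ∀ n : ℕ, (0 : ℝ) < n + 1 := fun n => by positivity
  choose R hRn hR1 hR2 using fun n : ℕ => exists_resolvent T hT hinj (hc n)
  have hRcomm : ∀ m n, Commute (R m) (R n) := by
    -- The resolvent identity; dividing it by `m - n` gives commutation.
    have key : ∀ (m n : ℕ) (h : H), R n h = ((m : ℝ) - n) • R m (R n h) + R m h := by
      intro m n h
      have h1 := hR2 m _ _ (hR1 n h)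
      have h2 : ((m : ℝ) + 1) • R n h - (((n : ℝ) + 1) • R n h - h) = ((m : ℝ) - n) • R n h + h := by
        module
      rw [h2, map_add, map_smul] at h1
      exact h1.symm
    intro m n
    rcases eq_or_ne m n with rfl | hmn
    · exact Commute.refl _
    · ext h
      have h1 := key m n h
      have h2 := key n m h
      have hne : ((m : ℝ) - n) ≠ 0 := sub_ne_zero.2 (by exact_mod_cast hmn)
      refine (smul_right_injective H hne) ?_
      change ((m : ℝ) - n) • R m (R n h) = ((m : ℝ) - n) • R n (R m h)
      have e1 : ((m : ℝ) - n) • R m (R n h) = R n h - R m h := by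
        rw [eq_sub_iff_add_eq]; exact h1.symm
      have e2 : ((n : ℝ) - m) • R n (R m h) = R m h - R n h := by
        rw [eq_sub_iff_add_eq]; exact h2.symm
      rw [e1, ← neg_sub (n : ℝ) m, neg_smul, e2, neg_sub]
  -- Yosida approximations at the parameter `n + 1`, which stays positive at `n = 0`.
  let Y : ℕ → H →L[ℝ] H := fun n => ((n : ℝ) + 1) • (((n : ℝ) + 1) • R n - 1)
  have hY : ∀ n x, Y n x = ((n : ℝ) + 1) • (((n : ℝ) + 1) • R n x - x) := fun n x => rfl
  have hYG : ∀ (n : ℕ) (x y : H), AdjGraph T x y → Y n x = ((n : ℝ) + 1) • R n y := by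
    intro n x y h
    have := hR2 n x y h
    rw [map_sub, map_smul] at this
    rw [hY]
    congr 1
    rw [sub_eq_iff_eq_add] at this ⊢
    rw [this]; abel
  have hYR : ∀ m n, Commute (Y m) (R n) := fun m n =>
    (((hRcomm m n).smul_left _).sub_left (Commute.one_left _)).smul_left _
  have hYY : ∀ m n, Commute (Y m) (Y n) := fun m n =>
    (((hYR m n).smul_right _).sub_right (Commute.one_right _)).smul_right _
  have hcR : ∀ (n : ℕ) (x : H), ‖((n : ℝ) + 1) • R n x‖ ≤ ‖x‖ := by
    intro n x
    rw [norm_smul, Real.norm_of_nonneg (hc n).le, ← le_div_iff₀' (hc n), div_eq_inv_mul]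
    exact hRn n x
  have hYd : ∀ n x, inner ℝ (Y n x) x ≤ 0 := by
    intro n x
    rw [hY, real_inner_smul_left, inner_sub_left, real_inner_self_eq_norm_sq]
    have h1 := (real_inner_le_norm (((n : ℝ) + 1) • R n x) x).trans
      (mul_le_mul_of_nonneg_right (hcR n x) (norm_nonneg x))
    have := hc n
    nlinarith
  -- On the domain the error is `R n y`, of size at most `‖y‖ / (n + 1)`; density and the uniform
  -- bound `hcR` handle the other vectors.
  have hcRt : ∀ x, Tendsto (fun n : ℕ => ((n : ℝ) + 1) • R n x) atTop (𝓝 x) := by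
    intro x
    rw [Metric.tendsto_atTop]
    intro ε hε
    obtain ⟨x', hx', y, hxy⟩ := Metric.dense_iff.1 hdense x (ε / 3) (by positivity)
    obtain ⟨N, hN⟩ := exists_nat_gt (‖y‖ / (ε / 3))
    refine ⟨N, fun n hn => ?_⟩
    have h1 : ((n : ℝ) + 1) • R n x' - x' = R n y := by
      have := hYG n x' y hxy
      rw [hY] at this
      exact smul_right_injective H (hc n).ne' this
    have h2 : ‖R n y‖ < ε / 3 := by
      refine (hRn n y).trans_lt ?_
      rw [inv_mul_eq_div, div_lt_iff₀ (hc n)]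
      rw [div_lt_iff₀ (by positivity)] at hN
      have : (N : ℝ) ≤ n := by exact_mod_cast hn
      nlinarith
    have h3 : ((n : ℝ) + 1) • R n x - x =
        ((n : ℝ) + 1) • R n (x - x') + (((n : ℝ) + 1) • R n x' - x') - (x - x') := by
      rw [map_sub]; module
    have h4 : ‖x - x'‖ < ε / 3 := by rw [← dist_eq_norm, dist_comm]; exact hx'
    rw [dist_eq_norm, h3, h1]
    calc _ ≤ ‖((n : ℝ) + 1) • R n (x - x')‖ + ‖R n y‖ + ‖x - x'‖ :=
          (norm_sub_le _ _).trans (by gcongr; exact norm_add_le _ _)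
      _ < ε := by have := hcR n (x - x'); linarith
  have hYt : ∀ x y, AdjGraph T x y → Tendsto (fun n => Y n x) atTop (𝓝 y) := by
    intro x y h
    simp_rw [fun n => hYG n x y h]
    exact hcRt y
  have hnorm : ∀ n x t, 0 ≤ t → ‖expOp (Y n) t x‖ ≤ ‖x‖ := fun n x t ht =>
    norm_expOp_le (hYd n) x ht
  have hcauchy : ∀ t, 0 ≤ t → ∀ x, CauchySeq fun n => expOp (Y n) t x := by
    intro t ht x
    rw [Metric.cauchySeq_iff]
    intro ε hε
    obtain ⟨x', hx', y, hxy⟩ := Metric.dense_iff.1 hdense x (ε / 3) (by positivity)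
    have h4 : ‖x - x'‖ < ε / 3 := by rw [← dist_eq_norm, dist_comm]; exact hx'
    obtain ⟨N, hN⟩ := Metric.cauchySeq_iff.1 (hYt x' y hxy).cauchySeq (ε / 3 / (t + 1))
      (by positivity)
    refine ⟨N, fun m hm n hn => ?_⟩
    have h5 := hN m hm n hn
    rw [dist_eq_norm, lt_div_iff₀ (by positivity)] at h5
    have h6 := norm_expOp_sub_le (hYd m) (hYd n) (hYY m n) x' ht
    have h7 : expOp (Y m) t x - expOp (Y n) t x = expOp (Y m) t (x - x') +
        (expOp (Y m) t x' - expOp (Y n) t x') - expOp (Y n) t (x - x') := by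
      simp only [map_sub]; abel
    rw [dist_eq_norm, h7]
    have h8 := hnorm m (x - x') t ht
    have h9 := hnorm n (x - x') t ht
    have h10 := norm_nonneg (Y m x' - Y n x')
    calc _ ≤ ‖expOp (Y m) t (x - x')‖ + ‖expOp (Y m) t x' - expOp (Y n) t x'‖
            + ‖expOp (Y n) t (x - x')‖ :=
          (norm_sub_le _ _).trans (by gcongr; exact norm_add_le _ _)
      _ < ε := by nlinarith
  choose S₀ hS₀ using fun t : {t : ℝ // 0 ≤ t} => fun x => cauchySeq_tendsto_of_complete
    (hcauchy t t.2 x)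
  -- Negative times are frozen at `0`, so that the contraction and continuity statements hold on all
  -- of `ℝ`.
  let S : ℝ → H →L[ℝ] H := fun t => LinearMap.mkContinuous
    { toFun := S₀ ⟨max t 0, le_max_right _ _⟩
      map_add' := fun x y => tendsto_nhds_unique (hS₀ _ (x + y))
        (by simpa only [map_add] using (hS₀ _ x).add (hS₀ _ y))
      map_smul' := fun a x => tendsto_nhds_unique (hS₀ _ (a • x))
        (by simpa only [map_smul, RingHom.id_apply] using (hS₀ _ x).const_smul a) } 1 (by
      intro x
      rw [one_mul]
      exact le_of_tendsto (hS₀ _ x).norm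
        (Eventually.of_forall fun n => hnorm n x _ (le_max_right _ _)))
  have hSlim : ∀ t, 0 ≤ t → ∀ x, Tendsto (fun n => expOp (Y n) t x) atTop (𝓝 (S t x)) := by
    intro t ht x
    have : S t x = S₀ ⟨t, ht⟩ x := by
      change S₀ ⟨max t 0, _⟩ x = _
      congr 2
      exact max_eq_left ht
    rw [this]
    exact hS₀ ⟨t, ht⟩ x
  have hSmax : ∀ t, S t = S (max t 0) := by
    intro t
    ext x
    change S₀ ⟨max t 0, _⟩ x = S₀ ⟨max (max t 0) 0, _⟩ x
    congr 2
    simp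
  have hSn : ∀ t x, ‖S t x‖ ≤ ‖x‖ := by
    intro t x
    rw [hSmax]
    exact le_of_tendsto (hSlim _ (le_max_right _ _) x).norm
      (Eventually.of_forall fun n => hnorm n x _ (le_max_right _ _))
  have hSlip : ∀ x y, AdjGraph T x y → ∀ s t, ‖S t x - S s x‖ ≤ ‖y‖ * ‖t - s‖ := by
    intro x y h s t
    rw [hSmax t, hSmax s]
    have h1 : ‖max t 0 - max s 0‖ ≤ ‖t - s‖ := abs_max_sub_max_le_abs t s 0
    refine le_trans ?_ (mul_le_mul_of_nonneg_left h1 (norm_nonneg y))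
    refine le_of_tendsto_of_tendsto ((hSlim _ (le_max_right t 0) x).sub
      (hSlim _ (le_max_right s 0) x)).norm ((hYt x y h).norm.mul_const _)
      (Eventually.of_forall fun n =>
        norm_expOp_sub_expOp_le (hYd n) x (le_max_right s 0) (le_max_right t 0))
  have hScont : ∀ x, Continuous fun t => S t x := by
    intro x
    refine continuous_of_uniform_approx_of_continuous fun u hu => ?_
    obtain ⟨ε, hε, hεu⟩ := Metric.mem_uniformity_dist.1 hu
    obtain ⟨x', hx', y, hxy⟩ := Metric.dense_iff.1 hdense x ε hε
    refine ⟨fun t => S t x', ?_, fun t => hεu ?_⟩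
    · refine (LipschitzWith.of_dist_le_mul (K := ‖y‖₊) fun s t => ?_).continuous
      rw [dist_eq_norm, dist_eq_norm]
      exact hSlip x' y hxy t s
    · rw [dist_eq_norm, ← map_sub]
      refine (hSn _ _).trans_lt ?_
      rw [← dist_eq_norm, dist_comm]; exact hx'
  have hSY : ∀ x y, AdjGraph T x y → ∀ t, 0 ≤ t →
      Tendsto (fun n => expOp (Y n) t (Y n x)) atTop (𝓝 (S t y)) := by
    intro x y h t ht
    have h1 : Tendsto (fun n => expOp (Y n) t (Y n x - y)) atTop (𝓝 0) := by
      refine squeeze_zero_norm (fun n => hnorm n _ t ht) ?_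
      simpa using ((hYt x y h).sub_const y).norm
    have := h1.add (hSlim t ht y)
    rw [zero_add] at this
    refine this.congr fun n => ?_
    rw [← map_add, sub_add_cancel]
  have hS0 : ∀ x, S 0 x = x := by
    intro x
    refine tendsto_nhds_unique (hSlim 0 le_rfl x) ?_
    simp [expOp, NormedSpace.exp_zero]
  refine ⟨S, hSn, hS0, hScont, fun x y h t ht => ⟨?_, ?_⟩⟩
  -- The integral equation survives the limit by dominated convergence, and differentiating it gives
  -- the derivative along the domain.
  · have hint : ∀ t, 0 ≤ t → S t x = x + ∫ s in (0 : ℝ)..t, S s y := by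
      intro t ht
      have h1 : ∀ n, expOp (Y n) t x = x + ∫ s in (0 : ℝ)..t, expOp (Y n) s (Y n x) := by
        intro n
        have hcont : Continuous fun s => expOp (Y n) s (Y n x) :=
          continuous_iff_continuousAt.2 fun s => (hasDerivAt_expOp (Y n) (Y n x) s).continuousAt
        rw [intervalIntegral.integral_eq_sub_of_hasDerivAt
          (fun s _ => hasDerivAt_expOp (Y n) x s) (hcont.intervalIntegrable _ _)]
        simp [expOp, NormedSpace.exp_zero]
      refine tendsto_nhds_unique (hSlim t ht x) ?_
      simp_rw [h1]
      refine tendsto_const_nhds.add ?_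
      obtain ⟨C, hC⟩ := (hYt x y h).norm.bddAbove_range
      refine intervalIntegral.tendsto_integral_filter_of_dominated_convergence (fun _ => C) ?_ ?_ ?_ ?_
      · exact Eventually.of_forall fun n => (continuous_iff_continuousAt.2 fun s =>
          (hasDerivAt_expOp (Y n) (Y n x) s).continuousAt).aestronglyMeasurable
      · refine Eventually.of_forall fun n => Eventually.of_forall fun s hs => ?_
        rw [uIoc_of_le ht] at hs
        exact (hnorm n _ s hs.1.le).trans (hC ⟨n, rfl⟩)
      · exact intervalIntegrable_const
      · refine Eventually.of_forall fun s hs => ?_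
        rw [uIoc_of_le ht] at hs
        exact hSY x y h s hs.1.le
    have hd : HasDerivAt (fun t => x + ∫ s in (0 : ℝ)..t, S s y) (S t y) t :=
      ((hScont y).integral_hasStrictDerivAt 0 t).hasDerivAt.const_add x
    exact hd.hasDerivWithinAt.congr (fun s hs => hint s hs) (hint t ht)
  -- An adjoint relation is closed. The approximants `(n + 1) R n (exp (t Y n) x)` lie in the domain
  -- with images `Y n (exp (t Y n) x)`, and both sequences converge.
  · refine AdjGraph.of_tendsto (u := fun n => ((n : ℝ) + 1) • R n (expOp (Y n) t x))
      (w := fun n => expOp (Y n) t (Y n x)) (fun n => ?_) ?_ ?_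
    · have h1 := (hR1 n (expOp (Y n) t x)).smul ((n : ℝ) + 1)
      have h2 : expOp (Y n) t (Y n x) = Y n (expOp (Y n) t x) :=
        (DFunLike.congr_fun (commute_expOp (Commute.refl (Y n)) t) x).symm
      rw [h2]
      exact h1
    · have h1 : Tendsto (fun n : ℕ => expOp (Y n) t (((n : ℝ) + 1) • R n x - x)) atTop (𝓝 0) := by
        refine squeeze_zero_norm (fun n => hnorm n _ t ht) ?_
        simpa using ((hcRt x).sub_const x).norm
      have := h1.add (hSlim t ht x)
      rw [zero_add] at this
      refine this.congr fun n => ?_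
      rw [← map_add, sub_add_cancel, map_smul]
      congr 1
      exact (DFunLike.congr_fun (commute_expOp (hYR n n).symm t) x).symm
    · exact hSY x y h t ht

end Generation

/-! ### Calculus on the unit interval and weak derivatives. -/

section UnitInterval

theorem integral_μ01 {E : Type*} [NormedAddCommGroup E] [NormedSpace ℝ E] (f : ℝ → E) :
    ∫ s, f s ∂μ01 = ∫ s in (0 : ℝ)..1, f s := by
  rw [intervalIntegral.integral_of_le zero_le_one, integral_Ioc_eq_integral_Ioo]

theorem intervalIntegrable_of_μ01 {E : Type*} [NormedAddCommGroup E] {f : ℝ → E}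
    (hf : Integrable f μ01) : IntervalIntegrable f volume 0 1 := by
  rw [intervalIntegrable_iff_integrableOn_Ioo_of_le zero_le_one]
  exact hf

theorem ae_μ01_of_forall {P : ℝ → Prop} (h : ∀ s ∈ Ioo (0 : ℝ) 1, P s) : ∀ᵐ s ∂μ01, P s :=
  (ae_restrict_iff' measurableSet_Ioo).2 (Eventually.of_forall h)

/-- Extend the one-sided derivative by constants beyond `[0,1]` and integrate it. The coefficients
are controlled only on `[0,1]`, whereas tests are `C¹` on the whole line. -/
theorem exists_contDiff_extension {f : ℝ → ℝ} (hf : ContDiffOn ℝ 1 f (Icc 0 1)) :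
    ∃ F : ℝ → ℝ, ContDiff ℝ 1 F ∧ EqOn F f (Icc 0 1) := by
  have hu : UniqueDiffOn ℝ (Icc (0 : ℝ) 1) := uniqueDiffOn_Icc zero_lt_one
  have hd : ContinuousOn (derivWithin f (Icc 0 1)) (Icc 0 1) :=
    hf.continuousOn_derivWithin hu le_rfl
  let d : ℝ → ℝ := IccExtend (zero_le_one' ℝ) (domRestrict (Icc 0 1) (derivWithin f (Icc 0 1)))
  have hdc : Continuous d := (continuousOn_iff_continuous_domRestrict.1 hd).Icc_extend'
  have hdeq : ∀ s ∈ Icc (0 : ℝ) 1, d s = derivWithin f (Icc 0 1) s := fun s hs => by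
    simp [d, IccExtend_of_mem _ _ hs]
  have hF : ∀ s, HasDerivAt (fun s => f 0 + ∫ σ in (0 : ℝ)..s, d σ) (d s) s := fun s =>
    (hdc.integral_hasStrictDerivAt 0 s).hasDerivAt.const_add _
  refine ⟨fun s => f 0 + ∫ σ in (0 : ℝ)..s, d σ, ?_, ?_⟩
  · rw [contDiff_one_iff_deriv]
    refine ⟨fun s => (hF s).differentiableAt, ?_⟩
    rwa [show deriv _ = d from funext fun s => (hF s).deriv]
  · intro s hs
    have h1 : ∀ x ∈ Icc (0 : ℝ) s, HasDerivWithinAt f (d x) (Icc 0 s) x := fun x hx => by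
      have hx' : x ∈ Icc (0 : ℝ) 1 := ⟨hx.1, hx.2.trans hs.2⟩
      rw [hdeq x hx']
      exact ((hf.differentiableOn one_ne_zero x hx').hasDerivWithinAt).mono
        (Icc_subset_Icc_right hs.2)
    have h2 := intervalIntegral.integral_eq_sub_of_hasDerivAt_of_le hs.1
      (fun x hx => (h1 x hx).continuousWithinAt)
      (fun x hx => (h1 x (Ioo_subset_Icc_self hx)).hasDerivAt (Icc_mem_nhds hx.1 hx.2))
      (hdc.intervalIntegrable _ _)
    dsimp only
    rw [h2]; ring

/-- Integration by parts of a primitive against a `C¹` function. -/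
theorem primitive_integral_by_parts {d : ℝ → ℝ} (hd : IntervalIntegrable d volume 0 1) (c : ℝ)
    {G : ℝ → ℝ} (hG : ContDiff ℝ 1 G) :
    (∫ s in (0 : ℝ)..1, (c + ∫ σ in (0 : ℝ)..s, d σ) * deriv G s) + ∫ s in (0 : ℝ)..1, d s * G s =
      (c + ∫ σ in (0 : ℝ)..1, d σ) * G 1 - c * G 0 := by
  have hac : AbsolutelyContinuousOnInterval (fun s => c + ∫ σ in (0 : ℝ)..s, d σ) 0 1 := by
    have h1 : AbsolutelyContinuousOnInterval (fun _ : ℝ => c) 0 1 :=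
      (contDiff_const (n := 1)).contDiffOn.absolutelyContinuousOnInterval
    exact h1.add (hd.absolutelyContinuousOnInterval_intervalIntegral (by simp))
  have hG' : AbsolutelyContinuousOnInterval G 0 1 := hG.contDiffOn.absolutelyContinuousOnInterval
  rw [hac.integral_mul_deriv_eq_deriv_mul hG']
  have : ∫ s in (0 : ℝ)..1, deriv (fun s => c + ∫ σ in (0 : ℝ)..s, d σ) s * G s =
      ∫ s in (0 : ℝ)..1, d s * G s := by
    apply intervalIntegral.integral_congr_ae
    filter_upwards [hd.ae_hasDerivAt_integral] with x hx hx'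
    rw [((hx (uIoc_subset_uIcc hx') 0 (by simp)).const_add c).deriv]
  rw [this]
  simp

/-- A function on `(0,1)` with vanishing weak derivative is constant. -/
theorem ae_eq_const_of_weakDeriv_zero {E : Type*} [NormedAddCommGroup E] [NormedSpace ℝ E]
    [CompleteSpace E] {u : ℝ → E} (hu : Integrable u μ01)
    (h : ∀ χ : ℝ → ℝ, ContDiff ℝ ∞ χ → HasCompactSupport χ → tsupport χ ⊆ Ioo (0 : ℝ) 1 →
      ∫ s, deriv χ s • u s ∂μ01 = 0) : ∃ c : E, ∀ᵐ s ∂μ01, u s = c := by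
  let b : ContDiffBump (1 / 2 : ℝ) := ⟨1 / 8, 1 / 4, by norm_num, by norm_num⟩
  let ρ : ℝ → ℝ := b.normed volume
  have hρs : ContDiff ℝ ∞ ρ := b.contDiff_normed
  have hρt : tsupport ρ = Metric.closedBall (1 / 2 : ℝ) (1 / 4) := b.tsupport_normed_eq
  have hρt' : tsupport ρ ⊆ Ioo (0 : ℝ) 1 := by
    rw [hρt, Real.closedBall_eq_Icc]
    intro x hx
    constructor <;> [have := hx.1; have := hx.2] <;> linarith
  have hρc : HasCompactSupport ρ := b.hasCompactSupport_normed
  have hρi : ∫ s, ρ s = 1 := b.integral_normed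
  have hint : ∀ θ : ℝ → ℝ, Continuous θ → HasCompactSupport θ →
      Integrable (fun s => θ s • u s) μ01 := by
    intro θ hθ hθc
    obtain ⟨C, hC⟩ := hθc.exists_bound_of_continuous hθ
    exact hu.bdd_smul C hθ.aestronglyMeasurable (Eventually.of_forall hC)
  refine ⟨∫ s, ρ s • u s ∂μ01, ?_⟩
  set c := ∫ s, ρ s • u s ∂μ01
  have key : ∀ θ : ℝ → ℝ, ContDiff ℝ ∞ θ → HasCompactSupport θ → tsupport θ ⊆ Ioo (0 : ℝ) 1 →
      ∫ s, θ s • u s ∂μ01 = (∫ s, θ s) • c := by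
    intro θ hθ hθc hθt
    let I := ∫ s, θ s
    -- Removing the mean with the unit-mass bump `ρ` makes the primitive of `w` compactly supported,
    -- hence an admissible test.
    let w : ℝ → ℝ := fun s => θ s - I * ρ s
    have hwc : Continuous w := hθ.continuous.sub (continuous_const.mul hρs.continuous)
    have hwS : ContDiff ℝ ∞ w := hθ.sub (contDiff_const.mul hρs)
    let χ : ℝ → ℝ := fun s => ∫ σ in (0 : ℝ)..s, w σ
    have hχd : ∀ s, HasDerivAt χ (w s) s := fun s => (hwc.integral_hasStrictDerivAt 0 s).hasDerivAt
    have hχ' : deriv χ = w := funext fun s => (hχd s).deriv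
    have hχS : ContDiff ℝ ∞ χ := by
      rw [contDiff_infty_iff_deriv, hχ']
      exact ⟨fun s => (hχd s).differentiableAt, hwS⟩
    have hθint : Integrable θ := hθ.continuous.integrable_of_hasCompactSupport hθc
    have hρint : Integrable ρ := hρs.continuous.integrable_of_hasCompactSupport hρc
    have hwI : ∫ s, w s = 0 := by
      rw [integral_sub hθint (hρint.const_mul I), integral_const_mul, hρi]; simp [I]
    let K := tsupport θ ∪ tsupport ρ
    have hK : IsCompact K := hθc.union hρc
    have hK01 : K ⊆ Ioo (0 : ℝ) 1 := union_subset hθt hρt'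
    have hKne : K.Nonempty := ⟨1 / 2, Or.inr (by rw [hρt]; simp)⟩
    have hw0 : ∀ s, s ∉ K → w s = 0 := by
      intro s hs
      have h1 : θ s = 0 := image_eq_zero_of_notMem_tsupport fun h => hs (Or.inl h)
      have h2 : ρ s = 0 := image_eq_zero_of_notMem_tsupport fun h => hs (Or.inr h)
      simp [w, h1, h2]
    have ha := hK01 (hK.sInf_mem hKne)
    have hb := hK01 (hK.sSup_mem hKne)
    -- To the left of the supports nothing is integrated; to the right the whole integral of `w` is,
    -- and it is zero.
    have hχ0 : ∀ s, s ∉ Icc (sInf K) (sSup K) → χ s = 0 := by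
      intro s hs
      rcases lt_or_ge s (sInf K) with h1 | h1
      · refine (intervalIntegral.integral_congr (g := fun _ => 0) fun x hx => hw0 x fun hx' => ?_).trans
          (by simp)
        have h2 : sInf K ≤ x := csInf_le hK.bddBelow hx'
        have h3 : x ≤ max 0 s := hx.2
        have h4 : max 0 s < sInf K := max_lt ha.1 h1
        linarith
      · have h1' : sSup K < s := by
          by_contra h2
          exact hs ⟨h1, not_lt.1 h2⟩
        have h2 : Function.support w ⊆ Ioc 0 s := by
          intro x hx
          by_contra hx'
          refine hx (hw0 x fun hxK => hx' ⟨(hK01 hxK).1, ?_⟩)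
          exact (le_csSup hK.bddAbove hxK).trans h1'.le
        have h3 : χ s = ∫ x, w x := intervalIntegral.integral_eq_integral_of_support_subset h2
        rw [h3, hwI]
    have hsub : tsupport χ ⊆ Icc (sInf K) (sSup K) := by
      refine closure_minimal (fun s hs => ?_) isClosed_Icc
      by_contra h'
      exact hs (hχ0 s h')
    have hχc : HasCompactSupport χ := isCompact_Icc.of_isClosed_subset (isClosed_tsupport χ) hsub
    have h1 := h χ hχS hχc (hsub.trans fun x hx => ⟨ha.1.trans_le hx.1, hx.2.trans_lt hb.2⟩)
    rw [hχ'] at h1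
    have h2 : ∀ s, w s • u s = θ s • u s - I • (ρ s • u s) := fun s => by
      simp only [w, sub_smul, mul_smul]
    simp_rw [h2] at h1
    rw [integral_sub (hint θ hθ.continuous hθc) ((hint ρ hρs.continuous hρc).fun_smul I),
      integral_smul, sub_eq_zero] at h1
    exact h1
  have hloc : LocallyIntegrableOn (fun s => u s - c) (Ioo 0 1) volume := by
    have h1 : IntegrableOn (fun s => u s - c) (Ioo 0 1) volume := hu.sub (integrable_const c)
    exact h1.locallyIntegrableOn
  have h2 := isOpen_Ioo.ae_eq_zero_of_integral_contDiff_smul_eq_zero hloc (by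
    intro θ hθ hθc hθt
    have h0 : ∀ s ∉ Ioo (0 : ℝ) 1, θ s = 0 := fun s hs =>
      image_eq_zero_of_notMem_tsupport fun h => hs (hθt h)
    have h3 : ∫ s, θ s • (u s - c) = ∫ s, θ s • (u s - c) ∂μ01 := by
      rw [setIntegral_eq_integral_of_forall_compl_eq_zero]
      intro s hs
      rw [h0 s hs, zero_smul]
    have h4 : ∫ s, θ s ∂μ01 = ∫ s, θ s := by
      rw [setIntegral_eq_integral_of_forall_compl_eq_zero]
      exact h0
    have hθi : Integrable θ μ01 := (hθ.continuous.integrable_of_hasCompactSupport hθc).restrict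
    rw [h3]
    simp_rw [smul_sub]
    rw [integral_sub (hint θ hθ.continuous hθc) (hθi.smul_const c), key θ hθ hθc hθt,
      integral_smul_const, h4, sub_self])
  rw [ae_restrict_iff' measurableSet_Ioo]
  filter_upwards [h2] with s hs hs'
  exact sub_eq_zero.1 (hs hs')

end UnitInterval

/-! ### H¹ profiles as primitives of their weak derivatives. -/

section LTwo

variable {ℓ r m : ℕ}

theorem L2.integrable (φ : L2 ℓ r) : Integrable φ μ01 := (Lp.memLp φ).integrable one_le_two

theorem L2.integrable_apply (φ : L2 ℓ r) (i : Idx ℓ r) : Integrable (fun s => φ s i) μ01 :=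
  (EuclideanSpace.proj i : EuclideanSpace ℝ (Idx ℓ r) →L[ℝ] ℝ).integrable_comp (L2.integrable φ)

theorem integral_apply {f : ℝ → EuclideanSpace ℝ (Idx ℓ r)} {μ : Measure ℝ} (hf : Integrable f μ)
    (i : Idx ℓ r) : (∫ s, f s ∂μ) i = ∫ s, f s i ∂μ :=
  ((EuclideanSpace.proj i : EuclideanSpace ℝ (Idx ℓ r) →L[ℝ] ℝ).integral_comp_comm hf).symm

theorem integrable_smul_of_continuous {E : Type*} [NormedAddCommGroup E] [NormedSpace ℝ E]
    {u : ℝ → E} (hu : Integrable u μ01) {χ : ℝ → ℝ} (hχ : Continuous χ) :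
    Integrable (fun s => χ s • u s) μ01 := by
  obtain ⟨C, hC⟩ := (isCompact_Icc (a := (0 : ℝ)) (b := 1)).exists_bound_of_continuousOn
    hχ.continuousOn
  exact hu.bdd_smul C hχ.aestronglyMeasurable
    (ae_μ01_of_forall fun s hs => hC s (Ioo_subset_Icc_self hs))

/-- The primitive of `δ` with value `c` at `0`. -/
def primitive (c : EuclideanSpace ℝ (Idx ℓ r)) (δ : L2 ℓ r) (s : ℝ) : EuclideanSpace ℝ (Idx ℓ r) :=
  c + ∫ σ in (0 : ℝ)..s, δ σ

theorem continuousOn_primitive (c : EuclideanSpace ℝ (Idx ℓ r)) (δ : L2 ℓ r) :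
    ContinuousOn (primitive c δ) (Icc 0 1) := by
  have h := intervalIntegral.continuousOn_primitive_interval (f := δ) (μ := volume) (a := 0) (b := 1)
    (by
      rw [uIcc_of_le zero_le_one, integrableOn_Icc_iff_integrableOn_Ioo]
      exact L2.integrable δ)
  rw [uIcc_of_le zero_le_one] at h
  exact continuousOn_const.add h

theorem primitive_apply (c : EuclideanSpace ℝ (Idx ℓ r)) (δ : L2 ℓ r) {s : ℝ}
    (hs : s ∈ Icc (0 : ℝ) 1) (i : Idx ℓ r) :
    primitive c δ s i = c i + ∫ σ in (0 : ℝ)..s, δ σ i := by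
  have h : IntegrableOn δ (Ioc 0 s) volume := by
    rw [integrableOn_Ioc_iff_integrableOn_Ioo]
    exact IntegrableOn.mono_set (L2.integrable δ) (Ioo_subset_Ioo_right hs.2)
  simp only [primitive, PiLp.add_apply, intervalIntegral.integral_of_le hs.1]
  rw [integral_apply h]

theorem primitive_zero (c : EuclideanSpace ℝ (Idx ℓ r)) (δ : L2 ℓ r) : primitive c δ 0 = c := by
  simp [primitive]

theorem integral_by_parts (c : EuclideanSpace ℝ (Idx ℓ r)) (δ : L2 ℓ r) (i : Idx ℓ r) {G : ℝ → ℝ}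
    (hG : ContDiff ℝ 1 G) :
    (∫ s, primitive c δ s i * deriv G s ∂μ01) + ∫ s, δ s i * G s ∂μ01 =
      primitive c δ 1 i * G 1 - primitive c δ 0 i * G 0 := by
  have h := primitive_integral_by_parts
    (intervalIntegrable_of_μ01 (L2.integrable_apply δ i)) (c i) hG
  rw [integral_μ01, integral_μ01, primitive_apply c δ (by simp), primitive_zero, ← h]
  congr 1
  refine intervalIntegral.integral_congr fun s hs => ?_
  rw [uIcc_of_le zero_le_one] at hs
  dsimp only
  rw [primitive_apply c δ hs]

theorem hasWeakDeriv_of_primitive {φ δ : L2 ℓ r} {c : EuclideanSpace ℝ (Idx ℓ r)}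
    (h : ∀ᵐ s ∂μ01, φ s = primitive c δ s) : HasWeakDeriv φ δ := by
  intro χ hχ _ hχt
  have hχ1 : ContDiff ℝ 1 χ := hχ.of_le (by exact_mod_cast le_top)
  have hout : ∀ s ∉ Ioo (0 : ℝ) 1, χ s = 0 := fun s hs =>
    image_eq_zero_of_notMem_tsupport fun h => hs (hχt h)
  ext i
  rw [PiLp.neg_apply, integral_apply (integrable_smul_of_continuous (L2.integrable φ)
      (hχ1.continuous_deriv le_rfl)),
    integral_apply (integrable_smul_of_continuous (L2.integrable δ) hχ1.continuous)]
  have h1 := integral_by_parts c δ i hχ1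
  rw [hout 0 (by simp), hout 1 (by simp), mul_zero, mul_zero, sub_zero] at h1
  rw [eq_neg_iff_add_eq_zero, ← h1]
  congr 1
  · refine integral_congr_ae ?_
    filter_upwards [h] with s hs
    simp [hs, mul_comm]
  · refine integral_congr_ae (Eventually.of_forall fun s => ?_)
    simp [mul_comm]

/-- Subtracting the primitive of `δ` leaves a function with zero weak derivative, hence a constant.
This supplies the continuous representative and so the boundary traces. -/
theorem HasWeakDeriv.exists_primitive {φ δ : L2 ℓ r} (h : HasWeakDeriv φ δ) :
    ∃ c, ∀ᵐ s ∂μ01, φ s = primitive c δ s := by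
  have hint : Integrable (primitive 0 δ) μ01 :=
    ((continuousOn_primitive 0 δ).integrableOn_Icc).mono_set Ioo_subset_Icc_self
  obtain ⟨c, hc⟩ := ae_eq_const_of_weakDeriv_zero (u := fun s => φ s - primitive 0 δ s)
    ((L2.integrable φ).sub hint) (by
      intro χ hχ hχc hχt
      have hχ1 : ContDiff ℝ 1 χ := hχ.of_le (by exact_mod_cast le_top)
      have hout : ∀ s ∉ Ioo (0 : ℝ) 1, χ s = 0 := fun s hs =>
        image_eq_zero_of_notMem_tsupport fun h => hs (hχt h)
      have hd := hχ1.continuous_deriv le_rfl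
      simp_rw [smul_sub]
      rw [integral_sub (integrable_smul_of_continuous (L2.integrable φ) hd)
        (integrable_smul_of_continuous hint hd), h χ hχ hχc hχt, sub_eq_zero]
      ext i
      rw [PiLp.neg_apply, integral_apply (integrable_smul_of_continuous (L2.integrable δ)
        hχ1.continuous), integral_apply (integrable_smul_of_continuous hint hd)]
      have h1 := integral_by_parts 0 δ i hχ1
      rw [hout 0 (by simp), hout 1 (by simp), mul_zero, mul_zero, sub_zero] at h1
      simp only [PiLp.smul_apply, smul_eq_mul, mul_comm (χ _), mul_comm (deriv χ _)]
      linarith)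
  refine ⟨c, ?_⟩
  filter_upwards [hc] with s hs
  rw [sub_eq_iff_eq_add] at hs
  rw [hs]
  simp [primitive]

end LTwo

/-! ### Multiplication operators and curves in `L²`. -/

section Operators

variable {ℓ r m : ℕ}

theorem exists_mulOp (M : ℝ → Matrix (Idx ℓ r) (Idx ℓ r) ℝ)
    (hM : ∀ i j, ContinuousOn (fun s => M s i j) (Icc 0 1)) :
    ∃ T : L2 ℓ r →L[ℝ] L2 ℓ r, ∀ u : L2 ℓ r, ∀ᵐ s ∂μ01, (T u s).ofLp = M s *ᵥ (u s).ofLp := by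
  let A : ℝ → EuclideanSpace ℝ (Idx ℓ r) →L[ℝ] EuclideanSpace ℝ (Idx ℓ r) :=
    fun s => Matrix.toEuclideanCLM (𝕜 := ℝ) (n := Idx ℓ r) (M s)
  have hA : ContinuousOn A (Icc 0 1) := by
    have h1 : Continuous (Matrix.toEuclideanCLM (𝕜 := ℝ) (n := Idx ℓ r)) :=
      LinearMap.continuous_of_finiteDimensional
        ((Matrix.toEuclideanCLM (𝕜 := ℝ) (n := Idx ℓ r)).toAlgEquiv.toLinearMap)
    have h2 : ContinuousOn M (Icc 0 1) :=
      continuousOn_pi.2 fun i => continuousOn_pi.2 fun j => hM i j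
    exact h1.comp_continuousOn h2
  obtain ⟨C, hC⟩ := isCompact_Icc.exists_bound_of_continuousOn hA
  have hC' : ∀ u : L2 ℓ r, ∀ᵐ s ∂μ01, ‖A s (u s)‖ ≤ C * ‖u s‖ := fun u =>
    ae_μ01_of_forall fun s hs => (A s).le_of_opNorm_le (hC s (Ioo_subset_Icc_self hs)) _
  have hmeas : ∀ u : L2 ℓ r, AEStronglyMeasurable (fun s => A s (u s)) μ01 := fun u =>
    (ContinuousLinearMap.id ℝ (EuclideanSpace ℝ (Idx ℓ r) →L[ℝ] EuclideanSpace ℝ (Idx ℓ r))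
      ).aestronglyMeasurable_comp₂
      ((hA.mono Ioo_subset_Icc_self).aestronglyMeasurable measurableSet_Ioo)
      (Lp.aestronglyMeasurable u)
  have hmem : ∀ u : L2 ℓ r, MemLp (fun s => A s (u s)) 2 μ01 := fun u =>
    (Lp.memLp u).of_le_mul (hmeas u) (hC' u)
  refine ⟨LinearMap.mkContinuous
    { toFun := fun u => (hmem u).toLp
      map_add' := fun u w => ?_
      map_smul' := fun c u => ?_ } C (fun u => ?_), fun u => ?_⟩
  · apply Lp.ext
    filter_upwards [(hmem (u + w)).coeFn_toLp, (hmem u).coeFn_toLp, (hmem w).coeFn_toLp,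
      Lp.coeFn_add u w, Lp.coeFn_add (hmem u).toLp (hmem w).toLp] with s h1 h2 h3 h4 h5
    rw [h1, h5, Pi.add_apply, h2, h3, h4, Pi.add_apply, map_add]
  · apply Lp.ext
    filter_upwards [(hmem (c • u)).coeFn_toLp, (hmem u).coeFn_toLp,
      Lp.coeFn_smul c u, Lp.coeFn_smul c (hmem u).toLp] with s h1 h2 h4 h5
    rw [h1, RingHom.id_apply, h5, Pi.smul_apply, h2, h4, Pi.smul_apply, map_smul]
  · refine Lp.norm_le_mul_norm_of_ae_le_mul ?_
    filter_upwards [(hmem u).coeFn_toLp, hC' u] with s h1 h2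
    change ‖(MemLp.toLp _ (hmem u) : L2 ℓ r) s‖ ≤ _
    rw [h1]; exact h2
  · filter_upwards [(hmem u).coeFn_toLp] with s h1
    change ((MemLp.toLp _ (hmem u) : L2 ℓ r) s).ofLp = _
    rw [h1]
    simp [A]

/-- The class in `L²` of a continuous profile on `[0,1]`. -/
theorem exists_clsI : ∃ T : C(Icc (0 : ℝ) 1, Idx ℓ r → ℝ) →L[ℝ] L2 ℓ r,
    ∀ g, ∀ᵐ s ∂μ01, (T g s).ofLp = g (projIcc 0 1 zero_le_one s) := by
  let e : (Idx ℓ r → ℝ) →L[ℝ] EuclideanSpace ℝ (Idx ℓ r) :=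
    ((EuclideanSpace.equiv (Idx ℓ r) ℝ).symm : (Idx ℓ r → ℝ) →L[ℝ] EuclideanSpace ℝ (Idx ℓ r))
  let F : C(Icc (0 : ℝ) 1, Idx ℓ r → ℝ) → ℝ → EuclideanSpace ℝ (Idx ℓ r) :=
    fun g s => e (g (projIcc 0 1 zero_le_one s))
  have hF : ∀ g s, ‖F g s‖ ≤ ‖e‖ * ‖g‖ := fun g s =>
    (e.le_opNorm _).trans (by gcongr; exact g.norm_coe_le_norm _)
  have hmem : ∀ g, MemLp (F g) 2 μ01 := fun g =>
    MemLp.of_bound (e.continuous.comp (g.continuous.comp continuous_projIcc)).aestronglyMeasurable _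
      (Eventually.of_forall (hF g))
  refine ⟨LinearMap.mkContinuous
    { toFun := fun g => (hmem g).toLp
      map_add' := fun g g' => ?_
      map_smul' := fun c g => ?_ } ‖e‖ (fun g => ?_), fun g => ?_⟩
  · apply Lp.ext
    filter_upwards [(hmem (g + g')).coeFn_toLp, (hmem g).coeFn_toLp, (hmem g').coeFn_toLp,
      Lp.coeFn_add (hmem g).toLp (hmem g').toLp] with s h1 h2 h3 h5
    rw [h1, h5, Pi.add_apply, h2, h3]
    simp [F]
  · apply Lp.ext
    filter_upwards [(hmem (c • g)).coeFn_toLp, (hmem g).coeFn_toLp,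
      Lp.coeFn_smul c (hmem g).toLp] with s h1 h2 h5
    rw [h1, RingHom.id_apply, h5, Pi.smul_apply, h2]
    simp [F]
  · refine (Lp.norm_le_of_ae_bound (C := ‖e‖ * ‖g‖) (by positivity) ?_).trans ?_
    · filter_upwards [(hmem g).coeFn_toLp] with s h1
      change ‖(MemLp.toLp _ (hmem g) : L2 ℓ r) s‖ ≤ _
      rw [h1]; exact hF g s
    · simp [measureUnivNNReal]
  · filter_upwards [(hmem g).coeFn_toLp] with s h1
    change ((MemLp.toLp _ (hmem g) : L2 ℓ r) s).ofLp = _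
    rw [h1]
    rfl

/-- A jointly continuous function of `(t,s)` is a continuous curve in `L²`. -/
theorem exists_curve (ψ : ℝ → ℝ → Idx ℓ r → ℝ) (hψ : Continuous fun p : ℝ × ℝ => ψ p.1 p.2) :
    ∃ Ψ : ℝ → L2 ℓ r, Continuous Ψ ∧ ∀ t, ∀ᵐ s ∂μ01, (Ψ t s).ofLp = ψ t s := by
  obtain ⟨T, hT⟩ := exists_clsI (ℓ := ℓ) (r := r)
  let F : C(ℝ, C(Icc (0 : ℝ) 1, Idx ℓ r → ℝ)) := ContinuousMap.curry
    ⟨fun p : ℝ × Icc (0 : ℝ) 1 => ψ p.1 p.2,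
      hψ.comp (continuous_fst.prodMk (continuous_subtype_val.comp continuous_snd))⟩
  refine ⟨fun t => T (F t), T.continuous.comp F.continuous, fun t => ?_⟩
  have h2 : ∀ᵐ s ∂μ01, s ∈ Icc (0 : ℝ) 1 := ae_μ01_of_forall fun s hs => Ioo_subset_Icc_self hs
  filter_upwards [hT (F t), h2] with s h1 hs
  rw [h1, projIcc_of_mem _ hs]
  rfl

theorem exists_cls (g : ℝ → Idx ℓ r → ℝ) (hg : Continuous g) :
    ∃ u : L2 ℓ r, ∀ᵐ s ∂μ01, (u s).ofLp = g s := by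
  obtain ⟨Ψ, -, h⟩ := exists_curve (fun _ => g) (hg.comp continuous_snd)
  exact ⟨Ψ 0, h 0⟩

/-- The curve is differentiated in the sup norm of `C([0,1])`: the fundamental theorem of calculus
holds at each point `s`, hence for the integral of the continuous curve `F'`. The bounded map into
`L²` then transports the derivative. -/
theorem exists_curve_hasDerivAt (ψ ψ' : ℝ → ℝ → Idx ℓ r → ℝ)
    (hψ : Continuous fun p : ℝ × ℝ => ψ p.1 p.2) (hψ' : Continuous fun p : ℝ × ℝ => ψ' p.1 p.2)
    (hd : ∀ t s, HasDerivAt (fun τ => ψ τ s) (ψ' t s) t) :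
    ∃ Ψ Ψ' : ℝ → L2 ℓ r, Continuous Ψ' ∧ (∀ t, HasDerivAt Ψ (Ψ' t) t) ∧
      (∀ t, ∀ᵐ s ∂μ01, (Ψ t s).ofLp = ψ t s) ∧ ∀ t, ∀ᵐ s ∂μ01, (Ψ' t s).ofLp = ψ' t s := by
  obtain ⟨T, hT⟩ := exists_clsI (ℓ := ℓ) (r := r)
  let F : C(ℝ, C(Icc (0 : ℝ) 1, Idx ℓ r → ℝ)) := ContinuousMap.curry
    ⟨fun p : ℝ × Icc (0 : ℝ) 1 => ψ p.1 p.2,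
      hψ.comp (continuous_fst.prodMk (continuous_subtype_val.comp continuous_snd))⟩
  let F' : C(ℝ, C(Icc (0 : ℝ) 1, Idx ℓ r → ℝ)) := ContinuousMap.curry
    ⟨fun p : ℝ × Icc (0 : ℝ) 1 => ψ' p.1 p.2,
      hψ'.comp (continuous_fst.prodMk (continuous_subtype_val.comp continuous_snd))⟩
  have hF : ∀ t, F t = F 0 + ∫ τ in (0 : ℝ)..t, F' τ := by
    intro t
    ext1 s
    have h1 : (∫ τ in (0 : ℝ)..t, F' τ) s = ∫ τ in (0 : ℝ)..t, F' τ s :=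
      ((ContinuousMap.evalCLM ℝ s).intervalIntegral_comp_comm
        (F'.continuous.intervalIntegrable 0 t)).symm
    have h2 : ∫ τ in (0 : ℝ)..t, F' τ s = ψ t s - ψ 0 s := by
      refine intervalIntegral.integral_eq_sub_of_hasDerivAt (fun τ _ => hd τ s) ?_
      exact (hψ'.comp (continuous_id.prodMk continuous_const)).intervalIntegrable 0 t
    rw [ContinuousMap.add_apply, h1, h2]
    change ψ t s = ψ 0 s + (ψ t s - ψ 0 s)
    abel
  have hFd : ∀ t, HasDerivAt F (F' t) t := by
    intro t
    have := (F'.continuous.integral_hasStrictDerivAt 0 t).hasDerivAt.const_add (F 0)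
    exact this.congr_of_eventuallyEq (Eventually.of_forall hF)
  have h2 : ∀ᵐ s ∂μ01, s ∈ Icc (0 : ℝ) 1 := ae_μ01_of_forall fun s hs => Ioo_subset_Icc_self hs
  refine ⟨fun t => T (F t), fun t => T (F' t), T.continuous.comp F'.continuous,
    fun t => T.hasFDerivAt.comp_hasDerivAt t (hFd t), fun t => ?_, fun t => ?_⟩
  · filter_upwards [hT (F t), h2] with s h1 hs
    rw [h1, projIcc_of_mem _ hs]
    rfl
  · filter_upwards [hT (F' t), h2] with s h1 hs
    rw [h1, projIcc_of_mem _ hs]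
    rfl

theorem dotProduct_eq_inner {ι : Type*} [Fintype ι] (x y : EuclideanSpace ℝ ι) :
    x.ofLp ⬝ᵥ y.ofLp = inner ℝ x y := by
  rw [EuclideanSpace.inner_eq_star_dotProduct, star_trivial, dotProduct_comm]

theorem integral_dotProduct_eq_inner (φ u : L2 ℓ r) {g : ℝ → Idx ℓ r → ℝ}
    (hu : ∀ᵐ s ∂μ01, (u s).ofLp = g s) : ∫ s, (φ s).ofLp ⬝ᵥ g s ∂μ01 = inner ℝ φ u := by
  rw [MeasureTheory.L2.inner_def]
  refine integral_congr_ae ?_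
  filter_upwards [hu] with s hs
  rw [← hs, dotProduct_eq_inner]

theorem integrable_dotProduct (φ u : L2 ℓ r) {g : ℝ → Idx ℓ r → ℝ}
    (hu : ∀ᵐ s ∂μ01, (u s).ofLp = g s) : Integrable (fun s => (φ s).ofLp ⬝ᵥ g s) μ01 := by
  refine (MeasureTheory.L2.integrable_inner (𝕜 := ℝ) φ u).congr ?_
  filter_upwards [hu] with s hs
  rw [← hs, dotProduct_eq_inner]

theorem pairing_eq_inner (v : State ℓ r m) (u : L2 ℓ r) {g : ℝ → Idx ℓ r → ℝ} (e : Fin m → ℝ)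
    (hu : ∀ᵐ s ∂μ01, (u s).ofLp = g s) :
    ClosedLoop.pairing v g e = inner ℝ v.1 u + inner ℝ v.2 (WithLp.toLp 2 e) := by
  rw [ClosedLoop.pairing, integral_dotProduct_eq_inner v.1 u hu, ← dotProduct_eq_inner]

end Operators

/-! ### Weak and strong forms of the right-hand side. -/

namespace ClosedLoop

variable {ℓ r m : ℕ} (D : ClosedLoop ℓ r m)

/-- Test functions which do not depend on time. -/
def IsStaticTest (g : ℝ → Idx ℓ r → ℝ) (e : Fin m → ℝ) : Prop :=
  ContDiff ℝ 1 g ∧ D.testOut g + D.Kᵀ *ᵥ D.testIn g = (D.L₁ * D.K + D.L₂)ᵀ *ᵥ e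

/-- `(Λ₀ g)_s - Λ₁ᵀ g`. -/
def adjProfile (g : ℝ → Idx ℓ r → ℝ) (s : ℝ) : Idx ℓ r → ℝ :=
  fun i => deriv (fun σ => D.lam i σ * g σ i) s - ((D.Λ₁ s)ᵀ *ᵥ g s) i

/-- `h` is the right-hand side of the closed loop at `v`, in the weak sense. -/
def WeakRHS (v h : State ℓ r m) : Prop :=
  ∀ g e, D.IsStaticTest g e →
    pairing v (D.adjProfile g) 0 - (D.testIn g - D.L₁ᵀ *ᵥ e) ⬝ᵥ D.actuation v.2
      + e ⬝ᵥ (D.wy - D.yref) = pairing h g e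

theorem exists_lam_extension :
    ∃ lamX : Idx ℓ r → ℝ → ℝ, ∀ i, ContDiff ℝ 1 (lamX i) ∧ EqOn (lamX i) (D.lam i) (Icc 0 1) := by
  choose F hF using fun i => exists_contDiff_extension (D.lam_C1 i)
  exact ⟨F, hF⟩

theorem lam_ne_zero (i : Idx ℓ r) {s : ℝ} (hs : s ∈ Icc (0 : ℝ) 1) : D.lam i s ≠ 0 := by
  rcases i with i | i
  · exact (D.lam_pos i s hs).ne'
  · exact (D.lam_neg i s hs).ne

theorem exists_lam_inv_extension :
    ∃ κ : Idx ℓ r → ℝ → ℝ, ∀ i, ContDiff ℝ 1 (κ i) ∧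
      ∀ s ∈ Icc (0 : ℝ) 1, D.lam i s * κ i s = 1 := by
  choose F hF using fun i => exists_contDiff_extension
    ((D.lam_C1 i).inv fun s hs => D.lam_ne_zero i hs)
  refine ⟨F, fun i => ⟨(hF i).1, fun s hs => ?_⟩⟩
  rw [(hF i).2 hs]
  exact mul_inv_cancel₀ (D.lam_ne_zero i hs)

theorem exists_Λ₁_extension :
    ∃ M : ℝ → Matrix (Idx ℓ r) (Idx ℓ r) ℝ, Continuous M ∧ ∀ s ∈ Icc (0 : ℝ) 1, M s = D.Λ₁ s := by
  have h : ContinuousOn D.Λ₁ (Icc 0 1) :=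
    continuousOn_pi.2 fun i => continuousOn_pi.2 fun j => (D.Λ₁_C1 i j).continuousOn
  refine ⟨IccExtend (zero_le_one' ℝ) (domRestrict (Icc 0 1) D.Λ₁),
    (continuousOn_iff_continuous_domRestrict.1 h).Icc_extend', fun s hs => ?_⟩
  rw [IccExtend_of_mem _ _ hs, domRestrict_apply]

/-- A derivative at an interior point sees only values in `[0,1]`, so the uncontrolled values of
`D.lam` outside play no role. -/
theorem adjProfile_eq {lamX : Idx ℓ r → ℝ → ℝ}
    (hl : ∀ i, ContDiff ℝ 1 (lamX i) ∧ EqOn (lamX i) (D.lam i) (Icc 0 1))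
    (g : ℝ → Idx ℓ r → ℝ) {s : ℝ} (hs : s ∈ Ioo (0 : ℝ) 1) (i : Idx ℓ r) :
    D.adjProfile g s i = deriv (fun σ => lamX i σ * g σ i) s - ((D.Λ₁ s)ᵀ *ᵥ g s) i := by
  rw [adjProfile]
  congr 1
  apply Filter.EventuallyEq.deriv_eq
  filter_upwards [Icc_mem_nhds hs.1 hs.2] with σ hσ
  rw [(hl i).2 hσ]

theorem exists_adjProfile_curve (ψ : ℝ → ℝ → Idx ℓ r → ℝ)
    (hψ : ContDiff ℝ 1 fun p : ℝ × ℝ => ψ p.1 p.2) :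
    ∃ Ψ : ℝ → L2 ℓ r, Continuous Ψ ∧ ∀ t, ∀ᵐ s ∂μ01, (Ψ t s).ofLp = D.adjProfile (ψ t) s := by
  obtain ⟨lamX, hl⟩ := D.exists_lam_extension
  obtain ⟨M, hM, hMeq⟩ := D.exists_Λ₁_extension
  have hψi : ∀ i, ContDiff ℝ 1 fun p : ℝ × ℝ => ψ p.1 p.2 i := fun i => contDiff_pi.1 hψ i
  have hG : ∀ i, ContDiff ℝ 1 fun p : ℝ × ℝ => lamX i p.2 * ψ p.1 p.2 i := fun i =>
    ((hl i).1.comp contDiff_snd).mul (hψi i)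
  let a : ℝ → ℝ → Idx ℓ r → ℝ := fun t s i =>
    fderiv ℝ (fun p : ℝ × ℝ => lamX i p.2 * ψ p.1 p.2 i) (t, s) (0, 1) - ((M s)ᵀ *ᵥ ψ t s) i
  have ha : Continuous fun p : ℝ × ℝ => a p.1 p.2 := by
    refine continuous_pi fun i => ?_
    refine Continuous.sub ?_ ?_
    · exact ((hG i).continuous_fderiv one_ne_zero).clm_apply continuous_const
    · simp only [Matrix.mulVec, dotProduct, Matrix.transpose_apply]
      refine continuous_finsetSum _ fun j _ => Continuous.mul ?_ (hψi j).continuous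
      exact ((continuous_apply i).comp ((continuous_apply j).comp hM)).comp continuous_snd
  obtain ⟨Ψ, hΨ, hΨa⟩ := exists_curve a ha
  refine ⟨Ψ, hΨ, fun t => ?_⟩
  filter_upwards [hΨa t, ae_μ01_of_forall fun s hs => hs] with s h1 hs
  rw [h1]
  ext i
  rw [D.adjProfile_eq hl (ψ t) hs, ← hMeq s (Ioo_subset_Icc_self hs)]
  dsimp only [a]
  congr 1
  have h2 := ((hG i).differentiable one_ne_zero (t, s)).hasFDerivAt.comp_hasDerivAt s
    ((hasDerivAt_const s t).prodMk (hasDerivAt_id s))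
  exact h2.deriv.symm

theorem exists_adjProfile_cls (g : ℝ → Idx ℓ r → ℝ) (hg : ContDiff ℝ 1 g) :
    ∃ u : L2 ℓ r, ∀ᵐ s ∂μ01, (u s).ofLp = D.adjProfile g s := by
  obtain ⟨Ψ, -, h⟩ := D.exists_adjProfile_curve (fun _ => g) (hg.comp contDiff_snd)
  exact ⟨Ψ 0, h 0⟩

theorem mulVec_Λ₀_apply (s : ℝ) (x : Idx ℓ r → ℝ) (i : Idx ℓ r) :
    (D.Λ₀ s *ᵥ x) i = D.lam i s * x i := by
  rw [Λ₀, Matrix.mulVec_diagonal]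

/-- Green's formula for the spatial operator and its formal adjoint. -/
theorem green {φ δ χ : L2 ℓ r} {c : EuclideanSpace ℝ (Idx ℓ r)}
    (hφ : ∀ᵐ s ∂μ01, φ s = primitive c δ s)
    (hχ : ∀ᵐ s ∂μ01, (χ s).ofLp = -(D.Λ₀ s *ᵥ (δ s).ofLp) - D.Λ₁ s *ᵥ (φ s).ofLp)
    {g : ℝ → Idx ℓ r → ℝ} (hg : ContDiff ℝ 1 g) :
    ∫ s, (φ s).ofLp ⬝ᵥ D.adjProfile g s ∂μ01 = (∫ s, (χ s).ofLp ⬝ᵥ g s ∂μ01) +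
      inflow (primitive c δ) ⬝ᵥ D.testIn g + outflow (primitive c δ) ⬝ᵥ D.testOut g := by
  obtain ⟨lamX, hl⟩ := D.exists_lam_extension
  have hgi : ∀ i, ContDiff ℝ 1 fun s => g s i := fun i => contDiff_pi.1 hg i
  have hG : ∀ i, ContDiff ℝ 1 fun s => lamX i s * g s i := fun i => (hl i).1.mul (hgi i)
  obtain ⟨u, hu⟩ := D.exists_adjProfile_cls g hg
  obtain ⟨w, hw⟩ := exists_cls g hg.continuous
  have hi1 : ∀ i, Integrable (fun s => primitive c δ s i * deriv (fun s => lamX i s * g s i) s)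
      μ01 := fun i => by
    have := integrable_smul_of_continuous (L2.integrable_apply φ i)
      ((hG i).continuous_deriv le_rfl)
    refine this.congr ?_
    filter_upwards [hφ] with s hs
    rw [hs, smul_eq_mul, mul_comm]
  have hi2 : ∀ i, Integrable (fun s => δ s i * (lamX i s * g s i)) μ01 := fun i => by
    have := integrable_smul_of_continuous (L2.integrable_apply δ i) (hG i).continuous
    refine this.congr (Eventually.of_forall fun s => ?_)
    simp [mul_comm]
  have h1 : (∫ s, (φ s).ofLp ⬝ᵥ D.adjProfile g s ∂μ01) - ∫ s, (χ s).ofLp ⬝ᵥ g s ∂μ01 =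
      ∑ i, (primitive c δ 1 i * (lamX i 1 * g 1 i) - primitive c δ 0 i * (lamX i 0 * g 0 i)) := by
    rw [← integral_sub (integrable_dotProduct φ u hu) (integrable_dotProduct χ w hw)]
    simp_rw [fun i => (integral_by_parts c δ i (hG i)).symm,
      fun i => (integral_add (hi1 i) (hi2 i)).symm]
    rw [← integral_finsetSum _ fun i _ => (hi1 i).fun_add (hi2 i)]
    refine integral_congr_ae ?_
    filter_upwards [hφ, hχ, ae_μ01_of_forall fun s hs => hs] with s h2 h3 hs
    have h4 : (φ s).ofLp ⬝ᵥ ((D.Λ₁ s)ᵀ *ᵥ g s) = (D.Λ₁ s *ᵥ (φ s).ofLp) ⬝ᵥ g s := by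
      rw [Matrix.dotProduct_mulVec, Matrix.vecMul_transpose]
    have h5 : (φ s).ofLp ⬝ᵥ D.adjProfile g s =
        (φ s).ofLp ⬝ᵥ (fun i => deriv (fun σ => lamX i σ * g σ i) s) -
          (φ s).ofLp ⬝ᵥ ((D.Λ₁ s)ᵀ *ᵥ g s) := by
      rw [← dotProduct_sub]
      congr 1
      ext i
      exact D.adjProfile_eq hl g hs i
    rw [h5, h4, h3, sub_dotProduct, neg_dotProduct, h2]
    simp only [dotProduct, Finset.sum_add_distrib, mulVec_Λ₀_apply]
    have h6 : ∀ i, D.lam i s * (δ s).ofLp i * g s i = δ s i * (lamX i s * g s i) := fun i => by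
      rw [(hl i).2 (Ioo_subset_Icc_self hs)]; ring
    simp only [h6]
    ring
  have h0 : (0 : ℝ) ∈ Icc (0 : ℝ) 1 := by simp
  have h1' : (1 : ℝ) ∈ Icc (0 : ℝ) 1 := by simp
  rw [sub_eq_iff_eq_add'] at h1
  rw [h1, Fintype.sum_sum_type, add_assoc]
  congr 1
  simp only [dotProduct, Fintype.sum_sum_type, inflow, outflow, testIn, testOut, Sum.elim_inl,
    Sum.elim_inr, Finset.sum_sub_distrib, (hl _).2 h0, (hl _).2 h1', mul_neg,
    Finset.sum_neg_distrib]
  ring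

/-- Makes the boundary traces independent of the choice of continuous representative. -/
theorem eqOn_of_ae_eq {f f' : ℝ → EuclideanSpace ℝ (Idx ℓ r)} (hf : ContinuousOn f (Icc 0 1))
    (hf' : ContinuousOn f' (Icc 0 1)) (h : f =ᵐ[μ01] f') : EqOn f f' (Icc 0 1) := by
  refine Measure.eqOn_Icc_of_ae_eq volume zero_ne_one ?_ hf hf'
  rw [Measure.restrict_congr_set Ioo_ae_eq_Icc.symm]
  exact h

theorem inflow_congr {f f' : ℝ → EuclideanSpace ℝ (Idx ℓ r)} (h : EqOn f f' (Icc 0 1)) :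
    inflow f = inflow f' := by
  simp only [inflow, h (show (0 : ℝ) ∈ Icc (0 : ℝ) 1 by simp),
    h (show (1 : ℝ) ∈ Icc (0 : ℝ) 1 by simp)]

theorem outflow_congr {f f' : ℝ → EuclideanSpace ℝ (Idx ℓ r)} (h : EqOn f f' (Icc 0 1)) :
    outflow f = outflow f' := by
  simp only [outflow, h (show (0 : ℝ) ∈ Icc (0 : ℝ) 1 by simp),
    h (show (1 : ℝ) ∈ Icc (0 : ℝ) 1 by simp)]

/-- The boundary terms of the weak formulation, for given boundary values of the test function. -/
theorem boundary_identity (fi fo a act : Idx ℓ r → ℝ) (e : Fin m → ℝ) :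
    fi ⬝ᵥ a + fo ⬝ᵥ ((D.L₁ * D.K + D.L₂)ᵀ *ᵥ e - D.Kᵀ *ᵥ a) - (a - D.L₁ᵀ *ᵥ e) ⬝ᵥ act
      + e ⬝ᵥ (D.wy - D.yref) =
    (fi - (D.K *ᵥ fo + act)) ⬝ᵥ a +
      (D.L₁ *ᵥ (D.K *ᵥ fo + act) + D.L₂ *ᵥ fo + D.wy - D.yref) ⬝ᵥ e := by
  have h1 : fo ⬝ᵥ (D.Kᵀ *ᵥ a) = (D.K *ᵥ fo) ⬝ᵥ a := by
    rw [Matrix.dotProduct_mulVec, Matrix.vecMul_transpose]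
  have h2 : fo ⬝ᵥ ((D.L₁ * D.K + D.L₂)ᵀ *ᵥ e) =
      (D.L₁ *ᵥ (D.K *ᵥ fo)) ⬝ᵥ e + (D.L₂ *ᵥ fo) ⬝ᵥ e := by
    rw [Matrix.dotProduct_mulVec, Matrix.vecMul_transpose, Matrix.add_mulVec, add_dotProduct,
      Matrix.mulVec_mulVec]
  have h3 : (D.L₁ᵀ *ᵥ e) ⬝ᵥ act = (D.L₁ *ᵥ act) ⬝ᵥ e := by
    rw [dotProduct_comm, Matrix.dotProduct_mulVec, Matrix.vecMul_transpose]
  rw [dotProduct_sub, h1, h2, sub_dotProduct, h3, sub_dotProduct, add_dotProduct, sub_dotProduct,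
    add_dotProduct, add_dotProduct, Matrix.mulVec_add, add_dotProduct, dotProduct_comm a act,
    dotProduct_sub, dotProduct_comm e, dotProduct_comm e]
  ring

theorem IsStaticTest.testOut_eq {g : ℝ → Idx ℓ r → ℝ} {e : Fin m → ℝ} (h : D.IsStaticTest g e) :
    D.testOut g = (D.L₁ * D.K + D.L₂)ᵀ *ᵥ e - D.Kᵀ *ᵥ D.testIn g :=
  eq_sub_of_add_eq h.2

/-- Green's formula moves the operator onto the test. The adjoint boundary condition eliminates the
test's outflow trace, and the boundary condition of `v` then leaves only the output paired with `e`.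
-/
theorem IsRHS.weakRHS {v h : State ℓ r m} {δ : L2 ℓ r} (hr : D.IsRHS v δ h) : D.WeakRHS v h := by
  obtain ⟨hw, hχ, f, ⟨hfc, hfφ⟩, hbc, hout⟩ := hr
  obtain ⟨c, hc⟩ := hw.exists_primitive
  have hff : EqOn f (primitive c δ) (Icc 0 1) :=
    eqOn_of_ae_eq hfc (continuousOn_primitive c δ) (hfφ.symm.trans hc)
  intro g e hge
  have hg := D.green hc hχ hge.1
  have hb := D.boundary_identity (inflow f) (outflow f) (D.testIn g) (D.actuation v.2) e
  rw [BC] at hbc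
  rw [← hbc, sub_self, zero_dotProduct, zero_add] at hb
  rw [pairing, pairing, hg, ← inflow_congr hff, ← outflow_congr hff, hge.testOut_eq, hout,
    dotProduct_zero]
  simp only [output, WithLp.ofLp_sub]
  linarith

/-- The inflow trace and `e` can be prescribed freely because the adjoint boundary condition merely
determines the outflow trace. Interpolating the four end values of `λ g` affinely and multiplying by
an extension `κ` of `1 / λ` realises them. -/
theorem exists_staticTest (a : Idx ℓ r → ℝ) (e : Fin m → ℝ) :
    ∃ g, D.IsStaticTest g e ∧ D.testIn g = a := by
  obtain ⟨κ, hκ⟩ := D.exists_lam_inv_extension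
  let b := (D.L₁ * D.K + D.L₂)ᵀ *ᵥ e - D.Kᵀ *ᵥ a
  let G0 : Idx ℓ r → ℝ := Sum.elim (fun i => -a (Sum.inl i)) (fun j => -b (Sum.inr j))
  let G1 : Idx ℓ r → ℝ := Sum.elim (fun i => b (Sum.inl i)) (fun j => a (Sum.inr j))
  let g : ℝ → Idx ℓ r → ℝ := fun s i => κ i s * ((1 - s) * G0 i + s * G1 i)
  have h0 : ∀ i, D.lam i 0 * g 0 i = G0 i := fun i => by
    have := (hκ i).2 0 (by simp)
    simp only [g]
    linear_combination G0 i * this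
  have h1 : ∀ i, D.lam i 1 * g 1 i = G1 i := fun i => by
    have := (hκ i).2 1 (by simp)
    simp only [g]
    linear_combination G1 i * this
  have hin : D.testIn g = a := by
    ext (i | i)
    · simp [testIn, h0, G0]
    · simp [testIn, h1, G1]
  have hout : D.testOut g = b := by
    ext (i | i)
    · simp [testOut, h1, G1]
    · simp [testOut, h0, G0]
  refine ⟨g, ⟨?_, ?_⟩, hin⟩
  · refine contDiff_pi.2 fun i => (hκ i).1.mul ?_
    fun_prop
  · rw [hin, hout]; simp [b]

/-- Tests vanishing at both ends identify the weak derivative; tests with arbitrary boundary data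
then force the boundary condition and the value of the output. -/
theorem WeakRHS.exists_isRHS {v h : State ℓ r m} (hw : D.WeakRHS v h) : ∃ δ, D.IsRHS v δ h := by
  obtain ⟨κ, hκ⟩ := D.exists_lam_inv_extension
  obtain ⟨T₁, hT₁⟩ := exists_mulOp (ℓ := ℓ) (r := r) D.Λ₁ fun i j => (D.Λ₁_C1 i j).continuousOn
  obtain ⟨T₀, hT₀⟩ := exists_mulOp (ℓ := ℓ) (r := r)
    (fun s => Matrix.diagonal fun i => κ i s) fun i j => by
      rcases eq_or_ne i j with rfl | hij
      · simpa using (hκ i).1.continuous.continuousOn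
      · simpa [Matrix.diagonal_apply_ne _ hij] using continuousOn_const
  -- The only candidate, obtained by solving `h = -Λ₀ δ - Λ₁ φ` for `δ`.
  let δ : L2 ℓ r := -T₀ (h.1 + T₁ v.1)
  have hδ : ∀ᵐ s ∂μ01, ∀ i, δ s i = -(κ i s * (h.1 s i + (D.Λ₁ s *ᵥ (v.1 s).ofLp) i)) := by
    filter_upwards [hT₁ v.1, hT₀ (h.1 + T₁ v.1), Lp.coeFn_neg (T₀ (h.1 + T₁ v.1)),
      Lp.coeFn_add h.1 (T₁ v.1)] with s h1 h2 h3 h4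
    intro i
    rw [show δ s = -(T₀ (h.1 + T₁ v.1) s) from h3, PiLp.neg_apply, h2, Matrix.mulVec_diagonal, h4]
    simp only [Pi.add_apply, WithLp.ofLp_add, h1]
  have hχ : ∀ᵐ s ∂μ01,
      (h.1 s).ofLp = -(D.Λ₀ s *ᵥ (δ s).ofLp) - D.Λ₁ s *ᵥ (v.1 s).ofLp := by
    filter_upwards [hδ, ae_μ01_of_forall fun s hs => hs] with s h1 hs
    ext i
    rw [Pi.sub_apply, Pi.neg_apply, mulVec_Λ₀_apply, h1]
    have := (hκ i).2 s (Ioo_subset_Icc_self hs)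
    linear_combination (-(h.1 s i + (D.Λ₁ s *ᵥ (v.1 s).ofLp) i)) * this
  have hweak : HasWeakDeriv v.1 δ := by
    intro χ hχs hχc hχt
    have hχ1 : ContDiff ℝ 1 χ := hχs.of_le (by exact_mod_cast le_top)
    have hout : ∀ s ∉ Ioo (0 : ℝ) 1, χ s = 0 := fun s hs =>
      image_eq_zero_of_notMem_tsupport fun h => hs (hχt h)
    ext i
    rw [PiLp.neg_apply, integral_apply (integrable_smul_of_continuous (L2.integrable v.1)
        (hχ1.continuous_deriv le_rfl)),
      integral_apply (integrable_smul_of_continuous (L2.integrable δ) hχ1.continuous)]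
    -- On `[0,1]` the factor `κ` cancels `λ`, so `Λ₀ g` is the scalar test `χ` in direction `i`.
    let g : ℝ → Idx ℓ r → ℝ := fun s => Pi.single i (κ i s * χ s)
    have hg : ContDiff ℝ 1 g := by
      refine contDiff_pi.2 fun j => ?_
      rcases eq_or_ne j i with rfl | hij
      · simpa [g] using (hκ j).1.mul hχ1
      · simpa [g, Pi.single_eq_of_ne hij] using contDiff_const
    have hg0 : g 0 = 0 := by simp [g, hout 0 (by simp)]
    have hg1 : g 1 = 0 := by simp [g, hout 1 (by simp)]
    have hin : D.testIn g = 0 := by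
      ext (j | j) <;> simp [testIn, hg0, hg1]
    have hout' : D.testOut g = 0 := by
      ext (j | j) <;> simp [testOut, hg0, hg1]
    have key := hw g 0 ⟨hg, by simp [hin, hout']⟩
    simp only [hin, pairing, Matrix.mulVec_zero, sub_zero, zero_dotProduct, add_zero,
      dotProduct_zero] at key
    obtain ⟨w, hw'⟩ := exists_cls g hg.continuous
    obtain ⟨u, hu⟩ := D.exists_adjProfile_cls g hg
    have hI1 : Integrable (fun s => deriv χ s * v.1 s i) μ01 := by
      simpa using integrable_smul_of_continuous (L2.integrable_apply v.1 i)
        (hχ1.continuous_deriv le_rfl)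
    have hI2 := integrable_dotProduct (T₁ v.1) w hw'
    have e1 : ∫ s, (v.1 s).ofLp ⬝ᵥ D.adjProfile g s ∂μ01 =
        (∫ s, deriv χ s * v.1 s i ∂μ01) - ∫ s, (T₁ v.1 s).ofLp ⬝ᵥ g s ∂μ01 := by
      rw [← integral_sub hI1 hI2]
      refine integral_congr_ae ?_
      filter_upwards [hT₁ v.1, ae_μ01_of_forall fun s hs => hs] with s h1 hs
      have h4 : (v.1 s).ofLp ⬝ᵥ ((D.Λ₁ s)ᵀ *ᵥ g s) = (D.Λ₁ s *ᵥ (v.1 s).ofLp) ⬝ᵥ g s := by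
        rw [Matrix.dotProduct_mulVec, Matrix.vecMul_transpose]
      rw [h1, ← h4]
      have h5 : D.adjProfile g s = Pi.single i (deriv χ s) - (D.Λ₁ s)ᵀ *ᵥ g s := by
        ext j
        rw [adjProfile, Pi.sub_apply]
        congr 1
        rcases eq_or_ne j i with rfl | hij
        · rw [Pi.single_eq_same]
          apply Filter.EventuallyEq.deriv_eq
          filter_upwards [Icc_mem_nhds hs.1 hs.2] with σ hσ
          simp only [g, Pi.single_eq_same]
          linear_combination χ σ * (hκ j).2 σ hσ
        · simp [g, Pi.single_eq_of_ne hij]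
      rw [h5, dotProduct_sub, dotProduct_single, mul_comm]
    have e2 : (∫ s, (h.1 s).ofLp ⬝ᵥ g s ∂μ01) + ∫ s, (T₁ v.1 s).ofLp ⬝ᵥ g s ∂μ01 =
        - ∫ s, χ s * δ s i ∂μ01 := by
      rw [← integral_add (integrable_dotProduct h.1 w hw') hI2, ← integral_neg]
      refine integral_congr_ae ?_
      filter_upwards [hT₁ v.1, hδ] with s h1 h2
      rw [h2, h1]
      simp only [g, dotProduct_single]
      ring
    simp only [PiLp.smul_apply, smul_eq_mul]
    linarith
  obtain ⟨c, hc⟩ := hweak.exists_primitive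
  -- With `a` and `e` independent, `e = 0` isolates the boundary condition and `a = 0` the output
  -- equation.
  have hid : ∀ a e, (inflow (primitive c δ) - (D.K *ᵥ outflow (primitive c δ) +
        D.actuation v.2)) ⬝ᵥ a + (D.L₁ *ᵥ (D.K *ᵥ outflow (primitive c δ) + D.actuation v.2) +
        D.L₂ *ᵥ outflow (primitive c δ) + D.wy - D.yref) ⬝ᵥ e = h.2.ofLp ⬝ᵥ e := by
    intro a e
    obtain ⟨g, hge, hga⟩ := D.exists_staticTest a e
    have h1 := hw g e hge
    have h2 := D.boundary_identity (inflow (primitive c δ)) (outflow (primitive c δ)) a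
      (D.actuation v.2) e
    rw [pairing, pairing, D.green hc hχ hge.1, hge.testOut_eq, hga, dotProduct_zero] at h1
    linarith
  have hbc : D.BC (primitive c δ) v.2 := by
    rw [BC, ← sub_eq_zero]
    refine dotProduct_eq_zero_iff.1 fun a => ?_
    simpa using hid a 0
  refine ⟨δ, hweak, hχ, primitive c δ, ⟨continuousOn_primitive c δ, hc⟩, hbc, ?_⟩
  have h3 : D.L₁ *ᵥ (D.K *ᵥ outflow (primitive c δ) + D.actuation v.2) +
        D.L₂ *ᵥ outflow (primitive c δ) + D.wy - D.yref = h.2.ofLp := by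
    refine dotProduct_eq _ _ fun e => ?_
    simpa using hid 0 e
  rw [BC] at hbc
  rw [← hbc] at h3
  ext j
  rw [← h3]
  simp [output]

end ClosedLoop

/-! ### The state norm and the duality pairing as a functional. -/

section StateNorm

variable {ℓ r m : ℕ}

theorem stateNorm_nonneg (v : State ℓ r m) : 0 ≤ stateNorm v := by
  rw [stateNorm]; positivity

theorem norm_le_stateNorm (v : State ℓ r m) : ‖v‖ ≤ stateNorm v := by
  rw [stateNorm, Prod.norm_def]
  exact max_le (le_add_of_nonneg_right (norm_nonneg _)) (le_add_of_nonneg_left (norm_nonneg _))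

theorem continuous_stateNorm : Continuous (stateNorm : State ℓ r m → ℝ) :=
  continuous_fst.norm.add continuous_snd.norm

theorem stateNorm_sub_comm (v w : State ℓ r m) : stateNorm (v - w) = stateNorm (w - v) := by
  simp only [stateNorm, Prod.fst_sub, Prod.snd_sub, norm_sub_rev]

theorem stateNorm_smul (c : ℝ) (v : State ℓ r m) : stateNorm (c • v) = |c| * stateNorm v := by
  simp only [stateNorm, Prod.smul_fst, Prod.smul_snd, norm_smul, Real.norm_eq_abs]
  ring

theorem eq_of_stateNorm_sub_le_zero {v w : State ℓ r m} (h : stateNorm (v - w) ≤ 0) : v = w :=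
  sub_eq_zero.1 (norm_le_zero_iff.1 ((norm_le_stateNorm _).trans h))

/-- The functional `v ↦ ⟨v, (u, z)⟩`. -/
def pairCLM (u : L2 ℓ r) (z : EuclideanSpace ℝ (Fin m)) : State ℓ r m →L[ℝ] ℝ :=
  (innerSL ℝ u).comp (ContinuousLinearMap.fst ℝ _ _) +
    (innerSL ℝ z).comp (ContinuousLinearMap.snd ℝ _ _)

theorem pairing_eq_pairCLM (v : State ℓ r m) (u : L2 ℓ r) {g : ℝ → Idx ℓ r → ℝ} (e : Fin m → ℝ)
    (hu : ∀ᵐ s ∂μ01, (u s).ofLp = g s) :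
    ClosedLoop.pairing v g e = pairCLM u (WithLp.toLp 2 e) v := by
  rw [pairing_eq_inner v u e hu, real_inner_comm, real_inner_comm (WithLp.toLp 2 e)]
  rfl

end StateNorm

/-! ### Homogeneous dynamics, Lyapunov decay and uniqueness. -/

namespace ClosedLoop

variable {ℓ r m : ℕ} (D : ClosedLoop ℓ r m)

/-- The component of the formal adjoint along the integral state. -/
def adjZ (g : ℝ → Idx ℓ r → ℝ) (e : Fin m → ℝ) : Fin m → ℝ :=
  -(D.ki • (D.Kiᵀ *ᵥ (D.Bᵀ *ᵥ (D.testIn g - D.L₁ᵀ *ᵥ e))))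

/-- The homogeneous version of `WeakRHS`. -/
def LinRHS (x y : State ℓ r m) : Prop :=
  ∀ g e, D.IsStaticTest g e → pairing x (D.adjProfile g) (D.adjZ g e) = pairing y g e

theorem testIn_dotProduct_actuation (g : ℝ → Idx ℓ r → ℝ) (e : Fin m → ℝ)
    (z : EuclideanSpace ℝ (Fin m)) :
    (D.testIn g - D.L₁ᵀ *ᵥ e) ⬝ᵥ D.actuation z =
      (D.testIn g - D.L₁ᵀ *ᵥ e) ⬝ᵥ D.wb - z.ofLp ⬝ᵥ D.adjZ g e := by
  rw [actuation, adjZ, dotProduct_add, dotProduct_neg, dotProduct_smul,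
    Matrix.dotProduct_mulVec z.ofLp, Matrix.vecMul_transpose, Matrix.dotProduct_mulVec _ D.Bᵀ,
    Matrix.vecMul_transpose, Matrix.mulVec_smul, dotProduct_smul, dotProduct_comm (D.B *ᵥ _)]
  ring

/-- The contribution of the exogenous signals to the weak formulation. -/
def source (g : ℝ → Idx ℓ r → ℝ) (e : Fin m → ℝ) : ℝ :=
  e ⬝ᵥ (D.wy - D.yref) - (D.testIn g - D.L₁ᵀ *ᵥ e) ⬝ᵥ D.wb

/-- The actuation is affine in `z`: its linear part is transposed onto the test as `adjZ`, and
everything independent of the state collects in `source`, which cancels in differences of solutions.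
-/
theorem weakForm_eq (v : State ℓ r m) (a g : ℝ → Idx ℓ r → ℝ) (b e : Fin m → ℝ) :
    pairing v a b - (D.testIn g - D.L₁ᵀ *ᵥ e) ⬝ᵥ D.actuation v.2 + e ⬝ᵥ (D.wy - D.yref) =
      pairing v a (b + D.adjZ g e) + D.source g e := by
  rw [testIn_dotProduct_actuation, source, pairing, pairing, dotProduct_add]
  ring

theorem weakRHS_iff (v h : State ℓ r m) : D.WeakRHS v h ↔ ∀ g e, D.IsStaticTest g e →
    pairing v (D.adjProfile g) (D.adjZ g e) + D.source g e = pairing h g e := by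
  simp only [WeakRHS, weakForm_eq, zero_add]

variable {D}

theorem WeakRHS.sub {v h w k : State ℓ r m} (hv : D.WeakRHS v h) (hw : D.WeakRHS w k) :
    D.LinRHS (v - w) (h - k) := by
  intro g e hge
  have h1 := (D.weakRHS_iff v h).1 hv g e hge
  have h2 := (D.weakRHS_iff w k).1 hw g e hge
  obtain ⟨u, hu⟩ := exists_cls g hge.1.continuous
  obtain ⟨a, ha⟩ := D.exists_adjProfile_cls g hge.1
  simp only [pairing_eq_pairCLM _ _ _ hu, pairing_eq_pairCLM _ _ _ ha] at *
  rw [map_sub, map_sub]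
  linarith

theorem WeakRHS.add_lin {v h x y : State ℓ r m} (hv : D.WeakRHS v h) (hx : D.LinRHS x y) :
    D.WeakRHS (v + x) (h + y) := by
  rw [weakRHS_iff]
  intro g e hge
  have h1 := (D.weakRHS_iff v h).1 hv g e hge
  have h2 := hx g e hge
  obtain ⟨u, hu⟩ := exists_cls g hge.1.continuous
  obtain ⟨a, ha⟩ := D.exists_adjProfile_cls g hge.1
  simp only [pairing_eq_pairCLM _ _ _ hu, pairing_eq_pairCLM _ _ _ ha] at *
  rw [map_add, map_add]
  linarith

theorem LinRHS.smul {x y : State ℓ r m} (c : ℝ) (hx : D.LinRHS x y) :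
    D.LinRHS (c • x) (c • y) := by
  intro g e hge
  have h2 := hx g e hge
  obtain ⟨u, hu⟩ := exists_cls g hge.1.continuous
  obtain ⟨a, ha⟩ := D.exists_adjProfile_cls g hge.1
  simp only [pairing_eq_pairCLM _ _ _ hu, pairing_eq_pairCLM _ _ _ ha] at *
  rw [map_smul, map_smul, h2]

theorem IsTest.static {T : ℝ} {ψ : ℝ → ℝ → Idx ℓ r → ℝ} {η : ℝ → Fin m → ℝ}
    (h : D.IsTest T ψ η) {t : ℝ} (ht : t ∈ Icc 0 T) : D.IsStaticTest (ψ t) (η t) :=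
  ⟨h.1.comp (contDiff_const.prodMk contDiff_id), h.2.2 t ht⟩

theorem IsStaticTest.isTest {g : ℝ → Idx ℓ r → ℝ} {e : Fin m → ℝ} (h : D.IsStaticTest g e)
    (T : ℝ) : D.IsTest T (fun _ => g) (fun _ => e) :=
  ⟨h.1.comp contDiff_snd, contDiff_const, fun _ _ => h.2⟩

theorem hasDerivAt_partial {ψ : ℝ → ℝ → Idx ℓ r → ℝ}
    (hψ : ContDiff ℝ 1 fun p : ℝ × ℝ => ψ p.1 p.2) (t s : ℝ) :
    HasDerivAt (fun τ => ψ τ s) (fderiv ℝ (fun p : ℝ × ℝ => ψ p.1 p.2) (t, s) (1, 0)) t :=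
  (hψ.differentiable one_ne_zero (t, s)).hasFDerivAt.comp_hasDerivAt (f := fun τ => (τ, s)) t
    ((hasDerivAt_id t).prodMk (hasDerivAt_const t s))

theorem adjointExpr_eq {ψ : ℝ → ℝ → Idx ℓ r → ℝ}
    (hψ : ContDiff ℝ 1 fun p : ℝ × ℝ => ψ p.1 p.2) (t s : ℝ) :
    D.adjointExpr ψ t s =
      fderiv ℝ (fun p : ℝ × ℝ => ψ p.1 p.2) (t, s) (1, 0) + D.adjProfile (ψ t) s := by
  ext i
  rw [adjointExpr, Pi.add_apply, adjProfile, add_sub_assoc]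
  congr 1
  exact (hasDerivAt_pi.1 (hasDerivAt_partial hψ t s) i).deriv

theorem exists_test_curves {ψ : ℝ → ℝ → Idx ℓ r → ℝ}
    (hψ : ContDiff ℝ 1 fun p : ℝ × ℝ => ψ p.1 p.2) :
    ∃ Ψ Ψ' : ℝ → L2 ℓ r, Continuous Ψ' ∧ (∀ t, HasDerivAt Ψ (Ψ' t) t) ∧
      (∀ t, ∀ᵐ s ∂μ01, (Ψ t s).ofLp = ψ t s) ∧
      ∀ t, ∀ᵐ s ∂μ01,
        (Ψ' t s).ofLp = fderiv ℝ (fun p : ℝ × ℝ => ψ p.1 p.2) (t, s) (1, 0) :=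
  exists_curve_hasDerivAt ψ _ hψ.continuous
    ((hψ.continuous_fderiv one_ne_zero).clm_apply continuous_const) (hasDerivAt_partial hψ)

/-- A `C¹` curve solving the system in the weak sense at each time is a weak solution. -/
theorem isWeakSol_of_hasDerivWithinAt {v v' : ℝ → State ℓ r m}
    (hv : ∀ t, 0 ≤ t → HasDerivWithinAt v (v' t) (Ici 0) t) (hv' : ContinuousOn v' (Ici 0))
    (hr : ∀ t, 0 ≤ t → D.WeakRHS (v t) (v' t)) : D.IsWeakSol (v 0) v := by
  have hvc : ContinuousOn v (Ici 0) := fun t ht => (hv t ht).continuousWithinAt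
  refine ⟨rfl, hvc, fun T hT ψ η htest => ?_⟩
  obtain ⟨Ψ, Ψ', hΨ'c, hΨd, hΨ, hΨ'⟩ := exists_test_curves htest.1
  have hΨc : Continuous Ψ := continuous_iff_continuousAt.2 fun t => (hΨd t).continuousAt
  let e : (Fin m → ℝ) →L[ℝ] EuclideanSpace ℝ (Fin m) :=
    ((EuclideanSpace.equiv (Fin m) ℝ).symm : (Fin m → ℝ) →L[ℝ] EuclideanSpace ℝ (Fin m))
  have hηd : ∀ t, HasDerivAt (fun t => e (η t)) (e (deriv η t)) t := fun t =>
    e.hasFDerivAt.comp_hasDerivAt t (htest.2.1.differentiable one_ne_zero t).hasDerivAt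
  have hηc : Continuous fun t => e (η t) := e.continuous.comp htest.2.1.continuous
  have hη'c : Continuous fun t => e (deriv η t) :=
    e.continuous.comp (htest.2.1.continuous_deriv le_rfl)
  have hsub : Icc 0 T ⊆ Ici 0 := Icc_subset_Ici_self
  have hF : ∀ t, pairing (v t) (ψ t) (η t) =
      inner ℝ (v t).1 (Ψ t) + inner ℝ (v t).2 (e (η t)) := fun t =>
    pairing_eq_inner (v t) (Ψ t) (η t) (hΨ t)
  let F' : ℝ → ℝ := fun t => (inner ℝ (v t).1 (Ψ' t) + inner ℝ (v' t).1 (Ψ t)) +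
    (inner ℝ (v t).2 (e (deriv η t)) + inner ℝ (v' t).2 (e (η t)))
  have hFd : ∀ t ∈ Icc 0 T,
      HasDerivWithinAt (fun t => pairing (v t) (ψ t) (η t)) (F' t) (Icc 0 T) t := by
    intro t ht
    have h0 := (hv t ht.1).mono hsub
    have h1 : HasDerivWithinAt (fun t => (v t).1) (v' t).1 (Icc 0 T) t :=
      (ContinuousLinearMap.fst ℝ (L2 ℓ r) (EuclideanSpace ℝ (Fin m))).hasFDerivAt.comp_hasDerivWithinAt
        t h0
    have h2 : HasDerivWithinAt (fun t => (v t).2) (v' t).2 (Icc 0 T) t :=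
      (ContinuousLinearMap.snd ℝ (L2 ℓ r) (EuclideanSpace ℝ (Fin m))).hasFDerivAt.comp_hasDerivWithinAt
        t h0
    simp_rw [hF]
    exact (h1.inner ℝ (hΨd t).hasDerivWithinAt).add (h2.inner ℝ (hηd t).hasDerivWithinAt)
  have hF'c : ContinuousOn F' (Icc 0 T) := by
    have h1 := hvc.mono hsub
    have h2 := hv'.mono hsub
    exact ((h1.fst.inner hΨ'c.continuousOn).add (h2.fst.inner hΨc.continuousOn)).add
      ((h1.snd.inner hη'c.continuousOn).add (h2.snd.inner hηc.continuousOn))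
  have hFTC := intervalIntegral.integral_eq_sub_of_hasDerivAt_of_le hT.le
    (fun t ht => (hFd t ht).continuousWithinAt)
    (fun t ht => (hFd t (Ioo_subset_Icc_self ht)).hasDerivAt (Icc_mem_nhds ht.1 ht.2))
    (hF'c.intervalIntegrable_of_Icc hT.le)
  rw [← hFTC]
  refine intervalIntegral.integral_congr fun t ht => ?_
  rw [uIcc_of_le hT.le] at ht
  have hst := htest.static ht
  obtain ⟨a, ha⟩ := D.exists_adjProfile_cls (ψ t) hst.1
  have h1 := (D.weakRHS_iff _ _).1 (hr t ht.1) _ _ hst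
  have hsum : ∀ᵐ s ∂μ01, ((Ψ' t + a) s).ofLp = D.adjointExpr ψ t s := by
    filter_upwards [hΨ' t, ha, Lp.coeFn_add (Ψ' t) a] with s h2 h3 h4
    rw [h4, Pi.add_apply, WithLp.ofLp_add, h2, h3, adjointExpr_eq htest.1]
  rw [weakForm_eq, pairing_eq_inner _ _ _ hsum, inner_add_right, WithLp.toLp_add, inner_add_right]
  rw [pairing_eq_inner _ _ _ ha, pairing_eq_inner _ _ _ (hΨ t)] at h1
  change inner ℝ (v t).1 (Ψ' t) + inner ℝ (v' t).1 (Ψ t) +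
    (inner ℝ (v t).2 (WithLp.toLp 2 (deriv η t)) + inner ℝ (v' t).2 (WithLp.toLp 2 (η t))) = _
  linarith

theorem contDiffOn_of_hasDerivWithinAt {v v' : ℝ → State ℓ r m}
    (hv : ∀ t, 0 ≤ t → HasDerivWithinAt v (v' t) (Ici 0) t) (hv' : ContinuousOn v' (Ici 0)) :
    ContDiffOn ℝ 1 v (Ici 0) := by
  have hu : UniqueDiffOn ℝ (Ici (0 : ℝ)) := uniqueDiffOn_Ici 0
  rw [show (1 : WithTop ℕ∞) = 0 + 1 by norm_num, contDiffOn_succ_iff_derivWithin hu]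
  refine ⟨fun t ht => (hv t ht).differentiableWithinAt, by simp, ?_⟩
  rw [contDiffOn_zero]
  exact hv'.congr fun t ht => (hv t ht).derivWithin (hu t ht)

/-- Exponential decay of `C¹` weak solutions. -/
theorem IsLyapunov.decay {vinf : State ℓ r m} {V : State ℓ r m → ℝ} {L μ : ℝ}
    (hV : D.IsLyapunov vinf V L μ) (hL : 0 < L) {v₀ : State ℓ r m} {v : ℝ → State ℓ r m}
    (hv : D.IsWeakSol v₀ v) (hC : ContDiffOn ℝ 1 v (Ici 0)) {t : ℝ} (ht : 0 ≤ t) :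
    stateNorm (v t - vinf) ≤ L * Real.exp (-(μ / 2) * t) * stateNorm (v₀ - vinf) := by
  obtain ⟨-, hbd, hdec⟩ := hV
  choose! d hd hd' using fun t (ht : 0 ≤ t) => hdec v₀ v hv t ht (hC t ht)
  have hg : ∀ t, 0 ≤ t → HasDerivWithinAt (fun t => Real.exp (μ * t) * V (v t))
      (Real.exp (μ * t) * μ * V (v t) + Real.exp (μ * t) * d t) (Ici 0) t := by
    intro t ht
    have h1 : HasDerivAt (fun t => Real.exp (μ * t)) (Real.exp (μ * t) * μ) t := by
      simpa using ((hasDerivAt_id t).const_mul μ).exp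
    exact h1.hasDerivWithinAt.mul (hd t ht)
  -- Gronwall's argument: the decay inequality says that the derivative of `exp (μ t) V` is
  -- nonpositive.
  have hanti : AntitoneOn (fun t => Real.exp (μ * t) * V (v t)) (Ici 0) := by
    refine antitoneOn_of_hasDerivWithinAt_nonpos (convex_Ici 0)
      (fun t ht => (hg t ht).continuousWithinAt) (fun t ht => (hg t (interior_subset ht)).mono
        interior_subset) fun t ht => ?_
    have h1 := hd' t (interior_subset ht)
    have h2 := Real.exp_pos (μ * t)
    nlinarith
  have h1 : Real.exp (μ * t) * V (v t) ≤ V v₀ := by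
    have := hanti (show (0 : ℝ) ∈ Ici 0 by simp) ht ht
    simpa [hv.1] using this
  have h2 := (hbd (v t)).1
  have h3 := (hbd v₀).2
  rw [div_le_iff₀ hL] at h2
  rw [stateNorm_sub_comm (v t), stateNorm_sub_comm v₀]
  have hn := stateNorm_nonneg (vinf - v₀)
  -- `V` is comparable to the squared norm, so the square root halves the rate, and the two factors
  -- `L` from the equivalence combine into one.
  refine le_of_sq_le_sq ?_ (by positivity)
  have h4 : Real.exp (μ * t) * (Real.exp (-(μ / 2) * t)) ^ 2 = 1 := by
    rw [← Real.exp_nat_mul, ← Real.exp_add, ← Real.exp_zero]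
    congr 1; push_cast; ring
  have h5 : V (v t) ≤ Real.exp (-(μ / 2) * t) ^ 2 * V v₀ := by
    calc V (v t) = Real.exp (-(μ / 2) * t) ^ 2 * (Real.exp (μ * t) * V (v t)) := by
          linear_combination (-V (v t)) * h4
      _ ≤ _ := by gcongr
  calc stateNorm (vinf - v t) ^ 2 ≤ V (v t) * L := h2
    _ ≤ (Real.exp (-(μ / 2) * t) ^ 2 * (L * stateNorm (vinf - v₀) ^ 2)) * L := by
        gcongr
        exact h5.trans (by gcongr)
    _ = _ := by ring

theorem IsEquilibrium.weakRHS {v : State ℓ r m} (h : D.IsEquilibrium v) : D.WeakRHS v 0 := by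
  obtain ⟨δ, h⟩ := h
  exact IsRHS.weakRHS D h

theorem IsEquilibrium.isWeakSol {v : State ℓ r m} (h : D.IsEquilibrium v) :
    D.IsWeakSol v fun _ => v :=
  isWeakSol_of_hasDerivWithinAt (v := fun _ => v) (v' := fun _ => 0)
    (fun t _ => hasDerivWithinAt_const t _ v) continuousOn_const fun _ _ => h.weakRHS

/-- Curves with the homogeneous dynamics decay exponentially. -/
theorem IsLyapunov.decay_lin {vinf : State ℓ r m} {V : State ℓ r m → ℝ} {L μ : ℝ}
    (hV : D.IsLyapunov vinf V L μ) (hL : 0 < L) (heq : D.IsEquilibrium vinf)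
    {x x' : ℝ → State ℓ r m} (hx : ∀ t, 0 ≤ t → HasDerivWithinAt x (x' t) (Ici 0) t)
    (hx' : ContinuousOn x' (Ici 0)) (hr : ∀ t, 0 ≤ t → D.LinRHS (x t) (x' t)) {t : ℝ}
    (ht : 0 ≤ t) : stateNorm (x t) ≤ L * Real.exp (-(μ / 2) * t) * stateNorm (x 0) := by
  have hd : ∀ t, 0 ≤ t → HasDerivWithinAt (fun t => vinf + x t) (x' t) (Ici 0) t :=
    fun t ht => (hx t ht).const_add vinf
  have h1 : D.IsWeakSol (vinf + x 0) fun t => vinf + x t :=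
    isWeakSol_of_hasDerivWithinAt (v := fun t => vinf + x t) hd hx' fun t ht => by
      simpa using heq.weakRHS.add_lin (hr t ht)
  simpa using hV.decay hL h1 (contDiffOn_of_hasDerivWithinAt hd hx') ht

/-- An equilibrium is a constant `C¹` weak solution, and its constant distance to `vinf` must decay.
-/
theorem IsLyapunov.equilibrium_unique {vinf : State ℓ r m} {V : State ℓ r m → ℝ} {L μ : ℝ}
    (hV : D.IsLyapunov vinf V L μ) (hL : 0 < L) (hμ : 0 < μ) {v : State ℓ r m}
    (hv : D.IsEquilibrium v) : v = vinf := by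
  have h1 : Tendsto (fun t : ℝ => L * Real.exp (-(μ / 2) * t) * stateNorm (v - vinf)) atTop
      (𝓝 (L * 0 * stateNorm (v - vinf))) := by
    refine ((Real.tendsto_exp_atBot.comp ?_).const_mul L).mul_const _
    exact tendsto_id.const_mul_atTop_of_neg (by linarith)
  rw [mul_zero, zero_mul] at h1
  refine eq_of_stateNorm_sub_le_zero (ge_of_tendsto h1 ?_)
  filter_upwards [eventually_ge_atTop 0] with t ht
  exact hV.decay hL hv.isWeakSol contDiffOn_const ht

/-- Tests constant in time reduce the weak formulation to the time-integrated equation, which is all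
that uniqueness requires. -/
theorem IsWeakSol.static {v₀ : State ℓ r m} {v : ℝ → State ℓ r m} (hv : D.IsWeakSol v₀ v)
    {T : ℝ} (hT : 0 ≤ T) {g : ℝ → Idx ℓ r → ℝ} {e : Fin m → ℝ} (hge : D.IsStaticTest g e)
    {u a : L2 ℓ r} (hu : ∀ᵐ s ∂μ01, (u s).ofLp = g s)
    (ha : ∀ᵐ s ∂μ01, (a s).ofLp = D.adjProfile g s) :
    pairCLM u (WithLp.toLp 2 e) (v T - v₀) =
      ∫ t in (0 : ℝ)..T, (pairCLM a (WithLp.toLp 2 (D.adjZ g e)) (v t) + D.source g e) := by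
  rcases hT.eq_or_lt with rfl | hT
  · rw [hv.1]; simp
  have h := hv.2.2 T hT _ _ (hge.isTest T)
  rw [pairing_eq_pairCLM _ _ _ hu, pairing_eq_pairCLM _ _ _ hu, ← map_sub] at h
  rw [h]
  refine intervalIntegral.integral_congr fun t _ => ?_
  dsimp only
  have hadj : D.adjointExpr (fun _ => g) t = D.adjProfile g := by
    ext s i
    simp [adjointExpr, adjProfile]
  rw [weakForm_eq, hadj, deriv_const, zero_add, pairing_eq_pairCLM _ _ _ ha]

/-- Decay is available only for `C¹` solutions, while the difference `d` of two weak solutions is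
merely continuous. Its time integral is `C¹`, starts at `0` and has the homogeneous dynamics, so the
decay estimate makes it vanish, and `d` is its derivative. -/
theorem IsLyapunov.weakSol_unique {vinf : State ℓ r m} {V : State ℓ r m → ℝ} {L μ : ℝ}
    (hV : D.IsLyapunov vinf V L μ) (hL : 0 < L) (heq : D.IsEquilibrium vinf)
    {v₀ : State ℓ r m} {v w : ℝ → State ℓ r m} (hv : D.IsWeakSol v₀ v) (hw : D.IsWeakSol v₀ w) :
    EqOn w v (Ici 0) := by
  -- Freezing at time `0` makes `d` continuous on `ℝ`, so that its primitive has two-sided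
  -- derivatives.
  let d : ℝ → State ℓ r m := fun t => w (max t 0) - v (max t 0)
  have hmax : ∀ t : ℝ, max t 0 ∈ Ici (0 : ℝ) := fun t => le_max_right t 0
  have hdc : Continuous d := (hw.2.1.comp_continuous (by fun_prop) hmax).sub
    (hv.2.1.comp_continuous (by fun_prop) hmax)
  have hd : ∀ t, 0 ≤ t → d t = w t - v t := fun t ht => by simp only [d, max_eq_left ht]
  have hW : ∀ t, HasDerivAt (fun t => ∫ τ in (0 : ℝ)..t, d τ) (d t) t := fun t =>
    (hdc.integral_hasStrictDerivAt 0 t).hasDerivAt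
  -- Subtracting the two time-integrated identities cancels the sources, and the continuous
  -- functional commutes with the integral.
  have hlin : ∀ t, 0 ≤ t → D.LinRHS (∫ τ in (0 : ℝ)..t, d τ) (d t) := by
    intro t ht g e hge
    obtain ⟨u, hu⟩ := exists_cls g hge.1.continuous
    obtain ⟨a, ha⟩ := D.exists_adjProfile_cls g hge.1
    have h1 := hw.static ht hge hu ha
    have h2 := hv.static ht hge hu ha
    have hint : ∀ x : ℝ → State ℓ r m, ContinuousOn x (Ici 0) → IntervalIntegrable
        (fun τ => pairCLM a (WithLp.toLp 2 (D.adjZ g e)) (x τ) + D.source g e) volume 0 t :=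
      fun x hx => (((ContinuousLinearMap.continuous _).comp_continuousOn
        (hx.mono Icc_subset_Ici_self)).add continuousOn_const).intervalIntegrable_of_Icc ht
    rw [pairing_eq_pairCLM _ _ _ hu, pairing_eq_pairCLM _ _ _ ha,
      ← ContinuousLinearMap.intervalIntegral_comp_comm _ (hdc.intervalIntegrable 0 t), hd t ht]
    have h3 : pairCLM u (WithLp.toLp 2 e) (w t - v t) =
        pairCLM u (WithLp.toLp 2 e) (w t - v₀) - pairCLM u (WithLp.toLp 2 e) (v t - v₀) := by
      rw [← map_sub]; congr 1; abel
    rw [h3, h1, h2, ← intervalIntegral.integral_sub (hint w hw.2.1) (hint v hv.2.1)]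
    refine intervalIntegral.integral_congr fun τ hτ => ?_
    rw [uIcc_of_le ht] at hτ
    dsimp only
    rw [hd τ hτ.1, map_sub]
    ring
  have hzero : ∀ t, 0 ≤ t → ∫ τ in (0 : ℝ)..t, d τ = 0 := by
    intro t ht
    have := hV.decay_lin hL heq (fun t _ => (hW t).hasDerivWithinAt) hdc.continuousOn hlin ht
    simp only [intervalIntegral.integral_same] at this
    refine eq_of_stateNorm_sub_le_zero (w := 0) ?_
    rw [sub_zero]
    refine this.trans (le_of_eq ?_)
    simp [stateNorm]
  intro t ht
  have h1 : HasDerivWithinAt (fun t => ∫ τ in (0 : ℝ)..t, d τ) 0 (Ici 0) t :=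
    (hasDerivWithinAt_const t (Ici 0) (0 : State ℓ r m)).congr (fun s hs => hzero s hs) (hzero t ht)
  have h2 := (uniqueDiffOn_Ici (0 : ℝ) t ht).eq_deriv _ h1 (hW t).hasDerivWithinAt
  rw [hd t ht] at h2
  exact (sub_eq_zero.1 h2.symm)

end ClosedLoop

/-! ### Elementary quadratic bounds. -/

section Bounds

theorem exists_mulVec_bound {ι κ : Type*} [Fintype ι] [Fintype κ] (M : Matrix ι κ ℝ) :
    ∃ C : ℝ, 0 ≤ C ∧ ∀ x : κ → ℝ, (M *ᵥ x) ⬝ᵥ (M *ᵥ x) ≤ C * (x ⬝ᵥ x) := by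
  refine ⟨∑ i, ∑ j, M i j ^ 2, by positivity, fun x => ?_⟩
  rw [Finset.sum_mul]
  refine Finset.sum_le_sum fun i _ => ?_
  have := Finset.sum_mul_sq_le_sq_mul_sq Finset.univ (M i) x
  simpa [Matrix.mulVec, dotProduct, pow_two] using this

theorem dotProduct_self_nonneg' {ι : Type*} [Fintype ι] (x : ι → ℝ) : 0 ≤ x ⬝ᵥ x :=
  Finset.sum_nonneg fun i _ => mul_self_nonneg (x i)

theorem two_mul_dotProduct_le {ι : Type*} [Fintype ι] (x y : ι → ℝ) :
    2 * (x ⬝ᵥ y) ≤ x ⬝ᵥ x + y ⬝ᵥ y := by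
  have := dotProduct_self_nonneg' (x - y)
  rw [sub_dotProduct, dotProduct_sub, dotProduct_sub, dotProduct_comm y x] at this
  linarith

theorem exists_quadratic_bound {ι : Type*} [Fintype ι] [DecidableEq ι] (M : ℝ → Matrix ι ι ℝ)
    (hM : ∀ i j, ContinuousOn (fun s => M s i j) (Icc 0 1)) :
    ∃ C : ℝ, 0 ≤ C ∧ ∀ s ∈ Icc (0 : ℝ) 1, ∀ x : ι → ℝ, x ⬝ᵥ (M s *ᵥ x) ≤ C * (x ⬝ᵥ x) := by
  have h : ContinuousOn (fun s => ∑ i, ∑ j, M s i j ^ 2) (Icc 0 1) :=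
    continuousOn_finsetSum _ fun i _ => continuousOn_finsetSum _ fun j _ => (hM i j).pow 2
  obtain ⟨C, hC⟩ := isCompact_Icc.exists_bound_of_continuousOn h
  have hC0 : 0 ≤ C := (norm_nonneg _).trans (hC 0 (by simp))
  refine ⟨(1 + C) / 2, by positivity, fun s hs x => ?_⟩
  have h1 := two_mul_dotProduct_le x (M s *ᵥ x)
  have h2 : (M s *ᵥ x) ⬝ᵥ (M s *ᵥ x) ≤ C * (x ⬝ᵥ x) := by
    refine le_trans ?_ (mul_le_mul_of_nonneg_right ((le_abs_self _).trans (hC s hs))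
      (dotProduct_self_nonneg' x))
    rw [Finset.sum_mul]
    refine Finset.sum_le_sum fun i _ => ?_
    have := Finset.sum_mul_sq_le_sq_mul_sq Finset.univ (M s i) x
    simpa [Matrix.mulVec, dotProduct, pow_two] using this
  linarith

end Bounds

/-! ### Quasi-dissipativity of the formal adjoint. -/

namespace ClosedLoop

variable {ℓ r m : ℕ} (D : ClosedLoop ℓ r m)

/-- The weight `ρ`, of the sign of `Λ₀`, of modulus `ε` at the outflow of the adjoint system's
data and `1` at the other end. -/
def rho (ε : ℝ) : Idx ℓ r → ℝ → ℝ :=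
  Sum.elim (fun _ s => 1 - (1 - ε) * s) (fun _ s => -(ε + (1 - ε) * s))

theorem hasDerivAt_rho (ε : ℝ) (i : Idx ℓ r) (s : ℝ) : HasDerivAt (rho ε i) (-(1 - ε)) s := by
  rcases i with i | i
  · simpa [rho] using ((hasDerivAt_id s).const_mul (1 - ε)).const_sub 1
  · simpa [rho] using (((hasDerivAt_id s).const_mul (1 - ε)).const_add ε).fun_neg

theorem weight_pos {ε : ℝ} (hε : 0 < ε) (hε1 : ε ≤ 1) (i : Idx ℓ r) {s : ℝ}
    (hs : s ∈ Icc (0 : ℝ) 1) : 0 < D.lam i s * rho ε i s := by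
  have h1 : (1 - ε) * s ≤ 1 - ε := mul_le_of_le_one_right (by linarith) hs.2
  have h2 : 0 ≤ (1 - ε) * s := mul_nonneg (by linarith) hs.1
  rcases i with i | i
  · exact mul_pos (D.lam_pos i s hs) (by simp only [rho, Sum.elim_inl]; linarith)
  · exact mul_pos_of_neg_of_neg (D.lam_neg i s hs) (by simp only [rho, Sum.elim_inr]; linarith)

theorem continuousOn_weight (ε : ℝ) (i : Idx ℓ r) :
    ContinuousOn (fun s => D.lam i s * rho ε i s) (Icc 0 1) :=
  (D.lam_C1 i).continuousOn.mul
    (continuous_iff_continuousAt.2 fun s => (hasDerivAt_rho ε i s).continuousAt).continuousOn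

theorem adjZ_dotProduct (g : ℝ → Idx ℓ r → ℝ) (e : Fin m → ℝ) :
    D.adjZ g e ⬝ᵥ e = ((D.ki • (D.Kiᵀ * D.Bᵀ * D.L₁ᵀ)) *ᵥ e) ⬝ᵥ e -
      D.testIn g ⬝ᵥ ((D.ki • (D.B * D.Ki)) *ᵥ e) := by
  have h1 : D.testIn g ⬝ᵥ ((D.B * D.Ki) *ᵥ e) = (D.Kiᵀ *ᵥ (D.Bᵀ *ᵥ D.testIn g)) ⬝ᵥ e := by
    rw [Matrix.dotProduct_mulVec, Matrix.mulVec_mulVec, ← Matrix.transpose_mul,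
      Matrix.mulVec_transpose]
  rw [adjZ, Matrix.mulVec_sub, Matrix.mulVec_sub, Matrix.smul_mulVec, Matrix.smul_mulVec,
    dotProduct_smul, h1, neg_dotProduct, smul_dotProduct, sub_dotProduct, smul_dotProduct,
    Matrix.mulVec_mulVec e, Matrix.mulVec_mulVec e, smul_eq_mul, smul_eq_mul, smul_eq_mul,
    Matrix.mul_assoc]
  ring

/-- The adjoint boundary condition expresses `testOut` through `testIn` and `e`. A small enough `ε`
lets the negative term in `testIn` absorb both its contribution to `testOut` and the cross term of
`adjZ`, leaving a multiple of `|e|²`. -/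
theorem exists_boundary_bound : ∃ ε β : ℝ, 0 < ε ∧ ε ≤ 1 ∧ 0 ≤ β ∧ ∀ g e, D.IsStaticTest g e →
    1 / 2 * (ε * (D.testOut g ⬝ᵥ D.testOut g) - D.testIn g ⬝ᵥ D.testIn g) +
      D.adjZ g e ⬝ᵥ e ≤ β * (e ⬝ᵥ e) := by
  obtain ⟨C₁, hC₁, h1⟩ := exists_mulVec_bound D.Kᵀ
  obtain ⟨C₂, hC₂, h2⟩ := exists_mulVec_bound (D.L₁ * D.K + D.L₂)ᵀ
  obtain ⟨C₃, hC₃, h3⟩ := exists_mulVec_bound (D.ki • (D.B * D.Ki))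
  obtain ⟨C₄, hC₄, h4⟩ := exists_mulVec_bound (D.ki • (D.Kiᵀ * D.Bᵀ * D.L₁ᵀ))
  have hd : 0 < 4 * (C₁ + C₂) + 1 := by positivity
  -- This `ε` makes `ε C₁` and `ε C₂` at most `1/4`. The outflow term then costs a quarter of
  -- `|testIn|²`, the cross term another quarter, and one half is available.
  refine ⟨(4 * (C₁ + C₂) + 1)⁻¹, 1 + C₃ + C₄, by positivity, inv_le_one_of_one_le₀ (by linarith),
    by positivity, fun g e hge => ?_⟩
  set ε := (4 * (C₁ + C₂) + 1)⁻¹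
  have hε : 0 < ε := by positivity
  have hε1 : ε * (4 * (C₁ + C₂) + 1) = 1 := inv_mul_cancel₀ hd.ne'
  have hεC1 : ε * C₁ ≤ 1 / 4 := by nlinarith [mul_nonneg hε.le hC₂]
  have hεC2 : ε * C₂ ≤ 1 / 4 := by nlinarith [mul_nonneg hε.le hC₁]
  rw [hge.testOut_eq, adjZ_dotProduct]
  generalize D.testIn g = a at *
  have k1 := h1 a
  have k2 := h2 e
  have k3 := h3 e
  have k4 := h4 e
  set x := (D.L₁ * D.K + D.L₂)ᵀ *ᵥ e
  set y := D.Kᵀ *ᵥ a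
  set p := (D.ki • (D.B * D.Ki)) *ᵥ e
  set q := (D.ki • (D.Kiᵀ * D.Bᵀ * D.L₁ᵀ)) *ᵥ e
  have ha := dotProduct_self_nonneg' a
  have he := dotProduct_self_nonneg' e
  have j1 : (x - y) ⬝ᵥ (x - y) ≤ 2 * (x ⬝ᵥ x + y ⬝ᵥ y) := by
    have := two_mul_dotProduct_le x (-y)
    rw [dotProduct_neg, neg_dotProduct_neg] at this
    rw [sub_dotProduct, dotProduct_sub, dotProduct_sub, dotProduct_comm y x]
    linarith
  have j2 : -(a ⬝ᵥ p) ≤ 1 / 4 * (a ⬝ᵥ a) + p ⬝ᵥ p := by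
    have := two_mul_dotProduct_le ((1 / 2 : ℝ) • a) (-p)
    rw [dotProduct_neg, neg_dotProduct_neg, smul_dotProduct, smul_dotProduct, dotProduct_smul,
      smul_eq_mul, smul_eq_mul, smul_eq_mul] at this
    linarith
  have j3 := two_mul_dotProduct_le q e
  have j4 : ε * ((x - y) ⬝ᵥ (x - y)) ≤ 1 / 2 * (e ⬝ᵥ e) + 1 / 2 * (a ⬝ᵥ a) := by
    have i1 : ε * (C₁ * (a ⬝ᵥ a)) ≤ 1 / 4 * (a ⬝ᵥ a) := by
      rw [← mul_assoc]; exact mul_le_mul_of_nonneg_right hεC1 ha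
    have i2 : ε * (C₂ * (e ⬝ᵥ e)) ≤ 1 / 4 * (e ⬝ᵥ e) := by
      rw [← mul_assoc]; exact mul_le_mul_of_nonneg_right hεC2 he
    have i3 : ε * ((x - y) ⬝ᵥ (x - y)) ≤ ε * (2 * (C₂ * (e ⬝ᵥ e) + C₁ * (a ⬝ᵥ a))) :=
      mul_le_mul_of_nonneg_left (by linarith) hε.le
    linarith
  have j5 : 0 ≤ C₄ * (e ⬝ᵥ e) := mul_nonneg hC₄ he
  linarith

/-- Quasi-dissipativity of the formal adjoint in a weighted norm. -/
theorem exists_dissipative_weight : ∃ p : Idx ℓ r → ℝ → ℝ, ∃ β : ℝ, 0 ≤ β ∧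
    (∀ i, ContinuousOn (p i) (Icc 0 1)) ∧ (∀ i, ∀ s ∈ Icc (0 : ℝ) 1, 0 < p i s) ∧
    ∀ g e, D.IsStaticTest g e →
      Integrable (fun s => ∑ i, p i s * g s i ^ 2) μ01 →
      Integrable (fun s => ∑ i, p i s * (D.adjProfile g s i * g s i)) μ01 →
      (∫ s, ∑ i, p i s * (D.adjProfile g s i * g s i) ∂μ01) + D.adjZ g e ⬝ᵥ e ≤
        β * ((∫ s, ∑ i, p i s * g s i ^ 2 ∂μ01) + e ⬝ᵥ e) := by
  obtain ⟨ε, β₁, hε, hε1, hβ₁, hbd⟩ := D.exists_boundary_bound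
  obtain ⟨lamX, hl⟩ := D.exists_lam_extension
  let p : Idx ℓ r → ℝ → ℝ := fun i s => D.lam i s * rho ε i s
  have hpc : ∀ i, ContinuousOn (p i) (Icc 0 1) := fun i => D.continuousOn_weight ε i
  have hpp : ∀ i, ∀ s ∈ Icc (0 : ℝ) 1, 0 < p i s := fun i s hs => D.weight_pos hε hε1 i hs
  -- The zeroth-order remainder: with the weight `λ ρ`, the weighted product of `g` with its adjoint
  -- profile is the derivative of `∑ ρ (λ g)² / 2` plus the quadratic form of `M`.
  let M : ℝ → Matrix (Idx ℓ r) (Idx ℓ r) ℝ := fun s =>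
    Matrix.diagonal (fun i => 1 / 2 * (1 - ε) * D.lam i s ^ 2) -
      Matrix.diagonal (fun i => p i s) * (D.Λ₁ s)ᵀ
  obtain ⟨C, hC, hM⟩ := exists_quadratic_bound M fun i j => by
    simp only [M, Matrix.sub_apply, Matrix.diagonal_mul, Matrix.transpose_apply]
    refine ContinuousOn.sub ?_ ((hpc i).mul (D.Λ₁_C1 j i).continuousOn)
    rcases eq_or_ne i j with rfl | hij
    · simp only [Matrix.diagonal_apply_eq]
      exact continuousOn_const.mul ((D.lam_C1 i).continuousOn.fun_pow 2)
    · simpa [Matrix.diagonal_apply_ne _ hij] using continuousOn_const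
  have hinv : ContinuousOn (fun s i => (p i s)⁻¹) (Icc 0 1) :=
    continuousOn_pi.2 fun i => (hpc i).inv₀ fun s hs => (hpp i s hs).ne'
  obtain ⟨B, hB⟩ := isCompact_Icc.exists_bound_of_continuousOn hinv
  have hB0 : 0 ≤ B := (norm_nonneg _).trans (hB 0 (by simp))
  have hquad : ∀ s ∈ Icc (0 : ℝ) 1, ∀ x : Idx ℓ r → ℝ,
      x ⬝ᵥ (M s *ᵥ x) ≤ C * B * ∑ i, p i s * x i ^ 2 := by
    intro s hs x
    refine (hM s hs x).trans ?_
    rw [mul_assoc]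
    refine mul_le_mul_of_nonneg_left ?_ hC
    rw [Finset.mul_sum]
    refine Finset.sum_le_sum fun i _ => ?_
    have h1 : (p i s)⁻¹ ≤ B :=
      (le_abs_self _).trans ((norm_le_pi_norm (fun i => (p i s)⁻¹) i).trans (hB s hs))
    have h2 : 1 ≤ B * p i s := by
      have := mul_le_mul_of_nonneg_right h1 (hpp i s hs).le
      rwa [inv_mul_cancel₀ (hpp i s hs).ne'] at this
    nlinarith [sq_nonneg (x i)]
  refine ⟨p, β₁ + C * B, by positivity, hpc, hpp, fun g e hge hi1 hi2 => ?_⟩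
  have hG : ∀ i, ContDiff ℝ 1 fun s => lamX i s * g s i := fun i =>
    (hl i).1.mul (contDiff_pi.1 hge.1 i)
  let E : ℝ → ℝ := fun s => ∑ i, rho ε i s * (lamX i s * g s i) ^ 2 / 2
  let E' : ℝ → ℝ := fun s => ∑ i, (-(1 - ε) / 2 * (lamX i s * g s i) ^ 2 +
    rho ε i s * ((lamX i s * g s i) * deriv (fun s => lamX i s * g s i) s))
  have hE : ∀ s, HasDerivAt E (E' s) s := by
    intro s
    refine HasDerivAt.fun_sum fun i _ => ?_
    have h1 := ((hG i).differentiable one_ne_zero s).hasDerivAt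
    refine (((hasDerivAt_rho ε i s).mul (h1.fun_pow 2)).div_const 2).congr_deriv ?_
    ring
  have hE'c : Continuous E' := by
    refine continuous_finsetSum _ fun i _ => ?_
    have h1 := (hG i).continuous
    have h2 := (hG i).continuous_deriv le_rfl
    have h3 : Continuous (rho ε i) :=
      continuous_iff_continuousAt.2 fun s => (hasDerivAt_rho ε i s).continuousAt
    fun_prop
  have hE'i : Integrable E' μ01 :=
    (hE'c.integrableOn_Icc (a := 0) (b := 1)).mono_set Ioo_subset_Icc_self
  have hFTC : ∫ s, E' s ∂μ01 = E 1 - E 0 := by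
    rw [integral_μ01]
    exact intervalIntegral.integral_eq_sub_of_hasDerivAt (fun s _ => hE s)
      (hE'c.intervalIntegrable _ _)
  have hpt : ∀ s ∈ Ioo (0 : ℝ) 1, ∑ i, p i s * (D.adjProfile g s i * g s i) ≤
      E' s + C * B * ∑ i, p i s * g s i ^ 2 := by
    intro s hs
    have hs' := Ioo_subset_Icc_self hs
    refine le_trans (le_of_eq ?_) (add_le_add_right (hquad s hs' (g s)) (E' s))
    have h1 : g s ⬝ᵥ (M s *ᵥ g s) = ∑ i, (g s i * (1 / 2 * (1 - ε) * D.lam i s ^ 2 * g s i) -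
        g s i * (p i s * ((D.Λ₁ s)ᵀ *ᵥ g s) i)) := by
      simp only [M, Matrix.sub_mulVec, ← Matrix.mulVec_mulVec, dotProduct, Pi.sub_apply,
        Matrix.mulVec_diagonal, mul_sub]
    rw [h1, ← Finset.sum_add_distrib]
    refine Finset.sum_congr rfl fun i _ => ?_
    rw [D.adjProfile_eq hl g hs i, (hl i).2 hs']
    simp only [p]
    ring
  have hmono := integral_mono_ae hi2 (hE'i.add (hi1.const_mul (C * B)))
    (ae_μ01_of_forall hpt)
  simp only [Pi.add_apply] at hmono
  rw [integral_add hE'i (hi1.const_mul (C * B)), integral_const_mul, hFTC] at hmono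
  -- The end values of `ρ` are `±1` at the inflow traces and `±ε` at the outflow traces, with signs
  -- that produce this difference.
  have hbdry : E 1 - E 0 =
      1 / 2 * (ε * (D.testOut g ⬝ᵥ D.testOut g) - D.testIn g ⬝ᵥ D.testIn g) := by
    simp only [E, Fintype.sum_sum_type, dotProduct, testOut, testIn, rho, Sum.elim_inl,
      Sum.elim_inr, (hl _).2 (show (0 : ℝ) ∈ Icc (0 : ℝ) 1 by simp),
      (hl _).2 (show (1 : ℝ) ∈ Icc (0 : ℝ) 1 by simp), mul_zero, mul_one, sub_zero, add_zero,
      sub_sub_cancel, add_sub_cancel, one_mul, neg_mul, mul_neg, neg_neg,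
      Finset.sum_neg_distrib, ← Finset.sum_div, ← Finset.mul_sum, pow_two]
    ring
  have hb := hbd g e hge
  rw [← hbdry] at hb
  have h0 : 0 ≤ ∫ s, ∑ i, p i s * g s i ^ 2 ∂μ01 := by
    refine integral_nonneg_of_ae (ae_μ01_of_forall fun s hs => ?_)
    exact Finset.sum_nonneg fun i _ =>
      mul_nonneg (hpp i s (Ioo_subset_Icc_self hs)).le (sq_nonneg _)
  have he := dotProduct_self_nonneg' e
  have i1 : 0 ≤ C * B * (e ⬝ᵥ e) := by positivity
  have i2 : 0 ≤ β₁ * ∫ s, ∑ i, p i s * g s i ^ 2 ∂μ01 := by positivity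
  linarith

end ClosedLoop

/-! ### The adjoint graph and the flow of the homogeneous system. -/

namespace ClosedLoop

variable {ℓ r m : ℕ} {D : ClosedLoop ℓ r m}

theorem testIn_add (g g' : ℝ → Idx ℓ r → ℝ) :
    D.testIn (g + g') = D.testIn g + D.testIn g' := by
  ext (i | i) <;> simp [testIn] <;> ring

theorem IsStaticTest.add {g g' : ℝ → Idx ℓ r → ℝ} {e e' : Fin m → ℝ} (h : D.IsStaticTest g e)
    (h' : D.IsStaticTest g' e') : D.IsStaticTest (g + g') (e + e') := by
  refine ⟨h.1.add h'.1, ?_⟩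
  have h1 : D.testOut (g + g') = D.testOut g + D.testOut g' := by
    ext (i | i) <;> simp [testOut] <;> ring
  rw [h1, testIn_add, Matrix.mulVec_add, Matrix.mulVec_add, ← h.2, ← h'.2]
  abel

theorem testIn_smul (c : ℝ) (g : ℝ → Idx ℓ r → ℝ) : D.testIn (c • g) = c • D.testIn g := by
  ext (i | i) <;> simp [testIn] <;> ring

theorem IsStaticTest.smul {g : ℝ → Idx ℓ r → ℝ} {e : Fin m → ℝ} (c : ℝ)
    (h : D.IsStaticTest g e) : D.IsStaticTest (c • g) (c • e) := by
  refine ⟨h.1.const_smul c, ?_⟩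
  have h1 : D.testOut (c • g) = c • D.testOut g := by
    ext (i | i) <;> simp [testOut] <;> ring
  rw [h1, testIn_smul, Matrix.mulVec_smul, Matrix.mulVec_smul, ← h.2, smul_add]

theorem adjZ_add (g g' : ℝ → Idx ℓ r → ℝ) (e e' : Fin m → ℝ) :
    D.adjZ (g + g') (e + e') = D.adjZ g e + D.adjZ g' e' := by
  have : D.testIn (g + g') - D.L₁ᵀ *ᵥ (e + e') =
      (D.testIn g - D.L₁ᵀ *ᵥ e) + (D.testIn g' - D.L₁ᵀ *ᵥ e') := by
    rw [testIn_add, Matrix.mulVec_add]; abel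
  rw [adjZ, this, Matrix.mulVec_add, Matrix.mulVec_add, smul_add, neg_add]
  rfl

theorem adjZ_smul (c : ℝ) (g : ℝ → Idx ℓ r → ℝ) (e : Fin m → ℝ) :
    D.adjZ (c • g) (c • e) = c • D.adjZ g e := by
  have : D.testIn (c • g) - D.L₁ᵀ *ᵥ (c • e) = c • (D.testIn g - D.L₁ᵀ *ᵥ e) := by
    rw [testIn_smul, Matrix.mulVec_smul, smul_sub]
  rw [adjZ, this, Matrix.mulVec_smul, Matrix.mulVec_smul, smul_comm, ← smul_neg]
  rfl

theorem adjProfile_add {g g' : ℝ → Idx ℓ r → ℝ} (hg : ContDiff ℝ 1 g) (hg' : ContDiff ℝ 1 g')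
    {s : ℝ} (hs : s ∈ Ioo (0 : ℝ) 1) :
    D.adjProfile (g + g') s = D.adjProfile g s + D.adjProfile g' s := by
  obtain ⟨lamX, hl⟩ := D.exists_lam_extension
  ext i
  have hG : ∀ {g : ℝ → Idx ℓ r → ℝ}, ContDiff ℝ 1 g →
      DifferentiableAt ℝ (fun s => lamX i s * g s i) s := fun hg =>
    ((hl i).1.mul (contDiff_pi.1 hg i)).differentiable one_ne_zero s
  rw [Pi.add_apply, D.adjProfile_eq hl _ hs, D.adjProfile_eq hl _ hs, D.adjProfile_eq hl _ hs,
    Pi.add_apply, Matrix.mulVec_add, Pi.add_apply,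
    show (fun σ => lamX i σ * (g + g') σ i) =
      (fun σ => lamX i σ * g σ i) + fun σ => lamX i σ * g' σ i from
        funext fun σ => mul_add _ _ _, deriv_add (hG hg) (hG hg')]
  ring

theorem adjProfile_smul {g : ℝ → Idx ℓ r → ℝ} (hg : ContDiff ℝ 1 g) (c : ℝ)
    {s : ℝ} (hs : s ∈ Ioo (0 : ℝ) 1) :
    D.adjProfile (c • g) s = c • D.adjProfile g s := by
  obtain ⟨lamX, hl⟩ := D.exists_lam_extension
  ext i
  have hG : DifferentiableAt ℝ (fun s => lamX i s * g s i) s :=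
    ((hl i).1.mul (contDiff_pi.1 hg i)).differentiable one_ne_zero s
  rw [Pi.smul_apply, D.adjProfile_eq hl _ hs, D.adjProfile_eq hl _ hs, Pi.smul_apply,
    Matrix.mulVec_smul, Pi.smul_apply,
    show (fun σ => lamX i σ * (c • g) σ i) = fun σ => c * (lamX i σ * g σ i) from
        funext fun σ => by simp only [Pi.smul_apply, smul_eq_mul]; ring, deriv_const_mul _ hG]
  simp only [smul_eq_mul]
  ring

variable (D) in
/-- The graph of the formal adjoint on static tests. -/
def adjointGraph : Submodule ℝ (State ℓ r m × State ℓ r m) where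
  carrier := {τ | ∃ g e, D.IsStaticTest g e ∧ (∀ᵐ s ∂μ01, (τ.1.1 s).ofLp = g s) ∧
    τ.1.2.ofLp = e ∧ (∀ᵐ s ∂μ01, (τ.2.1 s).ofLp = D.adjProfile g s) ∧
    τ.2.2.ofLp = D.adjZ g e}
  add_mem' := by
    rintro τ τ' ⟨g, e, h, h1, h2, h3, h4⟩ ⟨g', e', h', h1', h2', h3', h4'⟩
    refine ⟨g + g', e + e', h.add h', ?_, ?_, ?_, ?_⟩
    · filter_upwards [h1, h1', Lp.coeFn_add τ.1.1 τ'.1.1] with s k k' k2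
      rw [Prod.fst_add, Prod.fst_add, k2, Pi.add_apply, WithLp.ofLp_add, k, k', Pi.add_apply]
    · rw [← h2, ← h2']; rfl
    · filter_upwards [h3, h3', Lp.coeFn_add τ.2.1 τ'.2.1, ae_μ01_of_forall fun s hs => hs]
        with s k k' k2 hs
      rw [Prod.snd_add, Prod.fst_add, k2, Pi.add_apply, WithLp.ofLp_add, k, k',
        adjProfile_add h.1 h'.1 hs]
    · rw [adjZ_add, ← h4, ← h4']; rfl
  zero_mem' := by
    have h0 : D.IsStaticTest (0 : ℝ → Idx ℓ r → ℝ) 0 := by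
      obtain ⟨g, h, -⟩ := D.exists_staticTest 0 0
      simpa using h.smul 0
    refine ⟨0, 0, h0, ?_, rfl, ?_, ?_⟩
    · filter_upwards [Lp.coeFn_zero (EuclideanSpace ℝ (Idx ℓ r)) 2 μ01] with s hs
      rw [Prod.fst_zero, Prod.fst_zero, hs]; rfl
    · filter_upwards [Lp.coeFn_zero (EuclideanSpace ℝ (Idx ℓ r)) 2 μ01,
        ae_μ01_of_forall fun s hs => hs] with s hs hs'
      rw [Prod.snd_zero, Prod.fst_zero, hs]
      simpa using (adjProfile_smul (D := D) h0.1 0 hs').symm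
    · simpa using (adjZ_smul (D := D) 0 0 0).symm
  smul_mem' := by
    rintro c τ ⟨g, e, h, h1, h2, h3, h4⟩
    refine ⟨c • g, c • e, h.smul c, ?_, ?_, ?_, ?_⟩
    · filter_upwards [h1, Lp.coeFn_smul c τ.1.1] with s k k2
      rw [Prod.smul_fst, Prod.smul_fst, k2, Pi.smul_apply, WithLp.ofLp_smul, k, Pi.smul_apply]
    · rw [← h2]; rfl
    · filter_upwards [h3, Lp.coeFn_smul c τ.2.1, ae_μ01_of_forall fun s hs => hs] with s k k2 hs
      rw [Prod.smul_snd, Prod.smul_fst, k2, Pi.smul_apply, WithLp.ofLp_smul, k,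
        adjProfile_smul h.1 c hs]
    · rw [adjZ_smul, ← h4]; rfl

theorem linRHS_iff (x y : State ℓ r m) : D.LinRHS x y ↔ ∀ τ ∈ D.adjointGraph,
    inner ℝ x.1 τ.2.1 + inner ℝ x.2 τ.2.2 = inner ℝ y.1 τ.1.1 + inner ℝ y.2 τ.1.2 := by
  constructor
  · rintro h τ ⟨g, e, hge, h1, h2, h3, h4⟩
    have := h g e hge
    rw [pairing_eq_inner _ _ _ h1, pairing_eq_inner _ _ _ h3, ← h4, ← h2] at this
    exact this
  · intro h g e hge
    obtain ⟨u, hu⟩ := exists_cls g hge.1.continuous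
    obtain ⟨a, ha⟩ := D.exists_adjProfile_cls g hge.1
    have := h ((u, WithLp.toLp 2 e), (a, WithLp.toLp 2 (D.adjZ g e)))
      ⟨g, e, hge, hu, rfl, ha, rfl⟩
    rw [pairing_eq_inner _ _ _ hu, pairing_eq_inner _ _ _ ha]
    exact this

/-- States with smooth profile satisfying the homogeneous boundary condition lie in the domain. -/
theorem exists_linRHS {φ : L2 ℓ r} {f : ℝ → Idx ℓ r → ℝ} (hf : ContDiff ℝ 1 f)
    (hφ : ∀ᵐ s ∂μ01, (φ s).ofLp = f s) (z : EuclideanSpace ℝ (Fin m))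
    (hbc : inflow (fun s => WithLp.toLp 2 (f s)) = D.K *ᵥ outflow (fun s => WithLp.toLp 2 (f s)) +
      D.B *ᵥ (D.ki • (D.Ki *ᵥ z.ofLp))) : ∃ y, D.LinRHS (φ, z) y := by
  -- Without exogenous signals the source vanishes, so the weak right-hand side of `D₀` is the
  -- homogeneous one of `D`.
  let D₀ : ClosedLoop ℓ r m := { D with wb := 0, wy := 0, yref := 0 }
  obtain ⟨δ, hδ⟩ := exists_cls (deriv f) (hf.continuous_deriv le_rfl)
  obtain ⟨T₁, hT₁⟩ := exists_mulOp (ℓ := ℓ) (r := r) D.Λ₁ fun i j => (D.Λ₁_C1 i j).continuousOn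
  obtain ⟨T₀, hT₀⟩ := exists_mulOp (ℓ := ℓ) (r := r) D.Λ₀ fun i j => by
      rcases eq_or_ne i j with rfl | hij
      · simpa [Λ₀] using (D.lam_C1 i).continuousOn
      · simpa [Λ₀, Matrix.diagonal_apply_ne _ hij] using continuousOn_const
  have hprim : ∀ s ∈ Icc (0 : ℝ) 1, WithLp.toLp 2 (f s) = primitive (WithLp.toLp 2 (f 0)) δ s := by
    intro s hs
    ext i
    rw [primitive_apply _ _ hs]
    have hd : ∀ σ, HasDerivAt (fun s => f s i) (deriv f σ i) σ := fun σ =>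
      hasDerivAt_pi.1 (hf.differentiable one_ne_zero σ).hasDerivAt i
    have h1 : ∫ σ in (0 : ℝ)..s, δ σ i = ∫ σ in (0 : ℝ)..s, deriv f σ i := by
      refine intervalIntegral.integral_congr_ae ?_
      have h2 := (ae_restrict_iff' measurableSet_Ioo).1 hδ
      have h3 : ∀ᵐ σ : ℝ, σ ≠ 1 := by simp [ae_iff]
      filter_upwards [h2, h3] with σ h4 h5 h6
      rw [uIoc_of_le hs.1] at h6
      rw [h4 ⟨h6.1, lt_of_le_of_ne (h6.2.trans hs.2) h5⟩]
    have h2 : ∫ σ in (0 : ℝ)..s, deriv f σ i = f s i - f 0 i :=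
      intervalIntegral.integral_eq_sub_of_hasDerivAt (fun σ _ => hd σ)
        (((continuous_apply i).comp (hf.continuous_deriv le_rfl)).intervalIntegrable _ _)
    rw [h1, h2]
    simp
  have hφ' : ∀ᵐ s ∂μ01, φ s = WithLp.toLp 2 (f s) := by
    filter_upwards [hφ] with s hs
    rw [← hs]
  have hrep : IsContRep (fun s => WithLp.toLp 2 (f s)) φ :=
    ⟨((PiLp.continuous_toLp 2 _).comp hf.continuous).continuousOn, hφ'⟩
  refine ⟨(-T₀ δ - T₁ φ, D₀.output (fun s => WithLp.toLp 2 (f s)) - WithLp.toLp 2 D₀.yref), ?_⟩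
  have hR : D₀.IsRHS (φ, z) δ
      (-T₀ δ - T₁ φ, D₀.output (fun s => WithLp.toLp 2 (f s)) - WithLp.toLp 2 D₀.yref) := by
    refine ⟨?_, ?_, _, hrep, ?_, rfl⟩
    · refine hasWeakDeriv_of_primitive (c := WithLp.toLp 2 (f 0)) ?_
      filter_upwards [hφ', ae_μ01_of_forall fun s hs => hs] with s h1 hs
      rw [h1, hprim s (Ioo_subset_Icc_self hs)]
    · filter_upwards [hT₀ δ, hT₁ φ, Lp.coeFn_sub (-T₀ δ) (T₁ φ), Lp.coeFn_neg (T₀ δ)]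
        with s h1 h2 h3 h4
      rw [h3, Pi.sub_apply, h4, Pi.neg_apply, WithLp.ofLp_sub, WithLp.ofLp_neg, h1, h2]
      rfl
    · rw [BC, actuation, add_zero]
      exact hbc
  intro g e hge
  have h1 := (D₀.weakRHS_iff _ _).1 (IsRHS.weakRHS D₀ hR) g e hge
  have h2 : D₀.source g e = 0 := by simp [source, D₀]
  rw [h2, add_zero] at h1
  exact h1

/-- The orthogonality form of density of the domain. Profiles vanishing at both ends, with `z = 0`,
annihilate `q.1`; a state with `z = q.2` and a profile adapted to its actuation then annihilates
`q.2`. -/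
theorem eq_zero_of_forall_linRHS (q : State ℓ r m)
    (hq : ∀ x y, D.LinRHS x y → inner ℝ q.1 x.1 + inner ℝ q.2 x.2 = 0) : q = 0 := by
  have hq1 : q.1 = 0 := by
    have hloc : LocallyIntegrableOn q.1 (Ioo 0 1) volume :=
      IntegrableOn.locallyIntegrableOn (L2.integrable q.1)
    have h := isOpen_Ioo.ae_eq_zero_of_integral_contDiff_smul_eq_zero hloc (by
      intro χ hχ hχc hχt
      have hχ1 : ContDiff ℝ 1 χ := hχ.of_le (by exact_mod_cast le_top)
      have hout : ∀ s ∉ Ioo (0 : ℝ) 1, χ s = 0 := fun s hs =>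
        image_eq_zero_of_notMem_tsupport fun h => hs (hχt h)
      have h3 : ∫ s, χ s • q.1 s = ∫ s, χ s • q.1 s ∂μ01 := by
        rw [setIntegral_eq_integral_of_forall_compl_eq_zero]
        intro s hs
        rw [hout s hs, zero_smul]
      rw [h3]
      ext i
      rw [integral_apply (integrable_smul_of_continuous (L2.integrable q.1) hχ1.continuous)]
      let f : ℝ → Idx ℓ r → ℝ := fun s => Pi.single i (χ s)
      have hf : ContDiff ℝ 1 f := by
        refine contDiff_pi.2 fun j => ?_
        rcases eq_or_ne j i with rfl | hij
        · simpa [f] using hχ1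
        · simpa [f, Pi.single_eq_of_ne hij] using contDiff_const
      have hf0 : f 0 = 0 := by simp [f, hout 0 (by simp)]
      have hf1 : f 1 = 0 := by simp [f, hout 1 (by simp)]
      obtain ⟨φ, hφ⟩ := exists_cls f hf.continuous
      obtain ⟨y, hy⟩ := exists_linRHS (D := D) hf hφ 0 (by
        have h1 : inflow (fun s => WithLp.toLp 2 (f s)) = 0 := by
          ext (j | j) <;> simp [inflow, hf0, hf1]
        have h2 : outflow (fun s => WithLp.toLp 2 (f s)) = 0 := by
          ext (j | j) <;> simp [outflow, hf0, hf1]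
        rw [h1, h2]; simp)
      have h4 := hq _ _ hy
      simp only [inner_zero_right, add_zero] at h4
      rw [← integral_dotProduct_eq_inner q.1 φ hφ] at h4
      rw [PiLp.zero_apply, ← h4]
      refine integral_congr_ae (Eventually.of_forall fun s => ?_)
      simp [f, dotProduct_single, mul_comm])
    apply Lp.ext
    filter_upwards [(ae_restrict_iff' measurableSet_Ioo).2 h,
      Lp.coeFn_zero (EuclideanSpace ℝ (Idx ℓ r)) 2 μ01] with s h1 h2
    rw [h1, h2]; rfl
  refine Prod.ext hq1 ?_
  let b : Idx ℓ r → ℝ := D.B *ᵥ (D.ki • (D.Ki *ᵥ q.2.ofLp))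
  -- Inflow trace `b` and zero outflow trace, so the boundary condition holds whatever `K` is.
  let f : ℝ → Idx ℓ r → ℝ := fun s =>
    Sum.elim (fun i => (1 - s) * b (Sum.inl i)) (fun j => s * b (Sum.inr j))
  have hf : ContDiff ℝ 1 f := by
    refine contDiff_pi.2 ?_
    rintro (i | i) <;> simp only [f, Sum.elim_inl, Sum.elim_inr] <;> fun_prop
  obtain ⟨φ, hφ⟩ := exists_cls f hf.continuous
  obtain ⟨y, hy⟩ := exists_linRHS (D := D) hf hφ q.2 (by
    have h1 : inflow (fun s => WithLp.toLp 2 (f s)) = b := by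
      ext (j | j) <;> simp [inflow, f]
    have h2 : outflow (fun s => WithLp.toLp 2 (f s)) = 0 := by
      ext (j | j) <;> simp [outflow, f]
    rw [h1, h2]; simp [b])
  have h4 := hq _ _ hy
  rw [hq1, inner_zero_left, zero_add] at h4
  exact inner_self_eq_zero.1 h4

theorem inner_diagonal {φ u φ' u' : L2 ℓ r} {w w' : Idx ℓ r → ℝ → ℝ}
    (hφ : ∀ᵐ s ∂μ01, (φ' s).ofLp = Matrix.diagonal (fun i => w i s) *ᵥ (φ s).ofLp)
    (hu : ∀ᵐ s ∂μ01, (u' s).ofLp = Matrix.diagonal (fun i => w' i s) *ᵥ (u s).ofLp) :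
    ∀ᵐ s ∂μ01, inner ℝ (φ' s) (u' s) = ∑ i, w i s * w' i s * (φ s i * u s i) := by
  filter_upwards [hφ, hu] with s h1 h2
  rw [← dotProduct_eq_inner, h1, h2, dotProduct]
  refine Finset.sum_congr rfl fun i _ => ?_
  rw [Matrix.mulVec_diagonal, Matrix.mulVec_diagonal]
  ring

variable (D) in
/-- Coordinates in which the formal adjoint is quasi-dissipative. -/
theorem exists_dissipative_coordinates :
    ∃ (J : State ℓ r m ≃L[ℝ] WithLp 2 (L2 ℓ r × EuclideanSpace ℝ (Fin m)))
      (K : State ℓ r m →L[ℝ] WithLp 2 (L2 ℓ r × EuclideanSpace ℝ (Fin m))) (β : ℝ), 0 ≤ β ∧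
      Function.Surjective K ∧
      (∀ x y, inner ℝ (J x) (K y) = inner ℝ x.1 y.1 + inner ℝ x.2 y.2) ∧
      ∀ τ ∈ D.adjointGraph, inner ℝ (K τ.2) (K τ.1) ≤ β * ‖K τ.1‖ ^ 2 := by
  obtain ⟨p, β, hβ, hpc, hpp, hdiss⟩ := D.exists_dissipative_weight
  have hsc : ∀ i, ContinuousOn (fun s => √(p i s)) (Icc 0 1) := fun i => (hpc i).sqrt
  have hsp : ∀ i, ∀ s ∈ Icc (0 : ℝ) 1, √(p i s) ≠ 0 := fun i s hs =>
    (Real.sqrt_pos.2 (hpp i s hs)).ne'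
  obtain ⟨T, hT⟩ := exists_mulOp (ℓ := ℓ) (r := r) (fun s => Matrix.diagonal fun i => √(p i s))
    fun i j => by
      rcases eq_or_ne i j with rfl | hij
      · simpa using hsc i
      · simpa [Matrix.diagonal_apply_ne _ hij] using continuousOn_const
  obtain ⟨T', hT'⟩ := exists_mulOp (ℓ := ℓ) (r := r)
    (fun s => Matrix.diagonal fun i => (√(p i s))⁻¹) fun i j => by
      rcases eq_or_ne i j with rfl | hij
      · simp only [Matrix.diagonal_apply_eq]
        exact (hsc i).inv₀ (hsp i)
      · simpa [Matrix.diagonal_apply_ne _ hij] using continuousOn_const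
  have hTT' : Function.LeftInverse T T' := by
    intro φ
    apply Lp.ext
    filter_upwards [hT (T' φ), hT' φ, ae_μ01_of_forall fun s hs => hs] with s h1 h2 hs
    ext i
    rw [h1, h2, Matrix.mulVec_diagonal, Matrix.mulVec_diagonal,
      mul_inv_cancel_left₀ (hsp i s (Ioo_subset_Icc_self hs))]
  have hT'T : Function.RightInverse T T' := by
    intro φ
    apply Lp.ext
    filter_upwards [hT φ, hT' (T φ), ae_μ01_of_forall fun s hs => hs] with s h1 h2 hs
    ext i
    rw [h2, h1, Matrix.mulVec_diagonal, Matrix.mulVec_diagonal,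
      inv_mul_cancel_left₀ (hsp i s (Ioo_subset_Icc_self hs))]
  -- `K'` multiplies the profile by `√p` and `J` by its inverse. The norm of `K'` is thus the
  -- weighted one, while pairing `J` with `K'` returns the unweighted duality that defines `LinRHS`.
  let W := WithLp.prodContinuousLinearEquiv 2 ℝ (L2 ℓ r) (EuclideanSpace ℝ (Fin m))
  let eT : L2 ℓ r ≃L[ℝ] L2 ℓ r := ContinuousLinearEquiv.equivOfInverse T' T hTT' hT'T
  let J := (eT.prodCongr (ContinuousLinearEquiv.refl ℝ (EuclideanSpace ℝ (Fin m)))).trans W.symm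
  let K' := (eT.symm.prodCongr (ContinuousLinearEquiv.refl ℝ (EuclideanSpace ℝ (Fin m)))).trans
    W.symm
  have hJK : ∀ x y, inner ℝ (J x) (K' y) = inner ℝ x.1 y.1 + inner ℝ x.2 y.2 := by
    intro x y
    have h0 : inner ℝ (J x) (K' y) = inner ℝ (T' x.1) (T y.1) + inner ℝ x.2 y.2 := rfl
    rw [h0, MeasureTheory.L2.inner_def, MeasureTheory.L2.inner_def]
    congr 1
    refine integral_congr_ae ?_
    filter_upwards [inner_diagonal (hT' x.1) (hT y.1), ae_μ01_of_forall fun s hs => hs] with s h hs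
    rw [h, ← dotProduct_eq_inner, dotProduct]
    refine Finset.sum_congr rfl fun i _ => ?_
    rw [inv_mul_cancel₀ (hsp i s (Ioo_subset_Icc_self hs)), one_mul]
  have hKK : ∀ x y, inner ℝ (K' x) (K' y) = inner ℝ (T x.1) (T y.1) + inner ℝ x.2 y.2 :=
    fun x y => rfl
  have hTT : ∀ φ u : L2 ℓ r, ∀ᵐ s ∂μ01,
      inner ℝ (T φ s) (T u s) = ∑ i, p i s * (φ s i * u s i) := by
    intro φ u
    filter_upwards [inner_diagonal (hT φ) (hT u), ae_μ01_of_forall fun s hs => hs] with s h hs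
    rw [h]
    refine Finset.sum_congr rfl fun i _ => ?_
    rw [Real.mul_self_sqrt (hpp i s (Ioo_subset_Icc_self hs)).le]
  refine ⟨J, K', β, hβ, K'.surjective, hJK, ?_⟩
  rintro τ ⟨g, e, hge, h1, h2, h3, h4⟩
  have e1 : (fun s => inner ℝ (T τ.1.1 s) (T τ.1.1 s)) =ᵐ[μ01] fun s => ∑ i, p i s * g s i ^ 2 := by
    filter_upwards [hTT τ.1.1 τ.1.1, h1] with s k1 k2
    rw [k1, k2]
    simp only [pow_two]
  have e2 : (fun s => inner ℝ (T τ.2.1 s) (T τ.1.1 s)) =ᵐ[μ01]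
      fun s => ∑ i, p i s * (D.adjProfile g s i * g s i) := by
    filter_upwards [hTT τ.2.1 τ.1.1, h1, h3] with s k1 k2 k3
    rw [k1, k2, k3]
  have key := hdiss g e hge ((MeasureTheory.L2.integrable_inner (𝕜 := ℝ) _ _).congr e1)
    ((MeasureTheory.L2.integrable_inner (𝕜 := ℝ) _ _).congr e2)
  rw [← integral_congr_ae e1, ← integral_congr_ae e2, ← MeasureTheory.L2.inner_def,
    ← MeasureTheory.L2.inner_def, ← h4, ← h2, dotProduct_eq_inner, dotProduct_eq_inner,
    ← hKK, ← hKK, real_inner_self_eq_norm_sq] at key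
  exact key

variable (D) in
/-- The homogeneous closed loop generates a strongly continuous semigroup. -/
theorem exists_flow (hinj : ∀ c : ℝ, 0 < c → ∀ x, D.LinRHS x (c • x) → x = 0) :
    Dense {x | ∃ y, D.LinRHS x y} ∧
    ∃ S : ℝ → State ℓ r m →L[ℝ] State ℓ r m, (∀ x, S 0 x = x) ∧ (∀ x, Continuous fun t => S t x) ∧
      (∀ b : ℝ, ∃ M, ∀ t ≤ b, ∀ x, ‖S t x‖ ≤ M * ‖x‖) ∧
      ∀ x y, D.LinRHS x y → ∀ t, 0 ≤ t →
        HasDerivWithinAt (fun s => S s x) (S t y) (Ici 0) t ∧ D.LinRHS (S t x) (S t y) := by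
  obtain ⟨J, K, β, hβ, hK, hJK, hdiss⟩ := D.exists_dissipative_coordinates
  -- Subtracting `β` makes the transported graph dissipative; the factor `exp (β t)` restores it in
  -- the semigroup.
  let A : State ℓ r m × State ℓ r m →ₗ[ℝ] WithLp 2 (L2 ℓ r × EuclideanSpace ℝ (Fin m)) ×
      WithLp 2 (L2 ℓ r × EuclideanSpace ℝ (Fin m)) :=
    ((K.toLinearMap ∘ₗ LinearMap.fst ℝ _ _).prod
      (K.toLinearMap ∘ₗ LinearMap.snd ℝ _ _ - β • (K.toLinearMap ∘ₗ LinearMap.fst ℝ _ _)))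
  have hA : ∀ τ, A τ = (K τ.1, K τ.2 - β • K τ.1) := fun τ => rfl
  let 𝒯 := D.adjointGraph.map A
  have hG : ∀ x y, AdjGraph 𝒯 (J x) (J y - β • J x) ↔ D.LinRHS x y := by
    intro x y
    rw [linRHS_iff]
    have key : ∀ τ, (inner ℝ (J x) (A τ).2 = inner ℝ (J y - β • J x) (A τ).1) ↔
        (inner ℝ x.1 τ.2.1 + inner ℝ x.2 τ.2.2 = inner ℝ y.1 τ.1.1 + inner ℝ y.2 τ.1.2) := by
      intro τ
      rw [hA]
      simp only [inner_sub_left, inner_sub_right, real_inner_smul_left, real_inner_smul_right, hJK]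
      constructor <;> intro h <;> linarith
    constructor
    · intro h τ hτ
      exact (key τ).1 (h _ (Submodule.mem_map_of_mem hτ))
    · rintro h _ ⟨τ, hτ, rfl⟩
      exact (key τ).2 (h τ hτ)
  have hG' : ∀ X Y, AdjGraph 𝒯 X Y → D.LinRHS (J.symm X) (J.symm (Y + β • X)) := by
    intro X Y h
    rw [← hG]
    simpa using h
  have hT : ∀ τ ∈ 𝒯, inner ℝ τ.2 τ.1 ≤ 0 := by
    rintro _ ⟨τ, hτ, rfl⟩
    have := hdiss τ hτ
    rw [hA, inner_sub_left, real_inner_smul_left, real_inner_self_eq_norm_sq]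
    linarith
  -- An eigenvalue `c` of the shifted relation is an eigenvalue `c + β > 0` of the original one.
  have hinj' : ∀ c : ℝ, 0 < c → ∀ X, AdjGraph 𝒯 X (c • X) → X = 0 := by
    intro c hc X h
    have h1 := hG' _ _ h
    rw [← add_smul, map_smul] at h1
    simpa using hinj (c + β) (by linarith) _ h1
  have hdense : Dense {X | ∃ Y, AdjGraph 𝒯 X Y} := by
    let P : Submodule ℝ (WithLp 2 (L2 ℓ r × EuclideanSpace ℝ (Fin m))) :=
      { carrier := {X | ∃ Y, AdjGraph 𝒯 X Y}
        add_mem' := fun ⟨Y, h⟩ ⟨Y', h'⟩ => ⟨_, h.add h'⟩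
        zero_mem' := ⟨0, fun τ _ => by simp⟩
        smul_mem' := fun c _ ⟨Y, h⟩ => ⟨_, h.smul c⟩ }
    change Dense (P : Set (WithLp 2 (L2 ℓ r × EuclideanSpace ℝ (Fin m))))
    rw [Submodule.dense_iff_topologicalClosure_eq_top, Submodule.topologicalClosure_eq_top_iff,
      Submodule.eq_bot_iff]
    intro Q hQ
    obtain ⟨q, rfl⟩ := hK Q
    rw [eq_zero_of_forall_linRHS (D := D) q, map_zero]
    intro x y hxy
    have h1 := hQ (J x) ⟨_, (hG x y).2 hxy⟩
    rw [hJK] at h1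
    rw [real_inner_comm, real_inner_comm x.2]
    exact h1
  refine ⟨?_, ?_⟩
  · have h1 := hdense.preimage J.toHomeomorph.isOpenMap
    refine h1.mono ?_
    rintro x ⟨Y, hY⟩
    have := hG' _ _ hY
    rw [show J.toHomeomorph x = J x from rfl, J.symm_apply_apply] at this
    exact ⟨_, this⟩
  obtain ⟨S, hSn, hS0, hSc, hSd⟩ := exists_semigroup 𝒯 hT hinj' hdense
  refine ⟨fun t => Real.exp (β * t) • (J.symm.toContinuousLinearMap.comp
    ((S t).comp J.toContinuousLinearMap)), fun x => ?_, fun x => ?_, fun b => ?_,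
    fun x y hxy t ht => ?_⟩
  · simp [hS0]
  · change Continuous fun t => Real.exp (β * t) • J.symm (S t (J x))
    exact (by fun_prop : Continuous fun t => Real.exp (β * t)).smul
      (J.symm.continuous.comp (hSc (J x)))
  · refine ⟨Real.exp (β * b) * (‖J.symm.toContinuousLinearMap‖ *
      ‖J.toContinuousLinearMap‖), fun t ht x => ?_⟩
    change ‖Real.exp (β * t) • J.symm (S t (J x))‖ ≤ _
    rw [norm_smul, Real.norm_of_nonneg (Real.exp_pos _).le, mul_assoc]
    gcongr
    rw [mul_assoc]
    refine (J.symm.toContinuousLinearMap.le_opNorm _).trans ?_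
    gcongr
    exact (hSn t _).trans (J.toContinuousLinearMap.le_opNorm x)
  · obtain ⟨h1, h2⟩ := hSd _ _ ((hG x y).2 hxy) t ht
    have e1 : S t (J y - β • J x) + β • S t (J x) = S t (J y) := by
      rw [map_sub, map_smul, sub_add_cancel]
    constructor
    · change HasDerivWithinAt (fun s => Real.exp (β * s) • J.symm (S s (J x)))
        (Real.exp (β * t) • J.symm (S t (J y))) (Ici 0) t
      have h3 : HasDerivAt (fun s => Real.exp (β * s)) (Real.exp (β * t) * β) t := by
        simpa using ((hasDerivAt_id t).const_mul β).exp
      have h4 : HasDerivWithinAt (fun s => J.symm (S s (J x)))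
          (J.symm (S t (J y - β • J x))) (Ici 0) t :=
        J.symm.toContinuousLinearMap.hasFDerivAt.comp_hasDerivWithinAt t h1
      refine (h3.hasDerivWithinAt.smul h4).congr_deriv ?_
      rw [← e1, map_add, map_smul, smul_add, smul_smul]
    · have h3 := (hG' _ _ h2).smul (Real.exp (β * t))
      rw [e1] at h3
      exact h3

/-! ### Regularity in the domain and the equilibrium. -/

/-- The weak derivative as a function of the state and of the right-hand side. -/
theorem exists_weakDeriv_op (D : ClosedLoop ℓ r m) :
    ∃ Q : State ℓ r m × State ℓ r m → L2 ℓ r, Continuous Q ∧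
      ∀ v δ h, D.IsRHS v δ h → δ = Q (v, h) := by
  obtain ⟨κ, hκ⟩ := D.exists_lam_inv_extension
  obtain ⟨T₁, hT₁⟩ := exists_mulOp (ℓ := ℓ) (r := r) D.Λ₁ fun i j => (D.Λ₁_C1 i j).continuousOn
  obtain ⟨T₀, hT₀⟩ := exists_mulOp (ℓ := ℓ) (r := r)
    (fun s => Matrix.diagonal fun i => κ i s) fun i j => by
      rcases eq_or_ne i j with rfl | hij
      · simpa using (hκ i).1.continuous.continuousOn
      · simpa [Matrix.diagonal_apply_ne _ hij] using continuousOn_const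
  refine ⟨fun p => -T₀ (p.2.1 + T₁ p.1.1), by fun_prop, fun v δ h hr => ?_⟩
  apply Lp.ext
  filter_upwards [hr.2.1, hT₁ v.1, hT₀ (h.1 + T₁ v.1), Lp.coeFn_neg (T₀ (h.1 + T₁ v.1)),
    Lp.coeFn_add h.1 (T₁ v.1), ae_μ01_of_forall fun s hs => hs] with s h0 h1 h2 h3 h4 hs
  ext i
  rw [h3, Pi.neg_apply, PiLp.neg_apply, h2, Matrix.mulVec_diagonal, h4, Pi.add_apply,
    WithLp.ofLp_add, h1, h0]
  simp only [sub_add_cancel, Pi.neg_apply, mulVec_Λ₀_apply]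
  linear_combination (-(δ s).ofLp i) * (hκ i).2 s (Ioo_subset_Icc_self hs)

/-- Compatible data lie in the domain of the closed-loop operator. -/
theorem Compatible.exists_isRHS {v₀ : State ℓ r m} (h : D.Compatible v₀) :
    ∃ δ k, D.IsRHS v₀ δ k := by
  obtain ⟨⟨δ, hδ⟩, f, hf, hbc⟩ := h
  obtain ⟨T₁, hT₁⟩ := exists_mulOp (ℓ := ℓ) (r := r) D.Λ₁ fun i j => (D.Λ₁_C1 i j).continuousOn
  obtain ⟨T₀, hT₀⟩ := exists_mulOp (ℓ := ℓ) (r := r) D.Λ₀ fun i j => by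
      rcases eq_or_ne i j with rfl | hij
      · simpa [Λ₀] using (D.lam_C1 i).continuousOn
      · simpa [Λ₀, Matrix.diagonal_apply_ne _ hij] using continuousOn_const
  refine ⟨δ, (-T₀ δ - T₁ v₀.1, D.output f - WithLp.toLp 2 D.yref), hδ, ?_, f, hf, hbc, rfl⟩
  filter_upwards [hT₀ δ, hT₁ v₀.1, Lp.coeFn_sub (-T₀ δ) (T₁ v₀.1), Lp.coeFn_neg (T₀ δ)]
    with s h1 h2 h3 h4
  rw [h3, Pi.sub_apply, h4, Pi.neg_apply, WithLp.ofLp_sub, WithLp.ofLp_neg, h1, h2]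

/-- The rank condition provides an equilibrium. -/
theorem RankCondition.exists_equilibrium (h : D.RankCondition) : ∃ v, D.IsEquilibrium v := by
  obtain ⟨Φ, ⟨hΦ0, hΦ⟩, hM, hT⟩ := h
  set P := plusPart (Φ 1)
  set N := minusPart (Φ 1)
  set A := D.L₁ * N + D.L₂ * P
  set M := N - D.K * P
  -- The input solving `T₁ u = yref - wy - A M⁻¹ wb`; `z` is recovered from it by inverting the
  -- feedback gain.
  let u : Fin m → ℝ := (A * M⁻¹ * D.B)⁻¹ *ᵥ (D.yref - D.wy - A *ᵥ (M⁻¹ *ᵥ D.wb))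
  let z : EuclideanSpace ℝ (Fin m) := WithLp.toLp 2 (D.Ki⁻¹ *ᵥ (D.ki⁻¹ • u))
  have hu : D.ki • (D.Ki *ᵥ z.ofLp) = u := by
    simp only [z]
    rw [Matrix.mulVec_mulVec, Matrix.mul_nonsing_inv _ D.Ki_full_rank, Matrix.one_mulVec,
      smul_inv_smul₀ D.ki_pos.ne']
  -- The value of the profile at `s = 0`. The traces of `Φ c` are `N c` and `P c`, so the boundary
  -- condition reads `M c = B u + wb`.
  let c : Idx ℓ r → ℝ := M⁻¹ *ᵥ (D.B *ᵥ u + D.wb)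
  have hact : D.actuation z = D.B *ᵥ u + D.wb := by rw [actuation, hu]
  have hMc : M *ᵥ c = D.actuation z := by
    rw [hact, Matrix.mulVec_mulVec, Matrix.mul_nonsing_inv _ hM, Matrix.one_mulVec]
  have hAc : A *ᵥ c = D.yref - D.wy := by
    have h1 : (A * M⁻¹ * D.B) *ᵥ u = D.yref - D.wy - A *ᵥ (M⁻¹ *ᵥ D.wb) := by
      rw [Matrix.mulVec_mulVec, Matrix.mul_nonsing_inv _ hT, Matrix.one_mulVec]
    have h2 : A *ᵥ c = (A * M⁻¹ * D.B) *ᵥ u + A *ᵥ (M⁻¹ *ᵥ D.wb) := by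
      simp only [c, Matrix.mulVec_add, Matrix.mulVec_mulVec, Matrix.mul_assoc]
    rw [h2, h1, sub_add_cancel]
  have hΦc : ∀ i j, ContinuousOn (fun s => Φ s i j) (Icc 0 1) := fun i j s hs =>
    (hΦ s hs i j).continuousWithinAt
  let f : ℝ → EuclideanSpace ℝ (Idx ℓ r) := fun s => WithLp.toLp 2 (Φ s *ᵥ c)
  have hfc : ContinuousOn f (Icc 0 1) := by
    refine (PiLp.continuous_toLp 2 _).comp_continuousOn (continuousOn_pi.2 fun i => ?_)
    simp only [Matrix.mulVec, dotProduct]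
    exact continuousOn_finsetSum _ fun j _ => (hΦc i j).mul continuousOn_const
  obtain ⟨φ, hφ⟩ : ∃ φ : L2 ℓ r, ∀ᵐ s ∂μ01, φ s = f s := by
    obtain ⟨φ, hφ⟩ := exists_cls (ℓ := ℓ) (r := r)
      (fun s => (IccExtend (zero_le_one' ℝ) (domRestrict (Icc 0 1) f) s).ofLp)
      ((PiLp.continuous_ofLp 2 _).comp
        (continuousOn_iff_continuous_domRestrict.1 hfc).Icc_extend')
    refine ⟨φ, ?_⟩
    filter_upwards [hφ, ae_μ01_of_forall fun s hs => hs] with s h1 hs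
    rw [IccExtend_of_mem _ _ (Ioo_subset_Icc_self hs)] at h1
    exact WithLp.ofLp_injective 2 h1
  have hinv : ∀ s ∈ Icc (0 : ℝ) 1, (D.Λ₀ s)⁻¹ = Matrix.diagonal fun i => (D.lam i s)⁻¹ := by
    intro s hs
    refine Matrix.inv_eq_right_inv ?_
    rw [Λ₀, Matrix.diagonal_mul_diagonal, ← Matrix.diagonal_one]
    congr 1
    ext i
    exact mul_inv_cancel₀ (D.lam_ne_zero i hs)
  have hGc : ∀ i j, ContinuousOn (fun s => (-((D.Λ₀ s)⁻¹ * D.Λ₁ s)) i j) (Icc 0 1) := by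
    intro i j
    have h1 : ContinuousOn (fun s => -((D.lam i s)⁻¹ * D.Λ₁ s i j)) (Icc 0 1) :=
      (((D.lam_C1 i).continuousOn.inv₀ fun s hs => D.lam_ne_zero i hs).mul
        (D.Λ₁_C1 i j).continuousOn).neg
    refine h1.congr fun s hs => ?_
    simp only [hinv s hs, Matrix.neg_apply, Matrix.diagonal_mul]
  obtain ⟨G, hG⟩ := exists_mulOp (ℓ := ℓ) (r := r) _ hGc
  have hfd : ∀ s ∈ Icc (0 : ℝ) 1, ∀ i, HasDerivWithinAt (fun σ => f σ i)
      ((-((D.Λ₀ s)⁻¹ * D.Λ₁ s) *ᵥ (f s).ofLp) i) (Icc 0 1) s := by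
    intro s hs i
    have h1 : HasDerivWithinAt (fun σ => ∑ j, Φ σ i j * c j)
        (∑ j, (-((D.Λ₀ s)⁻¹ * D.Λ₁ s * Φ s)) i j * c j) (Icc 0 1) s :=
      HasDerivWithinAt.fun_sum fun j _ => (hΦ s hs i j).mul_const (c j)
    refine h1.congr_deriv ?_
    simp only [f, Matrix.mulVec_mulVec, Matrix.neg_mul]
    rfl
  have hprim : ∀ s ∈ Icc (0 : ℝ) 1, f s = primitive (f 0) (G φ) s := by
    intro s hs
    ext i
    rw [primitive_apply _ _ hs]
    have hsub : Icc 0 s ⊆ Icc (0 : ℝ) 1 := Icc_subset_Icc_right hs.2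
    have hc : ContinuousOn (fun σ => (-((D.Λ₀ σ)⁻¹ * D.Λ₁ σ) *ᵥ (f σ).ofLp) i) (Icc 0 1) := by
      simp only [Matrix.mulVec, dotProduct]
      refine continuousOn_finsetSum _ fun j _ => (hGc i j).mul ?_
      exact (continuous_apply j).comp_continuousOn ((PiLp.continuous_ofLp 2 _).comp_continuousOn hfc)
    have h1 : ∫ σ in (0 : ℝ)..s, G φ σ i =
        ∫ σ in (0 : ℝ)..s, (-((D.Λ₀ σ)⁻¹ * D.Λ₁ σ) *ᵥ (f σ).ofLp) i := by
      refine intervalIntegral.integral_congr_ae ?_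
      have h2 := (ae_restrict_iff' measurableSet_Ioo).1 (hG φ)
      have h2' := (ae_restrict_iff' measurableSet_Ioo).1 hφ
      have h3 : ∀ᵐ σ : ℝ, σ ≠ 1 := by simp [ae_iff]
      filter_upwards [h2, h2', h3] with σ h4 h4' h5 h6
      rw [uIoc_of_le hs.1] at h6
      have h7 : σ ∈ Ioo (0 : ℝ) 1 := ⟨h6.1, lt_of_le_of_ne (h6.2.trans hs.2) h5⟩
      rw [h4 h7, h4' h7]
    have h2 := intervalIntegral.integral_eq_sub_of_hasDerivAt_of_le (f := fun σ => f σ i) hs.1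
      (fun σ hσ => ((hfd σ (hsub hσ) i).mono hsub).continuousWithinAt)
      (fun σ hσ => ((hfd σ (hsub (Ioo_subset_Icc_self hσ)) i).mono hsub).hasDerivAt
        (Icc_mem_nhds hσ.1 hσ.2))
      ((hc.mono hsub).intervalIntegrable_of_Icc hs.1)
    rw [h1, h2]
    ring
  have hin : inflow f = N *ᵥ c := by
    ext (i | i)
    · simp [inflow, f, hΦ0, N, minusPart, Matrix.fromBlocks_mulVec]
    · simp [inflow, f, N, minusPart, Matrix.mulVec, dotProduct]
      rfl
  have hout : outflow f = P *ᵥ c := by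
    ext (i | i)
    · simp [outflow, f, P, plusPart, Matrix.mulVec, dotProduct]
      rfl
    · simp [outflow, f, hΦ0, P, plusPart, Matrix.fromBlocks_mulVec]
  refine ⟨(φ, z), G φ, ?_, ?_, f, ⟨hfc, hφ⟩, ?_, ?_⟩
  · refine hasWeakDeriv_of_primitive (c := f 0) ?_
    filter_upwards [hφ, ae_μ01_of_forall fun s hs => hs] with s h1 hs
    rw [h1, hprim s (Ioo_subset_Icc_self hs)]
  · filter_upwards [hG φ, Lp.coeFn_zero (EuclideanSpace ℝ (Idx ℓ r)) 2 μ01,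
      ae_μ01_of_forall fun s hs => hs] with s h1 h2 hs
    rw [Prod.fst_zero, h2, h1, hinv s (Ioo_subset_Icc_self hs)]
    have h3 : D.Λ₀ s * (Matrix.diagonal fun i => (D.lam i s)⁻¹) = 1 := by
      rw [Λ₀, Matrix.diagonal_mul_diagonal, ← Matrix.diagonal_one]
      congr 1
      ext i
      exact mul_inv_cancel₀ (D.lam_ne_zero i (Ioo_subset_Icc_self hs))
    rw [Matrix.mulVec_mulVec, Matrix.mul_neg, ← Matrix.mul_assoc, h3, Matrix.one_mul,
      Matrix.neg_mulVec, neg_neg, sub_self]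
    rfl
  · rw [BC, hin, hout, ← hMc, Matrix.sub_mulVec, ← Matrix.mulVec_mulVec]
    abel
  · rw [eq_comm, Prod.snd_zero, sub_eq_zero, output, hin, hout]
    congr 1
    have h1 : D.L₁ *ᵥ (N *ᵥ c) + D.L₂ *ᵥ (P *ᵥ c) = A *ᵥ c := by
      simp only [A, Matrix.add_mulVec, Matrix.mulVec_mulVec]
    rw [h1, hAc, sub_add_cancel]

/-! ### Limits of weak solutions and the conclusion. -/

theorem continuous_pairCLM {X : Type*} [TopologicalSpace X] {u : X → L2 ℓ r}
    {z : X → EuclideanSpace ℝ (Fin m)} (hu : Continuous u) (hz : Continuous z) :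
    Continuous fun x => pairCLM (u x) (z x) := by
  unfold pairCLM
  exact (((innerSL ℝ).continuous.comp hu).clm_comp continuous_const).add
    (((innerSL ℝ).continuous.comp hz).clm_comp continuous_const)

theorem continuous_testIn {ψ : ℝ → ℝ → Idx ℓ r → ℝ}
    (hψ : Continuous fun p : ℝ × ℝ => ψ p.1 p.2) : Continuous fun t => D.testIn (ψ t) := by
  have h : ∀ s i, Continuous fun t => ψ t s i := fun s i =>
    (continuous_apply i).comp (hψ.comp (continuous_id.prodMk continuous_const))
  refine continuous_pi ?_
  rintro (i | i)
  · exact (continuous_const.mul (h 0 _)).neg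
  · exact continuous_const.mul (h 1 _)

/-- The integrand of the weak formulation is a continuous family of affine functionals. -/
theorem IsTest.exists_weakForm {T : ℝ} {ψ : ℝ → ℝ → Idx ℓ r → ℝ} {η : ℝ → Fin m → ℝ}
    (h : D.IsTest T ψ η) : ∃ (F : ℝ → State ℓ r m →L[ℝ] ℝ) (k : ℝ → ℝ), Continuous F ∧
      Continuous k ∧ ∀ t v, pairing v (D.adjointExpr ψ t) (deriv η t)
        - (D.testIn (ψ t) - D.L₁ᵀ *ᵥ η t) ⬝ᵥ D.actuation v.2 + η t ⬝ᵥ (D.wy - D.yref) =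
          F t v + k t := by
  obtain ⟨Ψ, Ψ', hΨ'c, -, -, hΨ'⟩ := exists_test_curves h.1
  obtain ⟨A, hAc, hA⟩ := D.exists_adjProfile_curve ψ h.1
  have hin : Continuous fun t => D.testIn (ψ t) := continuous_testIn h.1.continuous
  have hη : Continuous η := h.2.1.continuous
  have hdiff : Continuous fun t => D.testIn (ψ t) - D.L₁ᵀ *ᵥ η t :=
    hin.sub (continuous_const.matrix_mulVec hη)
  have hZ : Continuous fun t => deriv η t + D.adjZ (ψ t) (η t) :=
    (h.2.1.continuous_deriv le_rfl).add
      ((continuous_const.matrix_mulVec (continuous_const.matrix_mulVec hdiff)).const_smul D.ki).neg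
  refine ⟨fun t => pairCLM (Ψ' t + A t) (WithLp.toLp 2 (deriv η t + D.adjZ (ψ t) (η t))),
    fun t => D.source (ψ t) (η t),
    continuous_pairCLM (hΨ'c.add hAc) ((PiLp.continuous_toLp 2 _).comp hZ),
    (hη.dotProduct continuous_const).sub (hdiff.dotProduct continuous_const), fun t v => ?_⟩
  rw [weakForm_eq]
  congr 1
  refine pairing_eq_pairCLM _ _ _ ?_
  filter_upwards [hΨ' t, hA t, Lp.coeFn_add (Ψ' t) (A t)] with s h2 h3 h4
  rw [h4, Pi.add_apply, WithLp.ofLp_add, h2, h3, adjointExpr_eq h.1]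

/-- Locally bounded pointwise limits of weak solutions are weak solutions. -/
theorem isWeakSol_of_tendsto {v₀ : State ℓ r m} {v : ℝ → State ℓ r m} {x : ℕ → State ℓ r m}
    {w : ℕ → ℝ → State ℓ r m} (hw : ∀ n, D.IsWeakSol (x n) (w n)) (hv0 : v 0 = v₀)
    (hvc : ContinuousOn v (Ici 0))
    (hlim : ∀ t, 0 ≤ t → Tendsto (fun n => w n t) atTop (𝓝 (v t)))
    (hbd : ∀ T : ℝ, ∃ M, ∀ n, ∀ t ∈ Icc 0 T, ‖w n t‖ ≤ M) : D.IsWeakSol v₀ v := by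
  refine ⟨hv0, hvc, fun T hT ψ η htest => ?_⟩
  obtain ⟨F, k, hF, hk, hFk⟩ := htest.exists_weakForm
  have hx : Tendsto x atTop (𝓝 v₀) := by
    have := hlim 0 le_rfl
    simpa only [(hw _).1, hv0] using this
  obtain ⟨u, hu⟩ := exists_cls (ψ T) (htest.static ⟨hT.le, le_rfl⟩).1.continuous
  obtain ⟨u₀, hu₀⟩ := exists_cls (ψ 0) (htest.static ⟨le_rfl, hT.le⟩).1.continuous
  have hid : ∀ n, pairCLM u (WithLp.toLp 2 (η T)) (w n T) -
      pairCLM u₀ (WithLp.toLp 2 (η 0)) (x n) = ∫ t in (0 : ℝ)..T, (F t (w n t) + k t) := by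
    intro n
    rw [← pairing_eq_pairCLM _ _ _ hu, ← pairing_eq_pairCLM _ _ _ hu₀,
      (hw n).2.2 T hT ψ η htest]
    simp only [hFk]
  simp only [hFk]
  rw [pairing_eq_pairCLM _ _ _ hu, pairing_eq_pairCLM _ _ _ hu₀]
  refine tendsto_nhds_unique ((((ContinuousLinearMap.continuous _).tendsto _).comp
    (hlim T hT.le)).sub (((ContinuousLinearMap.continuous _).tendsto _).comp hx)) ?_
  simp only [Function.comp_apply, hid]
  obtain ⟨M, hM⟩ := hbd T
  obtain ⟨C, hC⟩ := (isCompact_Icc (a := 0) (b := T)).exists_bound_of_continuousOn hF.continuousOn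
  obtain ⟨C', hC'⟩ := (isCompact_Icc (a := 0) (b := T)).exists_bound_of_continuousOn hk.continuousOn
  -- The test functionals are bounded on the compact `[0,T]` and the solutions are uniformly bounded
  -- there, which gives a constant dominating function.
  refine intervalIntegral.tendsto_integral_filter_of_dominated_convergence (fun _ => C * M + C')
    (Eventually.of_forall fun n => ?_) (Eventually.of_forall fun n =>
      Eventually.of_forall fun t ht => ?_) intervalIntegrable_const
    (Eventually.of_forall fun t ht => ?_)
  · rw [uIoc_of_le hT.le]
    refine ContinuousOn.aestronglyMeasurable ?_ measurableSet_Ioc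
    exact ((hF.continuousOn.clm_apply ((hw n).2.1.mono fun t ht => ht.1.le)).add hk.continuousOn)
  · rw [uIoc_of_le hT.le] at ht
    have ht' := Ioc_subset_Icc_self ht
    refine (norm_add_le _ _).trans (add_le_add ?_ (hC' t ht'))
    have hC0 : 0 ≤ C := (norm_nonneg _).trans (hC t ht')
    exact ((F t).le_opNorm _).trans (mul_le_mul (hC t ht') (hM n t ht') (norm_nonneg _) hC0)
  · rw [uIoc_of_le hT.le] at ht
    exact (((F t).continuous.tendsto _).comp (hlim t ht.1.le)).add_const _

theorem IsStrongSol.hasDerivWithinAt {v₀ : State ℓ r m} {v : ℝ → State ℓ r m}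
    (h : D.IsStrongSol v₀ v) {t : ℝ} (ht : 0 ≤ t) :
    HasDerivWithinAt v (derivWithin v (Ici 0) t) (Ici 0) t :=
  (h.2.1.differentiableOn one_ne_zero t ht).hasDerivWithinAt

theorem IsStrongSol.isWeakSol {v₀ : State ℓ r m} {v : ℝ → State ℓ r m} (h : D.IsStrongSol v₀ v) :
    D.IsWeakSol v₀ v := by
  have h1 := isWeakSol_of_hasDerivWithinAt (D := D) (fun t ht => h.hasDerivWithinAt ht)
    (h.2.1.continuousOn_derivWithin (uniqueDiffOn_Ici 0) le_rfl) fun t ht => by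
      obtain ⟨δ, -, hδ⟩ := h.2.2
      exact IsRHS.weakRHS D (hδ t ht)
  rwa [h.1] at h1

/-- Under the rank and Lyapunov conditions the closed loop is well posed, its unique equilibrium is
globally exponentially stable, and its output is regulated. -/
theorem wellPosed_and_expStable_and_regulated
    (hrank : D.RankCondition)
    (hV : ∀ vinf : State ℓ r m, D.IsEquilibrium vinf →
      ∃ (Ve : State ℓ r m → ℝ) (Le μe : ℝ), 0 < Le ∧ 0 < μe ∧ D.IsLyapunov vinf Ve Le μe) :
    D.WellPosed ∧
    (∃ vinf : State ℓ r m, D.IsEquilibrium vinf ∧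
      (∀ v, D.IsEquilibrium v → v = vinf) ∧ D.ExpStable vinf) ∧
    D.Regulated := by
  obtain ⟨vinf, heq⟩ := hrank.exists_equilibrium
  obtain ⟨V, L, μ, hL, hμ, hLyap⟩ := hV vinf heq
  -- An eigenvector for `c > 0` would generate the homogeneous solution `exp (c t) x`; its decay at
  -- rate `μ / 2` forces `x = 0`.
  have hinj : ∀ c : ℝ, 0 < c → ∀ x, D.LinRHS x (c • x) → x = 0 := by
    intro c hc x hx
    have hd : ∀ t : ℝ, HasDerivAt (fun t => Real.exp (c * t) • x)
        (Real.exp (c * t) • c • x) t := fun t => by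
      have h3 : HasDerivAt (fun s => Real.exp (c * s)) (Real.exp (c * t) * c) t := by
        simpa using ((hasDerivAt_id t).const_mul c).exp
      simpa [mul_smul] using h3.smul_const x
    have h1 : ∀ t, 0 ≤ t → stateNorm x ≤
        L * Real.exp (-(μ / 2 + c) * t) * stateNorm x := by
      intro t ht
      have h2 := hLyap.decay_lin hL heq (fun t _ => (hd t).hasDerivWithinAt)
        (by fun_prop) (fun t _ => hx.smul (Real.exp (c * t))) ht
      simp only [mul_zero, Real.exp_zero, one_smul] at h2
      rw [stateNorm_smul, abs_of_pos (Real.exp_pos _)] at h2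
      have h3 := mul_le_mul_of_nonneg_left h2 (Real.exp_pos (-(c * t))).le
      rw [← mul_assoc, ← Real.exp_add, neg_add_cancel, Real.exp_zero, one_mul] at h3
      refine h3.trans (le_of_eq ?_)
      rw [show -(μ / 2 + c) * t = -(c * t) + -(μ / 2) * t by ring, Real.exp_add]
      ring
    have h4 : Tendsto (fun t : ℝ => L * Real.exp (-(μ / 2 + c) * t) * stateNorm x)
        atTop (𝓝 (L * 0 * stateNorm x)) := by
      refine ((Real.tendsto_exp_atBot.comp ?_).const_mul L).mul_const _
      exact tendsto_id.const_mul_atTop_of_neg (by linarith)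
    rw [mul_zero, zero_mul] at h4
    refine eq_of_stateNorm_sub_le_zero (w := 0) ?_
    rw [sub_zero]
    refine ge_of_tendsto h4 ?_
    filter_upwards [eventually_ge_atTop 0] with t ht
    exact h1 t ht
  obtain ⟨hdense, S, hS0, hSc, hSb, hSd⟩ := D.exists_flow hinj
  -- For fixed `t` both sides are continuous in `x`, so the estimate extends from the dense domain.
  have hSdecay : ∀ x t, 0 ≤ t →
      stateNorm (S t x) ≤ L * Real.exp (-(μ / 2) * t) * stateNorm x := by
    intro x t ht
    have hcl : IsClosed {x : State ℓ r m | stateNorm (S t x) ≤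
        L * Real.exp (-(μ / 2) * t) * stateNorm x} :=
      isClosed_le (continuous_stateNorm.comp (S t).continuous)
        (continuous_const.mul continuous_stateNorm)
    refine hcl.closure_subset_iff.2 ?_ (hdense x)
    rintro y ⟨y', hy⟩
    have := hLyap.decay_lin hL heq (fun t ht => (hSd y y' hy t ht).1) (hSc y').continuousOn
      (fun t ht => (hSd y y' hy t ht).2) ht
    rwa [hS0] at this
  have hC1 : ∀ x y, D.LinRHS x y → ∀ t, 0 ≤ t →
      HasDerivWithinAt (fun t => vinf + S t x) (S t y) (Ici 0) t ∧
        D.WeakRHS (vinf + S t x) (S t y) := by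
    intro x y hxy t ht
    refine ⟨(hSd x y hxy t ht).1.const_add vinf, ?_⟩
    simpa using heq.weakRHS.add_lin (hSd x y hxy t ht).2
  have hweakC1 : ∀ x y, D.LinRHS x y → D.IsWeakSol (vinf + x) fun t => vinf + S t x := by
    intro x y hxy
    have := isWeakSol_of_hasDerivWithinAt (D := D) (fun t ht => (hC1 x y hxy t ht).1)
      (hSc y).continuousOn fun t ht => (hC1 x y hxy t ht).2
    simpa only [hS0] using this
  have hweak : ∀ v₀, D.IsWeakSol v₀ fun t => vinf + S t (v₀ - vinf) := by
    intro v₀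
    obtain ⟨x, hx, hxlim⟩ := mem_closure_iff_seq_limit.1 (hdense (v₀ - vinf))
    choose y hy using hx
    obtain ⟨B, hB⟩ := hxlim.norm.bddAbove_range
    refine isWeakSol_of_tendsto (fun n => hweakC1 _ _ (hy n)) (by simp [hS0])
      (continuous_const.add (hSc _)).continuousOn
      (fun t _ => tendsto_const_nhds.add (((S t).continuous.tendsto _).comp hxlim)) fun T => ?_
    obtain ⟨M, hM⟩ := hSb T
    refine ⟨‖vinf‖ + |M| * B, fun n t ht => (norm_add_le _ _).trans ?_⟩
    gcongr
    exact (hM t ht.2 _).trans (mul_le_mul (le_abs_self M) (hB ⟨n, rfl⟩) (norm_nonneg _)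
      (abs_nonneg M))
  have huniq : ∀ v₀ v, D.IsWeakSol v₀ v →
      EqOn v (fun t => vinf + S t (v₀ - vinf)) (Ici 0) := fun v₀ v hv =>
    hLyap.weakSol_unique hL heq (hweak v₀) hv
  have hdom : ∀ v₀, D.Compatible v₀ → ∃ y, D.LinRHS (v₀ - vinf) y := by
    intro v₀ hv₀
    obtain ⟨δ, k, hk⟩ := hv₀.exists_isRHS
    exact ⟨_, (IsRHS.weakRHS D hk).sub heq.weakRHS⟩
  refine ⟨⟨fun v₀ => ⟨_, hweak v₀, huniq v₀⟩, fun v₀ hv₀ => ?_⟩, ⟨vinf, heq, fun v hv =>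
    hLyap.equilibrium_unique hL hμ hv, L, μ / 2, hL, by positivity, fun v₀ v hv t ht => ?_⟩, ?_⟩
  · obtain ⟨y, hy⟩ := hdom v₀ hv₀
    -- Continuity in time with values in H¹: `Q` recovers the spatial derivative continuously from
    -- the state and its time derivative.
    obtain ⟨Q, hQ, hQeq⟩ := D.exists_weakDeriv_op
    have hder := fun t ht => (hC1 _ y hy t ht).1
    refine ⟨_, ⟨by simp [hS0], contDiffOn_of_hasDerivWithinAt hder (hSc y).continuousOn,
      fun t => Q (vinf + S t (v₀ - vinf), S t y), ?_, fun t ht => ?_⟩, hweak v₀,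
      fun w hw => huniq v₀ w hw.isWeakSol⟩
    · exact (hQ.comp ((continuous_const.add (hSc _)).prodMk (hSc y))).continuousOn
    · rw [(hder t ht).derivWithin (uniqueDiffOn_Ici 0 t ht)]
      obtain ⟨δ, hδ⟩ := (hC1 _ y hy t ht).2.exists_isRHS
      dsimp only
      rwa [← hQeq _ _ _ hδ]
  · rw [huniq v₀ v hv ht, add_sub_cancel_left]
    exact hSdecay _ t ht
  · intro v₀ hv₀ v hv
    obtain ⟨y, hy⟩ := hdom v₀ hv₀
    have hEq := huniq v₀ v hv.isWeakSol
    have hder : ∀ t, 0 ≤ t → derivWithin v (Ici 0) t = S t y := fun t ht =>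
      (((hC1 _ y hy t ht).1.congr hEq (hEq ht))).derivWithin (uniqueDiffOn_Ici 0 t ht)
    obtain ⟨δ, -, hδ⟩ := hv.2.2
    -- The equation for `z` is read backwards: the output is `yref` plus the second component of the
    -- time derivative, which is the decaying orbit of `y`.
    refine ⟨fun t => (S t y).2 + WithLp.toLp 2 D.yref, fun t ht => ?_, ?_⟩
    · obtain ⟨h1, -, f, hf, -, hout⟩ := hδ t ht
      refine ⟨⟨_, h1⟩, f, hf, ?_⟩
      dsimp only
      rw [← hder t ht, hout, sub_add_cancel]
    · have h4 : Tendsto (fun t : ℝ => L * Real.exp (-(μ / 2) * t) * stateNorm y)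
          atTop (𝓝 (L * 0 * stateNorm y)) := by
        refine ((Real.tendsto_exp_atBot.comp ?_).const_mul L).mul_const _
        exact tendsto_id.const_mul_atTop_of_neg (by linarith)
      rw [mul_zero, zero_mul] at h4
      refine squeeze_zero' (Eventually.of_forall fun t => norm_nonneg _) ?_ h4
      filter_upwards [eventually_ge_atTop 0] with t ht
      rw [add_sub_cancel_right]
      refine le_trans ?_ (hSdecay y t ht)
      rw [stateNorm]
      exact le_add_of_nonneg_left (norm_nonneg _)

end ClosedLoop

end HypReg

end

theorem mainTheorem6 {ℓ r m : ℕ} (D : HypReg.ClosedLoop ℓ r m)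
    (hrank : D.RankCondition)
    (hV : ∀ vinf : HypReg.State ℓ r m, D.IsEquilibrium vinf →
      ∃ (Ve : HypReg.State ℓ r m → ℝ) (Le μe : ℝ),
        0 < Le ∧ 0 < μe ∧ D.IsLyapunov vinf Ve Le μe) :
    D.WellPosed ∧
    (∃ vinf : HypReg.State ℓ r m, D.IsEquilibrium vinf ∧
      (∀ v, D.IsEquilibrium v → v = vinf) ∧ D.ExpStable vinf) ∧
    D.Regulated :=
  HypReg.ClosedLoop.wellPosed_and_expStable_and_regulated hrank hV
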